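/- Let $X=\{0,1\}$ and let $\mathrm{Aut}(X^*)$ be the automorphism group of the binary rooted tree of finite words, acting on the right; write $\langle g_0,g_1\rangle$ for the automorphism $0u\mapsto 0u^{g_0}$, $1u\mapsto 1u^{g_1}$, and $\sigma$ for the automorphism that changes the first letter. Put $g^h=h^{-1}gh$ and $[g,h]=g^{-1}h^{-1}gh$. Let $w=y_1\dots y_k$ and $v=x_1\dots x_n$ be non-empty words over $X$ with $y_k\neq x_n$ and $(k,n)\neq(1,1)$. The group $K(w,v)\le \mathrm{Aut}(X^*)$ is generated by $b_1=\sigma$; $b_{j+1}=\langle b_j,1\rangle$ if $y_j=0$ and $\langle 1,b_j\rangle$ if $y_j=1$ ($1\le j<k$); $a_1=\langle b_k,a_n\rangle$ if $x_n=1$ and $\langle a_n,b_k\rangle$ if $x_n=0$; $a_{i+1}=\langle a_i,1\rangle$ if $x_i=0$ and $\langle 1,a_i\rangle$ if $x_i=1$ ($1\le i<n$). Let $d$ be maximal such that $v=u^d$ for some word $u$, and let $$F=\langle a_1,\dots,a_n,b_1,\dots,b_k\mid a_i^2,\ b_j^2,\ [a_i,a_{i+\ell n/d}]\ (1\le i\le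 n,\ 1\le j\le k,\ 1\le \ell<d)\rangle,$$ with the indices of the $a$'s modulo $n$. The formulas above define a homomorphism $\Psi:F\to F\wr\mathfrak S_2$ (where $\mathfrak S_2=\{1,\sigma\}$). Choose $s,t\in F$ and $m$ such that $\Psi(a_1^t)=\langle b_k,a_n^s\rangle$ and: * if $k,n\ge2$: $m=1$, $s\in\langle b_1\rangle$ with $[a_n^s,b_k]=1$ in $K(w,v)$, and $t\in\langle b_1,b_2\rangle$; * if $k\ge3$, $n=1$: $m=1$, $s\in\langle b_1,b_2\rangle$ with $[a_1^s,b_k]=1$ in $K(w,v)$, and $t\in\langle b_1,b_2,b_3\rangle$; * if $k=2$, $n=1$: $m=2$, $s\in\langle b_1\rangle$ such that for some $r\in\langle b_1\rangle$ one has $\Psi(b_2^r)=\langle b_1,1\rangle$ and $\Psi(a_1^{rs})=\langle b_2,a_1\rangle$, and $t\in\langle b_1,b_2\rangle$; * if $k=1$, $n\ge2$: $m=2$, $s=1$ and $t\in\langle b_1\rangle$. Let $\varphi=\varphi_t$ be the endomorphism of $F$ with $\varphi(b_j)=b_{j+1}$ if $y_j=0$ and $b_{j+1}^{b_1}$ if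 $y_j=1$ (for $j<k$), $\varphi(b_k)=a_1^t$, and $\varphi(a_i)=a_{i+1}$ if $x_i=0$ and $a_{i+1}^{b_1}$ if $x_i=1$ (for $1\le i\le n$, with $a_{n+1}=a_1$). Let $\overline F$ be the quotient of $F$ by the normal closure of $\{\varphi^\ell(a_n^sb_k)^{2^m}:\ell\ge0\}$; then $\varphi$ induces an endomorphism of $\overline F$. Let $O$ (respectively $E$) be the set of elements of $\langle a_1^t,b_1\rangle\le\overline F$ that are products of $a_1^t$'s and $b_1$'s with an odd (respectively even) number of factors $b_1$, and let $\mathcal R\subset\overline F$ be the union of * $[b_i,b_j^u]$, $2\le i,j\le k$, $u\in O$ if $y_{i-1}=y_{j-1}$, $u\in E$ if $y_{i-1}\ne y_{j-1}$; * $[a_i,b_j^u]$, $2\le i\le n$, $2\le j\le k$, $u\in O$ if $x_{i-1}=y_{j-1}$, $u\in E$ if $x_{i-1}\ne y_{j-1}$; * $[a_i,a_j^u]$, $2\le i,j\le n$, $u\in O$ if $x_{i-1}=x_{j-1}$, $u\in E$ if $x_{i-1}\ne x_{j-1}$. Then there are choices of $s,t,m$ as above for which moreover $\varphi(s)\in\{tb_1,\,b_1tb_1\}$.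 For every choice of $s,t,m$ as above, $K(w,v)$ has the presentation $$K(w,v)=\Big\langle a_1,\dots,a_n,b_1,\dots,b_k\ \Big|\ \{\text{relations of }\overline F\}\cup\varphi^\ell(\mathcal R)\text{ for all }\ell\ge0\Big\rangle ,$$ the generators of the presentation corresponding to the generators of $K(w,v)$ of the same name. If moreover $\varphi(s)\in\{tb_1,b_1tb_1\}$, then $\langle a_1^t,b_1\rangle\le\overline F$ is dihedral of order $2^{m+2}$ and $\mathcal R$ is finite. -/

import Mathlib

noncomputable section

namespace KneadingGroup

/-- `g ^ h = h⁻¹ g h`. -/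
def cj {G : Type*} [Group G] (g h : G) : G := h⁻¹ * g * h

/-- `[g, h] = g⁻¹ h⁻¹ g h`. -/
def cm {G : Type*} [Group G] (g h : G) : G := g⁻¹ * h⁻¹ * g * h

/-- Commuting elements have a trivial commutator. -/
theorem cm_eq_one {G : Type*} [Group G] {g h : G} (e : g * h = h * g) : cm g h = 1 := by
  unfold cm
  rw [mul_assoc (g⁻¹ * h⁻¹), e]
  group

/-- The symbols `a_1, …, a_n, b_1, …, b_k`; the index `i : Fin n` stands for `a_{i+1}`, and
similarly for `b`. -/
inductive Gen (k n : ℕ) : Type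
  | a (i : Fin n) : Gen k n
  | b (j : Fin k) : Gen k n

/-- The last position of a non-empty word. -/
def lastPos (n : ℕ) [NeZero n] : Fin n := ⟨n - 1, Nat.sub_lt (NeZero.pos n) one_pos⟩

section

variable {k n : ℕ} [NeZero k] [NeZero n] (w : Fin k → Bool) (v : Fin n → Bool)

/-! Letters `0` and `1` are `false` and `true`. The words are `w = y_1 … y_k` and
`v = x_1 … x_n`, so that `y_j` is `w` at position `j - 1` and `x_i` is `v` at position `i - 1`. -/

/-- The coordinates of the generators: if `g = ⟨g_0, g_1⟩` or `g = ⟨g_0, g_1⟩ σ`, then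
`coord w v g c` is `g_c`, where `none` stands for the trivial element. -/
def coord : Gen k n → Bool → Option (Gen k n)
  | .b ⟨0, _⟩, _ => none
  | .b ⟨j + 1, h⟩, c =>
      if c = w ⟨j, by omega⟩ then some (.b ⟨j, by omega⟩) else none
  | .a ⟨0, _⟩, c =>
      if c = v (lastPos n) then some (.a (lastPos n)) else some (.b (lastPos k))
  | .a ⟨i + 1, h⟩, c =>
      if c = v ⟨i, by omega⟩ then some (.a ⟨i, by omega⟩) else none

/-- Only `b_1 = σ` is active. -/
def active : Gen k n → Bool
  | .b ⟨0, _⟩ => true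
  | .b ⟨_ + 1, _⟩ => false
  | .a _ => false

/-! ### The group acting on the binary tree -/

/-- The action on finite words over `{0, 1}` of a generator (or of the identity, `none`): the word
`c u` is sent to `c' (u^{g_c})`, where `c' ≠ c` if `g` is active, and `c' = c` otherwise. -/
def act : Option (Gen k n) → List Bool → List Bool
  | none, u => u
  | some _, [] => []
  | some g, c :: u => (xor (active g) c) :: act (coord w v g c) u

/-- The automorphism group of the rooted tree of finite words over `{0, 1}`, as a group acting
on the right: its elements are the permutations of the set of words that preserve and reflect the
prefix order, and the product `g * h` is `g` followed by `h`. -/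
def TreeAut : Subgroup (Equiv.Perm (List Bool))ᵐᵒᵖ where
  carrier := {g | ∀ u u' : List Bool, g.unop u <+: g.unop u' ↔ u <+: u'}
  one_mem' := fun _ _ => Iff.rfl
  mul_mem' := by
    intro g h hg hh u u'
    exact (hh _ _).trans (hg _ _)
  inv_mem' := by
    intro g hg u u'
    have := hg (g.unop⁻¹ u) (g.unop⁻¹ u')
    exact (by simpa using this.symm : _)

theorem coord_xor (g : Gen k n) (c : Bool) :
    coord w v g (xor (active g) c) = coord w v g c := by
  rcases g with ⟨_ | i, h⟩ | ⟨_ | j, h⟩ <;> simp [coord, active]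

theorem act_act (q : Option (Gen k n)) (u : List Bool) :
    act w v q (act w v q u) = u := by
  induction u generalizing q with
  | nil => cases q <;> simp [act]
  | cons c u ih =>
    cases q with
    | none => simp [act]
    | some g => simp [act, coord_xor, ih]

theorem act_prefix (q : Option (Gen k n)) (u u' : List Bool) (h : u <+: u') :
    act w v q u <+: act w v q u' := by
  induction u generalizing q u' with
  | nil => cases q <;> simp [act]
  | cons c u ih =>
    cases q with
    | none => simpa [act] using h
    | some g =>
      cases u' with
      | nil => simp at h
      | cons c' u' =>
        obtain ⟨rfl, h'⟩ := List.cons_prefix_cons.1 h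
        simp only [act, List.cons_prefix_cons, true_and]
        exact ih _ _ h'

/-- The tree automorphism given by a generator. -/
def aut (g : Gen k n) : TreeAut :=
  ⟨.op (Function.Involutive.toPerm (act w v (some g)) (act_act w v (some g))), by
    intro u u'
    change act w v (some g) u <+: act w v (some g) u' ↔ u <+: u'
    refine ⟨fun h => ?_, fun h => act_prefix w v _ _ _ h⟩
    have := act_prefix w v (some g) _ _ h
    rwa [act_act, act_act] at this⟩

/-- The group `K(w, v)`. -/
def K : Subgroup TreeAut := Subgroup.closure (Set.range (aut w v))

/-- The generators as elements of `K(w, v)`. -/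
def gen (g : Gen k n) : K w v := ⟨aut w v g, Subgroup.subset_closure ⟨g, rfl⟩⟩

/-! ### The group `F` -/

/-- The maximal `d` such that `v = u ^ d` for some word `u`. -/
def rootExp : ℕ := sSup {d : ℕ | ∃ u : List Bool, List.ofFn v = (List.replicate d u).flatten}

/-- The relations `a_i²`, `b_j²`, and `[a_i, a_{i + ℓ (n / d)}]` for `1 ≤ ℓ < d`, the indices of
the `a` being taken modulo `n`. -/
def relsF (k : ℕ) {n : ℕ} (v : Fin n → Bool) : Set (FreeGroup (Gen k n)) :=
  {r | ∃ g : Gen k n, r = FreeGroup.of g ^ 2} ∪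
  {r | ∃ (i i' : Fin n) (l : ℕ), 1 ≤ l ∧ l < rootExp v ∧
    (i' : ℕ) = (i + l * (n / rootExp v)) % n ∧
    r = cm (FreeGroup.of (Gen.a i)) (FreeGroup.of (Gen.a i'))}

/-- The group `F`. -/
abbrev F (k : ℕ) {n : ℕ} (v : Fin n → Bool) : Type := PresentedGroup (relsF k v)

/-- The generator `a_{i+1}` of `F`. -/
def fa (i : Fin n) : F k v := PresentedGroup.of (Gen.a i)

/-- The generator `b_{j+1}` of `F`. -/
def fb (j : Fin k) : F k v := PresentedGroup.of (Gen.b j)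

theorem flatten_replicate_get (d : ℕ) (u : List Bool) (i : ℕ) (hi : i < d * u.length) :
    (List.replicate d u).flatten[i]? = u[i % u.length]? := by
  induction d generalizing i with
  | zero => simp at hi
  | succ d ih =>
    rw [List.replicate_succ, List.flatten_cons]
    by_cases h : i < u.length
    · rw [List.getElem?_append_left h, Nat.mod_eq_of_lt h]
    · rw [not_lt] at h
      rw [List.getElem?_append_right h, ih _ (by rw [Nat.succ_mul] at hi; omega),
        Nat.mod_eq_sub_mod h]

theorem rootExp_spec : ∃ u : List Bool, List.ofFn v = (List.replicate (rootExp v) u).flatten := by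
  refine Nat.sSup_mem (s := {d : ℕ | ∃ u : List Bool, List.ofFn v = (List.replicate d u).flatten})
    ⟨1, List.ofFn v, by simp⟩ ⟨n, ?_⟩
  rintro d ⟨u, hu⟩
  have h := congrArg List.length hu
  simp only [List.length_ofFn, List.length_flatten, List.map_replicate, List.sum_replicate,
    smul_eq_mul] at h
  have hn := NeZero.pos n
  have : 0 < u.length := by
    rcases Nat.eq_zero_or_pos u.length with h0 | h0
    · rw [h0] at h; omega
    · exact h0
  calc d ≤ d * u.length := Nat.le_mul_of_pos_right _ this
    _ = n := h.symm

/-- The word `v` is periodic, cyclically, with period `n / d`. -/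
theorem letter_periodic {i i' : Fin n} {l : ℕ}
    (h : (i' : ℕ) = (i + l * (n / rootExp v)) % n) : v i' = v i := by
  obtain ⟨u, hu⟩ := rootExp_spec v
  have hlen := congrArg List.length hu
  simp only [List.length_ofFn, List.length_flatten, List.map_replicate, List.sum_replicate,
    smul_eq_mul] at hlen
  have hn := NeZero.pos n
  have hd : 0 < rootExp v := by
    rcases Nat.eq_zero_or_pos (rootExp v) with h0 | h0
    · rw [h0] at hlen; omega
    · exact h0
  have he : n / rootExp v = u.length := by
    exact Nat.div_eq_of_eq_mul_right hd hlen
  have key : ∀ j : Fin n, some (v j) = u[(j : ℕ) % u.length]? := by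
    intro j
    rw [← flatten_replicate_get (rootExp v) u j (by rw [← hlen]; exact j.2), ← hu]
    simp
  have hmod : (i' : ℕ) % u.length = (i : ℕ) % u.length := by
    rw [h, he, Nat.mod_mod_of_dvd _ ⟨rootExp v, by rw [mul_comm]; exact hlen⟩]
    simp
  have := (key i').trans ((congrArg (fun m => u[m]?) hmod).trans (key i).symm)
  exact Option.some.inj this

theorem coord_pair {i i' : Fin n} {l : ℕ} (h : (i' : ℕ) = (i + l * (n / rootExp v)) % n)
    (hne : i ≠ i') (c : Bool) :
    coord w v (.a i) c = none ∨ coord w v (.a i') c = none ∨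
    ∃ j j' : Fin n, (j' : ℕ) = (j + l * (n / rootExp v)) % n ∧
      coord w v (.a i) c = some (.a j) ∧ coord w v (.a i') c = some (.a j') := by
  have hn := NeZero.pos n
  have pred : ∀ {j j' : Fin n}, (j' + 1 : ℕ) ≡ j + 1 + l * (n / rootExp v) [MOD n] →
      (j' : ℕ) = (j + l * (n / rootExp v)) % n := by
    intro j j' hj
    have h1 : (j' : ℕ) ≡ j + l * (n / rootExp v) [MOD n] := by
      refine Nat.ModEq.add_right_cancel' 1 ?_
      rwa [show (j : ℕ) + l * (n / rootExp v) + 1 = j + 1 + l * (n / rootExp v) by ring]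
    have h2 : (j' : ℕ) % n = _ := h1
    rwa [Nat.mod_eq_of_lt j'.2] at h2
  have hmod : (i' : ℕ) ≡ i + l * (n / rootExp v) [MOD n] := by
    rw [h]; exact Nat.mod_modEq _ _
  have hl : ((lastPos n : Fin n) : ℕ) + 1 = n := by simp only [lastPos]; omega
  rcases i with ⟨_ | i, hi⟩ <;> rcases i' with ⟨_ | i', hi'⟩
  · exact absurd rfl hne
  · have hj : ((⟨i', by omega⟩ : Fin n) : ℕ) =
        ((lastPos n : Fin n) + l * (n / rootExp v)) % n := by
      refine pred ?_
      rw [hl]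
      exact hmod.trans (Nat.ModEq.add_right _ (by simp [Nat.ModEq]))
    have hv := letter_periodic v hj
    simp only [coord, hv]
    split_ifs with hc
    · exact Or.inr (Or.inr ⟨_, _, hj, rfl, rfl⟩)
    · exact Or.inr (Or.inl rfl)
  · have hj : ((lastPos n : Fin n) : ℕ) =
        ((⟨i, by omega⟩ : Fin n) + l * (n / rootExp v)) % n := by
      refine pred ?_
      rw [hl]
      exact Nat.ModEq.trans (by simp [Nat.ModEq]) hmod
    have hv := letter_periodic v hj
    simp only [coord, hv]
    split_ifs with hc
    · exact Or.inr (Or.inr ⟨_, _, hj, rfl, rfl⟩)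
    · exact Or.inl rfl
  · have hj : ((⟨i', by omega⟩ : Fin n) : ℕ) =
        ((⟨i, by omega⟩ : Fin n) + l * (n / rootExp v)) % n := pred hmod
    have hv := letter_periodic v hj
    simp only [coord, hv]
    split_ifs with hc
    · exact Or.inr (Or.inr ⟨_, _, hj, rfl, rfl⟩)
    · exact Or.inl rfl

theorem act_comm {i i' : Fin n} {l : ℕ} (h : (i' : ℕ) = (i + l * (n / rootExp v)) % n)
    (u : List Bool) :
    act w v (some (.a i)) (act w v (some (.a i')) u) =
      act w v (some (.a i')) (act w v (some (.a i)) u) := by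
  induction u generalizing i i' with
  | nil => simp [act]
  | cons c u ih =>
    by_cases hne : i = i'
    · rw [hne]
    simp only [act, active, Bool.false_xor, List.cons.injEq, true_and]
    rcases coord_pair w v h hne c with h1 | h1 | ⟨j, j', hj, h1, h2⟩
    · simp [h1, act]
    · simp [h1, act]
    · rw [h1, h2]
      exact ih hj

theorem gen_relsF (r : FreeGroup (Gen k n)) (hr : r ∈ relsF k v) :
    FreeGroup.lift (gen w v) r = 1 := by
  rcases hr with ⟨g, rfl⟩ | ⟨i, i', l, -, -, h, rfl⟩
  · rw [map_pow, FreeGroup.lift_apply_of, pow_two]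
    apply Subtype.ext
    apply Subtype.ext
    apply MulOpposite.unop_injective
    ext1 u
    exact act_act w v (some g) u
  · simp only [cm, map_mul, map_inv, FreeGroup.lift_apply_of]
    refine cm_eq_one ?_
    apply Subtype.ext
    apply Subtype.ext
    apply MulOpposite.unop_injective
    ext1 u
    exact (act_comm w v h u).symm

/-- The natural homomorphism from `F` to `K(w, v)`. -/
def toK : F k v →* K w v := PresentedGroup.toGroup (gen_relsF w v)

/-! ### The wreath recursion -/

/-- The permutational wreath product `G ≀ S_2`: the element `⟨g, π⟩` is `⟨g_0, g_1⟩ π`, and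
`(⟨g_0, g_1⟩ σ) (⟨h_0, h_1⟩ π) = ⟨g_0 h_1, g_1 h_0⟩ σ π`. -/
abbrev Wr (G : Type) [Group G] : Type :=
  (Bool → G) ⋊[(mulAutArrow : Equiv.Perm Bool →* MulAut (Bool → G))] Equiv.Perm Bool

/-- The element `⟨g_0, g_1⟩` of `G ≀ S_2`. -/
def pair {G : Type} [Group G] (g₀ g₁ : G) : Wr G :=
  SemidirectProduct.inl (fun c => if c then g₁ else g₀)

/-- A generator of `F`, or the trivial element. -/
def ofOption : Option (Gen k n) → F k v
  | none => 1
  | some g => PresentedGroup.of g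

/-- The values of the wreath recursion on the generators. -/
def psiGen (g : Gen k n) : Wr (F k v) :=
  pair (ofOption v (coord w v g false)) (ofOption v (coord w v g true)) *
    SemidirectProduct.inr (if active g then Equiv.boolNot else 1)

theorem of_mul_of (g : Gen k n) :
    (PresentedGroup.of g * PresentedGroup.of g : F k v) = 1 := by
  rw [← pow_two]
  exact PresentedGroup.one_of_mem (rels := relsF k v) (x := FreeGroup.of g ^ 2)
    (Or.inl ⟨g, rfl⟩)

theorem fa_comm {i i' : Fin n} {l : ℕ} (h : (i' : ℕ) = (i + l * (n / rootExp v)) % n)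
    (h1 : 1 ≤ l) (h2 : l < rootExp v) :
    (PresentedGroup.of (.a i) * PresentedGroup.of (.a i') : F k v) =
      PresentedGroup.of (.a i') * PresentedGroup.of (.a i) := by
  have h0 : cm (PresentedGroup.of (.a i) : F k v) (PresentedGroup.of (.a i')) = 1 :=
    PresentedGroup.one_of_mem (rels := relsF k v)
      (x := cm (FreeGroup.of (.a i)) (FreeGroup.of (.a i')))
      (Or.inr ⟨i, i', l, h1, h2, h, rfl⟩)
  unfold cm at h0
  rw [mul_assoc, mul_eq_one_iff_eq_inv] at h0
  simpa [mul_inv_rev] using (congrArg (fun x => x⁻¹) h0).symm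

theorem ofOption_mul_self (q : Option (Gen k n)) : ofOption v q * ofOption v q = 1 := by
  cases q with
  | none => simp [ofOption]
  | some g => exact of_mul_of v g

theorem psiGen_relsF (r : FreeGroup (Gen k n)) (hr : r ∈ relsF k v) :
    FreeGroup.lift (psiGen w v) r = 1 := by
  rcases hr with ⟨g, rfl⟩ | ⟨i, i', l, hl, hl', h, rfl⟩
  · rw [map_pow, FreeGroup.lift_apply_of, pow_two]
    rcases g with i | ⟨_ | j, hj⟩
    · ext c
      · cases c <;> simp [psiGen, pair, active, ofOption_mul_self]
      · simp [psiGen, pair, active]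
    · ext c
      · cases c <;> simp [psiGen, pair, active, coord, ofOption] <;> rfl
      · simp [psiGen, pair, active]
    · ext c
      · cases c <;> simp [psiGen, pair, active, ofOption_mul_self]
      · simp [psiGen, pair, active]
  · simp only [cm, map_mul, map_inv, FreeGroup.lift_apply_of]
    refine cm_eq_one ?_
    by_cases hne : i = i'
    · rw [hne]
    have key : ∀ c, ofOption v (coord w v (.a i) c) * ofOption v (coord w v (.a i') c) =
        ofOption v (coord w v (.a i') c) * ofOption v (coord w v (.a i) c) := by
      intro c
      rcases coord_pair w v h hne c with h1 | h1 | ⟨j, j', hj, h1, h2⟩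
      · simp [h1, ofOption]
      · simp [h1, ofOption]
      · rw [h1, h2]
        exact fa_comm v hj hl hl'
    ext c
    · cases c <;> simp [psiGen, pair, active, key]
    · simp [psiGen, pair, active]

/-- The wreath recursion `Ψ : F → F ≀ S_2`. -/
def psi : F k v →* Wr (F k v) := PresentedGroup.toGroup (psiGen_relsF w v)

/-! ### The endomorphism `φ` -/

/-- The first position of a non-empty word. -/
def firstPos (n : ℕ) [NeZero n] : Fin n := ⟨0, NeZero.pos n⟩

/-- The element `b_1 ^ c`, for a letter `c`. -/
def bpow (c : Bool) : F k v := if c then fb v (firstPos k) else 1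

/-- The values of `φ` on the generators, for a given element `t`. The index of `a` is taken modulo
`n`, so that `φ(a_n)` is `a_1` if `x_n = 0` and `a_1 ^ b_1` if `x_n = 1`. -/
def phiGen (t : F k v) : Gen k n → F k v
  | .b j =>
      if h : (j : ℕ) + 1 < k then cj (fb v ⟨j + 1, h⟩) (bpow v (w j))
      else cj (fa v (firstPos n)) t
  | .a i => cj (fa v (i + 1)) (bpow v (v i))

theorem phiGen_relsF (t : F k v) (r : FreeGroup (Gen k n)) (hr : r ∈ relsF k v) :
    FreeGroup.lift (phiGen w v t) r = 1 := by
  have sq : ∀ (g : Gen k n) (x : F k v),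
      cj (PresentedGroup.of g) x * cj (PresentedGroup.of g) x = 1 := by
    intro g x
    have := of_mul_of v g
    calc cj (PresentedGroup.of g) x * cj (PresentedGroup.of g) x
        = x⁻¹ * (PresentedGroup.of g * PresentedGroup.of g) * x := by unfold cj; group
      _ = 1 := by rw [this]; group
  rcases hr with ⟨g, rfl⟩ | ⟨i, i', l, hl, hl', h, rfl⟩
  · rw [map_pow, FreeGroup.lift_apply_of, pow_two]
    rcases g with i | j
    · exact sq _ _
    · simp only [phiGen]
      split_ifs
      · exact sq _ _
      · exact sq _ _
  · simp only [cm, map_mul, map_inv, FreeGroup.lift_apply_of]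
    refine cm_eq_one ?_
    have hs : ((i' + 1 : Fin n) : ℕ) = ((i + 1 : Fin n) + l * (n / rootExp v)) % n := by
      rw [Fin.val_add, Fin.val_add, h]
      simp only [Nat.mod_add_mod]
      congr 1
      ring
    have := fa_comm (k := k) v hs hl hl'
    simp only [phiGen, letter_periodic v h, fa]
    calc cj (PresentedGroup.of (.a (i + 1)) : F k v) (bpow v (v i)) *
          cj (PresentedGroup.of (.a (i' + 1))) (bpow v (v i))
        = (bpow v (v i))⁻¹ * (PresentedGroup.of (.a (i + 1)) *
          PresentedGroup.of (.a (i' + 1))) * bpow v (v i) := by unfold cj; group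
      _ = cj (PresentedGroup.of (.a (i' + 1))) (bpow v (v i)) *
          cj (PresentedGroup.of (.a (i + 1))) (bpow v (v i)) := by rw [this]; unfold cj; group

/-- The endomorphism `φ` of `F`. -/
def phi (t : F k v) : F k v →* F k v := PresentedGroup.toGroup (phiGen_relsF w v t)

/-! ### The elements `s`, `t` and the number `m` -/

/-- The subgroup `⟨b_1, …, b_r⟩` of `F`. -/
def bSub (r : ℕ) : Subgroup (F k v) := Subgroup.closure {g | ∃ j : Fin k, (j : ℕ) < r ∧ g = fb v j}

/-- The admissible choices of `s, t ∈ F` and `m ∈ {1, 2}`, according to the lengths `k` and `n`.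
In all cases `Ψ(a_1 ^ t) = ⟨b_k, a_n ^ s⟩`. -/
def IsChoice (s t : F k v) (m : ℕ) : Prop :=
  psi w v (cj (fa v (firstPos n)) t) = pair (fb v (lastPos k)) (cj (fa v (lastPos n)) s) ∧
  ((2 ≤ k ∧ 2 ≤ n ∧ m = 1 ∧ s ∈ bSub v 1 ∧ t ∈ bSub v 2 ∧
      toK w v (cm (cj (fa v (lastPos n)) s) (fb v (lastPos k))) = 1) ∨
    (3 ≤ k ∧ n = 1 ∧ m = 1 ∧ s ∈ bSub v 2 ∧ t ∈ bSub v 3 ∧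
      toK w v (cm (cj (fa v (lastPos n)) s) (fb v (lastPos k))) = 1) ∨
    (k = 2 ∧ n = 1 ∧ m = 2 ∧ s ∈ bSub v 1 ∧ t ∈ bSub v 2 ∧
      ∃ r ∈ bSub (k := k) v 1,
        psi w v (cj (fb v (lastPos k)) r) = pair (fb v (firstPos k)) 1 ∧
        psi w v (cj (fa v (firstPos n)) (r * s)) =
          pair (fb v (lastPos k)) (fa v (lastPos n))) ∨
    (k = 1 ∧ 2 ≤ n ∧ m = 2 ∧ s = 1 ∧ t ∈ bSub v 1))

/-- The element `t` is matched to `s` by `φ`: up to factors `b_1`, the element `φ(s)` is `t`. -/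
def IsMatched (s t : F k v) : Prop :=
  phi w v t s = t * fb v (firstPos k) ∨
  phi w v t s = fb v (firstPos k) * t * fb v (firstPos k)

/-! ### The group `F̄` and the set `R` -/

/-- The normal subgroup of `F` generated by all `φ^ℓ(a_n^s b_k)^{2^m}`, for `ℓ ≥ 0`. -/
def barKer (s t : F k v) (m : ℕ) : Subgroup (F k v) :=
  Subgroup.normalClosure
    {g | ∃ l : ℕ, g = ((phi w v t)^[l] (cj (fa v (lastPos n)) s * fb v (lastPos k))) ^ 2 ^ m}

instance barKer_normal (s t : F k v) (m : ℕ) : (barKer w v s t m).Normal :=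
  Subgroup.normalClosure_normal

/-- The group `F̄`. -/
abbrev Fbar (s t : F k v) (m : ℕ) : Type := F k v ⧸ barKer w v s t m

/-- The quotient map from `F` to `F̄`. -/
def toFbar (s t : F k v) (m : ℕ) : F k v →* Fbar w v s t m := QuotientGroup.mk' _

theorem barKer_le_comap (s t : F k v) (m : ℕ) :
    barKer w v s t m ≤ (barKer w v s t m).comap (phi w v t) := by
  refine Subgroup.normalClosure_le_normal ?_
  rintro g ⟨l, rfl⟩
  refine Subgroup.subset_normalClosure ⟨l + 1, ?_⟩
  rw [Function.iterate_succ_apply', map_pow]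

/-- The endomorphism of `F̄` induced by `φ`. -/
def phiBar (s t : F k v) (m : ℕ) : Fbar w v s t m →* Fbar w v s t m :=
  QuotientGroup.map _ _ (phi w v t) (barKer_le_comap w v s t m)

/-- The subgroup `⟨a_1^t, b_1⟩` of `F̄`. -/
def dih (s t : F k v) (m : ℕ) : Subgroup (Fbar w v s t m) :=
  Subgroup.closure {toFbar w v s t m (cj (fa v (firstPos n)) t),
    toFbar w v s t m (fb v (firstPos k))}

/-- The element of `F̄` given by a word in `a_1^t` (for `false`) and `b_1` (for `true`). As both
are involutions, every element of `⟨a_1^t, b_1⟩` is given by such a word. -/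
def dihWord (s t : F k v) (m : ℕ) (u : List Bool) : Fbar w v s t m :=
  (u.map fun c => toFbar w v s t m
    (if c then fb v (firstPos k) else cj (fa v (firstPos n)) t)).prod

/-- The elements of `⟨a_1^t, b_1⟩` that contain an odd number of `b_1`. -/
def setO (s t : F k v) (m : ℕ) : Set (Fbar w v s t m) :=
  {g | ∃ u : List Bool, Odd (u.count true) ∧ g = dihWord w v s t m u}

/-- The elements of `⟨a_1^t, b_1⟩` that contain an even number of `b_1`. -/
def setE (s t : F k v) (m : ℕ) : Set (Fbar w v s t m) :=
  {g | ∃ u : List Bool, Even (u.count true) ∧ g = dihWord w v s t m u}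

/-- The twisting elements allowed for two letters `c`, `c'`. -/
def twist (s t : F k v) (m : ℕ) (c c' : Bool) : Set (Fbar w v s t m) :=
  if c = c' then setO w v s t m else setE w v s t m

/-- The set `R` of commutators `[b_{i+1}, b_{j+1}^u]`, `[a_{i+1}, b_{j+1}^u]` and
`[a_{i+1}, a_{j+1}^u]`, with `u` in `O` if the letters `y_i`, `y_j` (respectively `x_i`, `y_j`, and
`x_i`, `x_j`) are equal, and in `E` otherwise. -/
def setR (s t : F k v) (m : ℕ) : Set (Fbar w v s t m) :=
  {g | ∃ (i j : ℕ) (hi : i + 1 < k) (hj : j + 1 < k),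
    ∃ u ∈ twist w v s t m (w ⟨i, Nat.lt_of_succ_lt hi⟩) (w ⟨j, Nat.lt_of_succ_lt hj⟩),
    g = cm (toFbar w v s t m (fb v ⟨i + 1, hi⟩)) (cj (toFbar w v s t m (fb v ⟨j + 1, hj⟩)) u)} ∪
  {g | ∃ (i j : ℕ) (hi : i + 1 < n) (hj : j + 1 < k),
    ∃ u ∈ twist w v s t m (v ⟨i, Nat.lt_of_succ_lt hi⟩) (w ⟨j, Nat.lt_of_succ_lt hj⟩),
    g = cm (toFbar w v s t m (fa v ⟨i + 1, hi⟩)) (cj (toFbar w v s t m (fb v ⟨j + 1, hj⟩)) u)} ∪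
  {g | ∃ (i j : ℕ) (hi : i + 1 < n) (hj : j + 1 < n),
    ∃ u ∈ twist w v s t m (v ⟨i, Nat.lt_of_succ_lt hi⟩) (v ⟨j, Nat.lt_of_succ_lt hj⟩),
    g = cm (toFbar w v s t m (fa v ⟨i + 1, hi⟩)) (cj (toFbar w v s t m (fa v ⟨j + 1, hj⟩)) u)}

/-- The relations of the presentation, as elements of the free group on the symbols
`a_1, …, a_n, b_1, …, b_k`: the relations of `F̄`, and the words that represent elements of
`φ^ℓ(R)` in `F̄`, for all `ℓ ≥ 0`. -/
def presRels (s t : F k v) (m : ℕ) : Set (FreeGroup (Gen k n)) :=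
  {r | toFbar w v s t m (PresentedGroup.mk _ r) = 1} ∪
  {r | ∃ l : ℕ, toFbar w v s t m (PresentedGroup.mk _ r) ∈
    (phiBar w v s t m)^[l] '' setR w v s t m}

end

end KneadingGroup

end

/-! Write Γ for the presented group `PG`, with quotient map `toPG : F → Γ`. The presentation holds
once an element of F is trivial in Γ exactly when it is trivial in K(w,v)
(`IsChoice.toPG_eq_one_iff`).

The engine is the identity Ψ(φ(g)) = ⟨g, θ(g)⟩ (`psi_phi`), where θ sends a_n to b_k, b_k to a_n^s
and every other generator to 1. The image of θ lies in ⟨a_n^s, b_k⟩, generated by two involutions.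
Once (a_n^s b_k)^{2^m} is killed, with m ≤ 2, this is a dihedral group of order at most 8 or a
quotient of one, and θ then kills every relator (`theta_kills`).

Relators die in K(w,v) (`toK_kills`): a commutator in R does because Ψ sends its two entries to
elements with disjoint supports, and φ carries a dying relator to a dying relator since both
coordinates ⟨g, θ(g)⟩ die.

Conversely, Ψ descends to Γ (`mapWr_psi_kills`) and stays injective there (`toPG_eq_one_of_psi`).
Indeed every element of Γ is φ(z₀) φ(z₁)^{b_1} δ with θ(z₀) = θ(z₁) = 1 and δ in ⟨a_1^t, b_1⟩
(`exists_decomp`), and applying θ to the coordinates separates the three factors. This needs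
φ(a_n^s) = a_1^{t b_1} in Γ, which is true even for choices that are not matched
(`Setup.toPG_phi_an`). To see that Ψ descends, (a_n^s b_k)^{2^m} has to be examined by hand; for m =
1 this lifts a commutation from K(w,v) to Γ (`commute_toPG_of_toK`).

Contraction finishes the argument (`toPG_eq_one_of_toK`). A shortest word trivial in K(w,v) but not
in Γ has a coordinate of the same kind and length, and so on for ever. No letter is ever lost, so
the word contains no b_j, and all its a_i read the same periodic sequence of letters of v. By
maximality of d these a_i commute in F. As every generator occurs an even number of times in a word
trivial in K(w,v) (`par_eq_one_of_toK`), two letters cancel, against minimality.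

For a matched choice, (a_1^t b_1)² = φ(b_k a_n^s) already in F. So the order of a_1^t b_1 in F̄
divides 2^{m+1}, and its image in K(w,v) shows that it is no smaller (`IsChoice.orderOf_A_mul_b1`).
-/

set_option linter.unusedSectionVars false

noncomputable section

namespace KneadingGroup

/-! ### Conjugates and commutators -/

section Group

variable {G H : Type*} [Group G] [Group H]

theorem map_cj (f : G →* H) (g h : G) : f (cj g h) = cj (f g) (f h) := by
  simp [cj]

theorem cj_mul (g h h' : G) : cj g (h * h') = cj (cj g h) h' := by
  simp [cj, mul_assoc]

theorem mul_cj (g g' h : G) : cj (g * g') h = cj g h * cj g' h := by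
  simp [cj, mul_assoc]

theorem cj_one (g : G) : cj g 1 = g := by simp [cj]

theorem one_cj (h : G) : cj 1 h = 1 := by simp [cj]

theorem cj_inv_cj (g h : G) : cj (cj g h) h⁻¹ = g := by simp [cj, mul_assoc]

theorem cj_mul_self {g : G} (hg : g * g = 1) (h : G) : cj g h * cj g h = 1 := by
  rw [← mul_cj, hg, one_cj]

theorem commute_cj_iff (g g' h : G) : Commute (cj g h) (cj g' h) ↔ Commute g g' := by
  constructor
  · intro e
    have e' : cj g h * cj g' h = cj g' h * cj g h := e
    rw [← mul_cj, ← mul_cj] at e'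
    have := congrArg (fun x => cj x h⁻¹) e'
    simp only [cj_inv_cj] at this
    exact this
  · intro e
    have e' : g * g' = g' * g := e
    change cj g h * cj g' h = cj g' h * cj g h
    rw [← mul_cj, ← mul_cj, e']

theorem cj_eq_self_iff (g h : G) : cj g h = g ↔ Commute g h := by
  unfold cj
  constructor
  · intro e
    have : g * h = h * g := by
      nth_rewrite 2 [← e]
      group
    exact this
  · intro e
    rw [mul_assoc, e.eq]
    group

theorem cj_eq_one_iff (g h : G) : cj g h = 1 ↔ g = 1 := by
  constructor
  · intro e
    rw [← cj_inv_cj g h, e, one_cj]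
  · rintro rfl
    exact one_cj h

theorem cm_eq_one_iff (g h : G) : cm g h = 1 ↔ Commute g h := by
  refine ⟨fun e => ?_, fun e => cm_eq_one e⟩
  unfold cm at e
  have : g * h = h * g := by
    have h1 : h * g * (g⁻¹ * h⁻¹ * g * h) = g * h := by group
    rw [← h1, e, mul_one]
  exact this

theorem map_cm (f : G →* H) (g h : G) : f (cm g h) = cm (f g) (f h) := by
  simp [cm]

/-- Two different homomorphisms are allowed so that one side can carry an extra conjugation, as in
the commutation of φ(x) with φ(y)^{b_1}. -/
theorem commute_of_closure {K : Type*} [Group K] {S : Set G} {T : Set K} (f : G →* H) (f' : K →* H)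
    (h : ∀ x ∈ S, ∀ y ∈ T, Commute (f x) (f' y)) {x : G} (hx : x ∈ Subgroup.closure S)
    {y : K} (hy : y ∈ Subgroup.closure T) : Commute (f x) (f' y) := by
  induction hx using Subgroup.closure_induction with
  | mem x hx =>
    induction hy using Subgroup.closure_induction with
    | mem y hy => exact h x hx y hy
    | one => simp
    | mul a b _ _ ha hb => rw [map_mul]; exact ha.mul_right hb
    | inv a _ ha => rw [map_inv]; exact ha.inv_right
  | one => simp
  | mul a b _ _ ha hb => rw [map_mul]; exact ha.mul_left hb
  | inv a _ ha => rw [map_inv]; exact ha.inv_left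

end Group

/-! ### Calculus in the wreath product -/

section Wreath

variable {G H : Type} [Group G] [Group H]

/-- The element `σ` of `G ≀ S_2`. -/
def sw : Wr G := SemidirectProduct.inr Equiv.boolNot

theorem pair_mul (a b c d : G) : pair a b * pair c d = pair (a * c) (b * d) := by
  unfold pair
  rw [← map_mul]
  congr 1
  funext x
  cases x <;> rfl

theorem pair_one : (pair 1 1 : Wr G) = 1 := by
  unfold pair
  simp only [ite_self]
  exact map_one _

theorem pair_inv (a b : G) : (pair a b)⁻¹ = pair a⁻¹ b⁻¹ := by
  rw [inv_eq_iff_mul_eq_one, pair_mul, mul_inv_cancel, mul_inv_cancel, pair_one]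

theorem pair_inj {a b c d : G} (h : pair a b = pair c d) : a = c ∧ b = d := by
  have h' := SemidirectProduct.inl_injective h
  exact ⟨by simpa using congrFun h' false, by simpa using congrFun h' true⟩

theorem pair_right (a b : G) : (pair a b).right = 1 := rfl

theorem sw_right : (sw : Wr G).right = Equiv.boolNot := rfl

theorem boolNot_mul_self : Equiv.boolNot * Equiv.boolNot = (1 : Equiv.Perm Bool) := by
  ext c; cases c <;> rfl

theorem boolNot_ne_one : Equiv.boolNot ≠ (1 : Equiv.Perm Bool) := by
  intro h
  simpa using congrArg (fun e : Equiv.Perm Bool => e false) h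

theorem sw_mul_sw : (sw * sw : Wr G) = 1 := by
  unfold sw
  rw [← map_mul, boolNot_mul_self, map_one]

theorem sw_mul_pair (a b : G) : sw * pair a b = pair b a * sw := by
  ext c
  · cases c <;> simp [sw, pair] <;> rfl
  · simp [sw, pair]

theorem sw_inv : (sw⁻¹ : Wr G) = sw := by
  rw [inv_eq_iff_mul_eq_one, sw_mul_sw]

theorem cj_pair_sw (a b : G) : cj (pair a b) sw = pair b a := by
  unfold cj
  rw [sw_inv, sw_mul_pair, mul_assoc, sw_mul_sw, mul_one]

theorem cj_pair_pair (a b c d : G) : cj (pair a b) (pair c d) = pair (cj a c) (cj b d) := by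
  simp [cj, pair_mul, pair_inv]

/-- The power `σ ^ c`, for a letter `c`. -/
def swpow (c : Bool) : Wr G := if c then sw else 1

theorem swpow_mul_sw (c : Bool) : (swpow c * sw : Wr G) = swpow (!c) := by
  cases c <;> simp [swpow, sw_mul_sw]

theorem swpow_right (c : Bool) :
    (swpow c : Wr G).right = if c then Equiv.boolNot else 1 := by
  cases c <;> rfl

/-- The element of the base group with `g` at the coordinate `c` and `1` at the other. -/
def atc (c : Bool) (g : G) : Wr G := if c then pair 1 g else pair g 1

theorem cj_atc_swpow (c e : Bool) (g : G) : cj (atc c g) (swpow e) = atc (xor c e) g := by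
  cases c <;> cases e <;> simp [atc, swpow, cj_one, cj_pair_sw]

theorem swpow_mul_pair (e : Bool) (a b : G) :
    swpow e * pair a b = (if e then pair b a else pair a b) * swpow e := by
  cases e <;> simp [swpow, sw_mul_pair]

theorem swpow_mul_atc (e c : Bool) (a : G) :
    swpow e * atc c a = atc (xor c e) a * swpow e := by
  cases e <;> cases c <;> simp [swpow, atc, sw_mul_pair]

theorem exists_eq_pair (x : Wr G) : ∃ (a b : G) (e : Bool), x = pair a b * swpow e := by
  have hp : x.right = 1 ∨ x.right = Equiv.boolNot := by
    by_cases h : x.right false = false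
    · left
      have h1 : x.right true = true := by
        by_contra h'
        have : x.right true = x.right false := by rw [h]; simpa using h'
        simpa using x.right.injective this
      ext c; cases c <;> simp [h, h1]
    · right
      have h0 : x.right false = true := by simpa using h
      have h1 : x.right true = false := by
        by_contra h'
        have : x.right true = x.right false := by rw [h0]; simpa using h'
        simpa using x.right.injective this
      ext c; cases c <;> simp [h0, h1]
  rcases hp with h | h
  · refine ⟨x.left false, x.left true, false, ?_⟩
    ext c
    · cases c <;> simp [pair, swpow]
    · simp [pair, swpow, h]
  · refine ⟨x.left false, x.left true, true, ?_⟩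
    ext c
    · cases c <;> simp [pair, swpow, sw]
    · simp [pair, swpow, h, sw]

theorem pair_swpow_inj {a b c d : G} {e e' : Bool}
    (h : pair a b * swpow e = pair c d * swpow e') : a = c ∧ b = d ∧ e = e' := by
  have he : e = e' := by
    have := congrArg SemidirectProduct.right h
    rw [SemidirectProduct.mul_right, SemidirectProduct.mul_right, pair_right, pair_right, one_mul,
      one_mul, swpow_right, swpow_right] at this
    cases e <;> cases e' <;> simp_all [boolNot_ne_one, boolNot_ne_one.symm]
  subst he
  obtain ⟨h1, h2⟩ := pair_inj (mul_right_cancel h)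
  exact ⟨h1, h2, rfl⟩

/-- The homomorphism `G ≀ S_2 → H ≀ S_2` induced by a homomorphism `G → H`. -/
def mapWr (f : G →* H) : Wr G →* Wr H where
  toFun x := ⟨fun c => f (x.left c), x.right⟩
  map_one' := by
    ext c <;> simp
  map_mul' x y := by
    ext c
    · rw [SemidirectProduct.mul_left, SemidirectProduct.mul_left]
      exact map_mul f _ _
    · rfl

theorem mapWr_pair (f : G →* H) (a b : G) : mapWr f (pair a b) = pair (f a) (f b) := by
  ext c
  · cases c <;> rfl
  · rfl

theorem mapWr_eq_one_iff (f : G →* H) (x : Wr G) :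
    mapWr f x = 1 ↔ (∀ c, f (x.left c) = 1) ∧ x.right = 1 := by
  constructor
  · intro h
    exact ⟨fun c => congrFun (congrArg SemidirectProduct.left h) c,
      congrArg SemidirectProduct.right h⟩
  · rintro ⟨h1, h2⟩
    exact SemidirectProduct.ext (funext h1) h2

theorem mapWr_sw (f : G →* H) : mapWr f sw = sw := by
  ext c
  · exact map_one f
  · rfl

theorem mapWr_swpow (f : G →* H) (e : Bool) : mapWr f (swpow e) = swpow e := by
  cases e
  · exact map_one _
  · exact mapWr_sw f

end Wreath

section

variable {k n : ℕ} [NeZero k] [NeZero n] (w : Fin k → Bool) (v : Fin n → Bool)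

/-! ### The generators of `F` -/

/-- The letter attached to a generator by the endomorphism `φ`. -/
def letter : Gen k n → Bool
  | .a i => v i
  | .b j => w j

/-- The next generator, in the order `b_1, …, b_k, a_1, …, a_n, a_1, …`. -/
def succGen : Gen k n → Gen k n
  | .a i => .a (i + 1)
  | .b j => if h : (j : ℕ) + 1 < k then .b ⟨j + 1, h⟩ else .a (firstPos n)

/-- The generators other than `a_n` and `b_k`. -/
def Inner : Gen k n → Prop
  | .a i => (i : ℕ) + 1 < n
  | .b j => (j : ℕ) + 1 < k

variable {v} in
/-- A generator as an element of `F`. -/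
def fg (x : Gen k n) : F k v := PresentedGroup.of x

theorem fg_mul_self (x : Gen k n) : (fg x * fg x : F k v) = 1 := of_mul_of v x

theorem fg_inv (x : Gen k n) : (fg x : F k v)⁻¹ = fg x := by
  rw [inv_eq_iff_mul_eq_one, fg_mul_self]

theorem closure_fg : Subgroup.closure (Set.range (fg : Gen k n → F k v)) = ⊤ :=
  PresentedGroup.closure_range_of _

variable {v} in
@[elab_as_elim]
theorem F_induction {p : F k v → Prop} (one : p 1) (mul : ∀ g x, p g → p (g * fg x))
    (g : F k v) : p g := by
  have hg : g ∈ Subgroup.closure (Set.range (fg : Gen k n → F k v)) := by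
    rw [closure_fg]; trivial
  induction hg using Subgroup.closure_induction_right with
  | one => exact one
  | mul_right g hg y hy ih => obtain ⟨x, rfl⟩ := hy; exact mul g x ih
  | mul_inv_cancel g hg y hy ih => obtain ⟨x, rfl⟩ := hy; rw [fg_inv]; exact mul g x ih

theorem F_hom_ext {H : Type*} [Group H] {f f' : F k v →* H} (h : ∀ x, f (fg x) = f' (fg x)) :
    f = f' := PresentedGroup.ext h

/-- The first generator `b_1`. -/
abbrev b1 : F k v := fb v (firstPos k)

/-- The last generator `b_k`. -/
abbrev bk : F k v := fb v (lastPos k)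

/-- The first generator `a_1`. -/
abbrev a1 : F k v := fa v (firstPos n)

/-- The last generator `a_n`. -/
abbrev an : F k v := fa v (lastPos n)

theorem b1_mul_self : (b1 v * b1 v : F k v) = 1 := fg_mul_self v _

theorem b1_inv : (b1 v : F k v)⁻¹ = b1 v := fg_inv v _

theorem bpow_mul_self (c : Bool) : (bpow v c * bpow v c : F k v) = 1 := by
  cases c
  · simp [bpow]
  · simpa [bpow] using b1_mul_self v

theorem bpow_inv (c : Bool) : (bpow v c : F k v)⁻¹ = bpow v c := by
  rw [inv_eq_iff_mul_eq_one, bpow_mul_self]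

theorem bpow_mul_b1 (c : Bool) : (bpow v c * b1 v : F k v) = bpow v (!c) := by
  cases c
  · simp [bpow]
  · simpa [bpow] using b1_mul_self v

theorem bpow_mul_bpow (c e : Bool) : (bpow v c * bpow v e : F k v) = bpow v (xor c e) := by
  cases e
  · simp [bpow]
  · have : (bpow v true : F k v) = b1 v := rfl
    rw [this, bpow_mul_b1]; simp

theorem Inner.ne_last_a {x : Gen k n} (h : Inner x) : x ≠ .a (lastPos n) := by
  rintro rfl
  have := NeZero.pos n
  simp only [Inner, lastPos] at h
  omega

theorem Inner.ne_last_b {x : Gen k n} (h : Inner x) : x ≠ .b (lastPos k) := by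
  rintro rfl
  have := NeZero.pos k
  simp only [Inner, lastPos] at h
  omega

theorem inner_or (x : Gen k n) : Inner x ∨ x = .a (lastPos n) ∨ x = .b (lastPos k) := by
  rcases x with i | j
  · by_cases h : (i : ℕ) + 1 < n
    · exact Or.inl h
    · refine Or.inr (Or.inl ?_)
      congr 1
      ext
      simp only [lastPos]
      omega
  · by_cases h : (j : ℕ) + 1 < k
    · exact Or.inl h
    · refine Or.inr (Or.inr ?_)
      congr 1
      ext
      simp only [lastPos]
      omega

theorem val_add_one_of_inner {i : Fin n} (h : (i : ℕ) + 1 < n) : ((i + 1 : Fin n) : ℕ) = i + 1 := by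
  rw [Fin.val_add, Fin.val_one', Nat.add_mod_mod, Nat.mod_eq_of_lt h]

theorem lastPos_add_one : (lastPos n + 1 : Fin n) = firstPos n := by
  have := NeZero.pos n
  ext
  rw [Fin.val_add, Fin.val_one', Nat.add_mod_mod]
  simp only [lastPos, firstPos]
  rw [show n - 1 + 1 = n by omega, Nat.mod_self]

/-- The split follows the shape of Ψ: b_1 is σ, a_1 has the two coordinates a_n and b_k, and the
successor of an inner generator has that generator as its only nontrivial coordinate. -/
theorem gen_cases (x : Gen k n) :
    x = .b (firstPos k) ∨ x = .a (firstPos n) ∨ ∃ y : Gen k n, Inner y ∧ x = succGen y := by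
  rcases x with ⟨_ | i, hi⟩ | ⟨_ | j, hj⟩
  · exact Or.inr (Or.inl rfl)
  · refine Or.inr (Or.inr ⟨.a ⟨i, by omega⟩, hi, ?_⟩)
    simp only [succGen]
    congr 1
    ext
    rw [val_add_one_of_inner hi]
  · exact Or.inl rfl
  · refine Or.inr (Or.inr ⟨.b ⟨j, by omega⟩, hj, ?_⟩)
    simp [succGen, hj]

/-! ### The wreath recursion on generators -/

theorem psi_fg (x : Gen k n) : psi w v (fg x) = psiGen w v x := PresentedGroup.toGroup.of _

theorem psi_b1 : psi w v (b1 v) = sw := by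
  have : (b1 v : F k v) = fg (.b (firstPos k)) := rfl
  rw [this, psi_fg]
  change pair 1 1 * sw = _
  rw [pair_one, one_mul]

theorem psi_bpow (c : Bool) : psi w v (bpow v c) = swpow c := by
  cases c
  · simp [bpow, swpow]
  · exact psi_b1 w v

theorem psi_succGen {x : Gen k n} (hx : Inner x) :
    psi w v (fg (succGen x)) = atc (letter w v x) (fg x) := by
  rw [psi_fg]
  rcases x with i | j
  · have hi : (i : ℕ) + 1 < n := hx
    have : (i + 1 : Fin n) = ⟨i + 1, hi⟩ := Fin.ext (val_add_one_of_inner hi)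
    simp only [succGen, this, psiGen, coord, letter, active]
    cases v i <;> simp [atc, ofOption, fg]
  · have hj : (j : ℕ) + 1 < k := hx
    simp only [succGen, hj, dif_pos, psiGen, coord, letter, active]
    cases w j <;> simp [atc, ofOption, fg]

theorem psi_a1 : psi w v (a1 v) =
    if v (lastPos n) then pair (bk v) (an v) else pair (an v) (bk v) := by
  have : (a1 v : F k v) = fg (.a (firstPos n)) := rfl
  rw [this, psi_fg]
  simp only [psiGen, firstPos, coord, active]
  cases v (lastPos n) <;> simp [ofOption, fa, fb]

/-! ### The endomorphism `φ` on generators -/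

theorem phi_fg (t : F k v) (x : Gen k n) : phi w v t (fg x) = phiGen w v t x :=
  PresentedGroup.toGroup.of _

theorem phi_inner (t : F k v) {x : Gen k n} (hx : Inner x) :
    phi w v t (fg x) = cj (fg (succGen x)) (bpow v (letter w v x)) := by
  rw [phi_fg]
  rcases x with i | j
  · rfl
  · have hj : (j : ℕ) + 1 < k := hx
    simp only [phiGen, succGen, hj, dif_pos, letter]
    rfl

theorem phi_bk (t : F k v) : phi w v t (bk v) = cj (a1 v) t := by
  have h : (bk v : F k v) = fg (.b (lastPos k)) := rfl
  have : ¬ ((lastPos k : Fin k) : ℕ) + 1 < k := by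
    have := NeZero.pos k
    simp only [lastPos]; omega
  rw [h, phi_fg]
  simp only [phiGen, this, dif_neg, not_false_eq_true]

theorem phi_an (t : F k v) : phi w v t (an v) = cj (a1 v) (bpow v (v (lastPos n))) := by
  have h : (an v : F k v) = fg (.a (lastPos n)) := rfl
  rw [h, phi_fg]
  simp only [phiGen, lastPos_add_one]

theorem succ_eq_phi (t : F k v) {x : Gen k n} (hx : Inner x) :
    fg (succGen x) = cj (phi w v t (fg x)) (bpow v (letter w v x)) := by
  rw [phi_inner w v t hx, ← cj_mul, bpow_mul_self, cj_one]

/-- The values of the second coordinate of `Ψ ∘ φ` on the generators. -/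
def thetaGen (s : F k v) (x : Gen k n) : F k v := by
  classical
  exact if x = .a (lastPos n) then bk v else if x = .b (lastPos k) then cj (an v) s else 1

/-- Among the a_i only a_n has a nontrivial value, so the commutator relators of F hold trivially.
-/
theorem thetaGen_relsF (s : F k v) (r : FreeGroup (Gen k n)) (hr : r ∈ relsF k v) :
    FreeGroup.lift (thetaGen v s) r = 1 := by
  rcases hr with ⟨g, rfl⟩ | ⟨i, i', l, -, -, h, rfl⟩
  · rw [map_pow, FreeGroup.lift_apply_of, pow_two]
    unfold thetaGen
    split_ifs
    · exact fg_mul_self v _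
    · exact cj_mul_self (fg_mul_self v _) _
    · exact one_mul 1
  · rw [map_cm, FreeGroup.lift_apply_of, FreeGroup.lift_apply_of]
    refine cm_eq_one ?_
    unfold thetaGen
    split_ifs <;> simp_all

/-- The second coordinate of `Ψ ∘ φ`, see `psi_phi`. -/
def theta (s : F k v) : F k v →* F k v := PresentedGroup.toGroup (thetaGen_relsF v s)

theorem theta_fg (s : F k v) (x : Gen k n) : theta v s (fg x) = thetaGen v s x :=
  PresentedGroup.toGroup.of _

theorem theta_inner (s : F k v) {x : Gen k n} (hx : Inner x) : theta v s (fg x) = 1 := by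
  rw [theta_fg, thetaGen, if_neg hx.ne_last_a, if_neg hx.ne_last_b]

theorem theta_an (s : F k v) : theta v s (an v) = bk v := by
  have h : (an v : F k v) = fg (.a (lastPos n)) := rfl
  rw [h, theta_fg, thetaGen, if_pos rfl]

theorem theta_bk (s : F k v) : theta v s (bk v) = cj (an v) s := by
  have h : (bk v : F k v) = fg (.b (lastPos k)) := rfl
  rw [h, theta_fg, thetaGen, if_neg (by simp), if_pos rfl]

-- The hypothesis on t is precisely the case of b_k. For an inner generator, the power of b_1 built
-- into φ moves the nontrivial coordinate to position 0; for a_n it puts a_n first and b_k second.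
variable {w v} in
theorem psi_phi {s t : F k v} (h : psi w v (cj (a1 v) t) = pair (bk v) (cj (an v) s)) (g : F k v) :
    psi w v (phi w v t g) = pair g (theta v s g) := by
  induction g using F_induction with
  | one => simp [pair_one]
  | mul g x ih =>
    have key : psi w v (phi w v t (fg x)) = pair (fg x) (theta v s (fg x)) := by
      rcases inner_or x with hx | rfl | rfl
      · rw [phi_inner w v t hx, theta_inner v s hx, map_cj, psi_succGen w v hx, psi_bpow,
          cj_atc_swpow]
        simp [atc]
      · have hp := phi_an w v t
        have ht := theta_an (k := k) v s
        have hpsi := psi_a1 (k := k) w v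
        unfold an fa at hp ht
        unfold fg
        rw [hp, ht, map_cj, psi_bpow, hpsi]
        cases v (lastPos n)
        · simp [swpow, cj_one, an, fa]
        · simp [swpow, cj_pair_sw, an, fa]
      · have hp := phi_bk w v t
        have ht := theta_bk (n := n) v s
        unfold bk fb at hp ht
        unfold fg
        rw [hp, ht, h]
        rfl
    rw [map_mul, map_mul, map_mul, ih, key, pair_mul]

end

section

variable {k n : ℕ} [NeZero k] [NeZero n] (w : Fin k → Bool) (v : Fin n → Bool)

/-! ### The action on the tree -/

/-- The action of an element of `F` on words. -/
def actF (g : F k v) : List Bool → List Bool := (toK w v g).1.1.unop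

theorem actF_one (u : List Bool) : actF w v 1 u = u := by
  simp [actF]

theorem actF_mul (g h : F k v) (u : List Bool) :
    actF w v (g * h) u = actF w v h (actF w v g u) := by
  simp [actF]

theorem toK_fg (x : Gen k n) : toK w v (fg x) = gen w v x := PresentedGroup.toGroup.of _

theorem actF_fg (x : Gen k n) (u : List Bool) : actF w v (fg x) u = act w v (some x) u := by
  unfold actF
  rw [toK_fg]
  rfl

theorem actF_ofOption (q : Option (Gen k n)) (u : List Bool) :
    actF w v (ofOption v q) u = act w v q u := by
  cases q with
  | none => rw [ofOption, actF_one]; cases u <;> rfl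
  | some x => exact actF_fg w v x u

theorem toK_eq_one_iff_actF (g : F k v) : toK w v g = 1 ↔ ∀ u, actF w v g u = u := by
  constructor
  · intro h u
    simp [actF, h]
  · intro h
    apply Subtype.ext
    apply Subtype.ext
    apply MulOpposite.unop_injective
    ext1 u
    exact h u

theorem actF_nil (g : F k v) : actF w v g [] = [] := by
  induction g using F_induction with
  | one => exact actF_one _ _ _
  | mul g x ih => rw [actF_mul, ih, actF_fg]; rfl

theorem actF_cons (g : F k v) (c : Bool) (u : List Bool) :
    actF w v g (c :: u) = (psi w v g).right c :: actF w v ((psi w v g).left c) u := by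
  induction g using F_induction generalizing c u with
  | one => simp [actF_one]
  | mul g x ih =>
    rw [actF_mul, ih, actF_fg, map_mul, psi_fg]
    obtain ⟨a, b, e, h⟩ := exists_eq_pair (psi w v g)
    generalize psi w v g = X at *
    rw [act]
    have hc : ∀ c, (xor (active x) c) = (if active x then Equiv.boolNot else 1 : Equiv.Perm Bool) c := by
      intro c; cases active x <;> simp
    have hl : ∀ c, (psiGen w v x).left c = ofOption v (coord w v x c) := by
      intro c; cases c <;> simp [psiGen, pair]
    have hr : (psiGen w v x).right = if active x then Equiv.boolNot else 1 := by
      simp [psiGen, pair]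
    rw [SemidirectProduct.mul_right, SemidirectProduct.mul_left, hr, Pi.mul_apply, actF_mul]
    have hs : ((mulAutArrow X.right) (psiGen w v x).left) c =
        ofOption v (coord w v x (X.right c)) := by
      rw [← hl, h]
      cases e <;> cases c <;> simp [swpow, sw, pair] <;> rfl
    rw [hs, actF_ofOption]
    congr 1
    rw [hc, h]
    cases e <;> cases c <;> cases active x <;> simp [swpow, sw, pair]

/-- By `actF_cons`, Ψ(g) records how g acts on the first letter and on the two subtrees. From here
on the action on words enters only through this equivalence. -/
theorem toK_eq_one_iff (g : F k v) : toK w v g = 1 ↔ mapWr (toK w v) (psi w v g) = 1 := by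
  rw [toK_eq_one_iff_actF]
  constructor
  · intro h
    have h1 : ∀ c u, (psi w v g).right c = c ∧ actF w v ((psi w v g).left c) u = u := by
      intro c u
      have := h (c :: u)
      rw [actF_cons] at this
      simpa using this
    refine (mapWr_eq_one_iff _ _).2 ⟨fun c => ?_, Equiv.ext fun c => ?_⟩
    · rw [toK_eq_one_iff_actF]
      exact fun u => (h1 c u).2
    · exact (h1 c []).1
  · intro h u
    cases u with
    | nil => exact actF_nil w v g
    | cons c u =>
      obtain ⟨hl, hr⟩ := (mapWr_eq_one_iff _ _).1 h
      replace hl := hl c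
      rw [toK_eq_one_iff_actF] at hl
      rw [actF_cons, hr, hl]
      rfl

theorem toK_eq_one_of_pair {g a b : F k v} (h : psi w v g = pair a b) (ha : toK w v a = 1)
    (hb : toK w v b = 1) : toK w v g = 1 := by
  rw [toK_eq_one_iff, h, mapWr_pair, ha, hb, pair_one]

theorem toK_pair_of_eq_one {g a b : F k v} {e : Bool} (h : psi w v g = pair a b * swpow e)
    (hg : toK w v g = 1) : toK w v a = 1 ∧ toK w v b = 1 ∧ e = false := by
  rw [toK_eq_one_iff, h, map_mul, mapWr_pair, mapWr_swpow] at hg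
  refine pair_swpow_inj (c := (1 : K w v)) (d := 1) (e' := false) ?_
  rw [hg, pair_one]
  rfl

theorem toK_eq_iff {g g' a b a' b' : F k v} (h : psi w v g = pair a b)
    (h' : psi w v g' = pair a' b') :
    toK w v g = toK w v g' ↔ toK w v a = toK w v a' ∧ toK w v b = toK w v b' := by
  have key : ∀ x y : F k v, toK w v x = toK w v y ↔ toK w v (x * y⁻¹) = 1 := by
    intro x y
    rw [map_mul, map_inv, mul_inv_eq_one]
  have hp : psi w v (g * g'⁻¹) = pair (a * a'⁻¹) (b * b'⁻¹) := by
    rw [map_mul, map_inv, h, h', pair_inv, pair_mul]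
  rw [key, key a, key b]
  constructor
  · intro hg
    obtain ⟨h1, h2, -⟩ := toK_pair_of_eq_one w v
      (show _ = pair (a * a'⁻¹) (b * b'⁻¹) * swpow false by rw [hp, swpow]; simp) hg
    exact ⟨h1, h2⟩
  · rintro ⟨h1, h2⟩
    exact toK_eq_one_of_pair w v hp h1 h2

/-! ### Parities -/

open Classical in
/-- The parity of the number of occurrences of a generator. -/
def par (x : Gen k n) : F k v →* ℤˣ :=
  PresentedGroup.toGroup (f := fun y => if y = x then -1 else 1) (by
    rintro r (⟨g, rfl⟩ | ⟨i, i', l, -, -, h, rfl⟩)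
    · rw [map_pow]; exact Int.units_sq _
    · rw [map_cm]; exact cm_eq_one (mul_comm _ _))

open Classical in
theorem par_fg (x y : Gen k n) : par v x (fg y) = if y = x then -1 else 1 :=
  PresentedGroup.toGroup.of _

theorem par_fg_self (x : Gen k n) : par v x (fg x) = -1 := by
  classical
  rw [par_fg, if_pos rfl]

theorem par_fg_ne {x y : Gen k n} (h : y ≠ x) : par v x (fg y) = 1 := by
  classical
  rw [par_fg, if_neg h]

theorem par_cj (x : Gen k n) (g h : F k v) : par v x (cj g h) = par v x g := by
  rw [map_cj, cj_eq_self_iff]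
  exact mul_comm _ _

theorem succGen_ne_b1 (x : Gen k n) : succGen x ≠ .b (firstPos k) := by
  rcases x with i | j
  · simp [succGen]
  · simp only [succGen]
    split_ifs
    · simp [firstPos]
    · simp

theorem succGen_ne_a1 {x : Gen k n} (hx : Inner x) : succGen x ≠ .a (firstPos n) := by
  rcases x with i | j
  · have hi : (i : ℕ) + 1 < n := hx
    simp only [succGen, ne_eq, Gen.a.injEq]
    intro h
    have := congrArg Fin.val h
    rw [val_add_one_of_inner hi] at this
    simp [firstPos] at this
  · have hj : (j : ℕ) + 1 < k := hx
    simp [succGen, hj]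

theorem succGen_inj {x y : Gen k n} (hx : Inner x) (hy : Inner y) (h : succGen x = succGen y) :
    x = y := by
  rcases x with i | j <;> rcases y with i' | j'
  · simp only [succGen, Gen.a.injEq] at h
    exact congrArg _ (add_right_cancel h)
  · have hj : (j' : ℕ) + 1 < k := hy
    simp [succGen, hj] at h
  · have hj : (j : ℕ) + 1 < k := hx
    simp [succGen, hj] at h
  · have hj : (j : ℕ) + 1 < k := hx
    have hj' : (j' : ℕ) + 1 < k := hy
    simp only [succGen, hj, hj', dif_pos, Gen.b.injEq, Fin.mk.injEq, add_left_inj] at h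
    exact congrArg _ (Fin.ext h)

theorem succGen_an : succGen (.a (lastPos n)) = (.a (firstPos n) : Gen k n) := by
  simp only [succGen, lastPos_add_one]

theorem succGen_bk : succGen (.b (lastPos k)) = (.a (firstPos n) : Gen k n) := by
  have : ¬ ((lastPos k : Fin k) : ℕ) + 1 < k := by
    have := NeZero.pos k
    simp only [lastPos]; omega
  simp only [succGen, this, dif_neg, not_false_eq_true]

theorem psi_fg_cases (x : Gen k n) :
    (x = .b (firstPos k) ∧ psi w v (fg x) = sw) ∨
    (x = .a (firstPos n) ∧ ∃ a b : F k v, psi w v (fg x) = pair a b ∧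
      ((a = bk v ∧ b = an v) ∨ (a = an v ∧ b = bk v))) ∨
    ∃ (y : Gen k n) (c : Bool), Inner y ∧ x = succGen y ∧ psi w v (fg x) = atc c (fg y) := by
  rcases gen_cases x with rfl | rfl | ⟨y, hy, rfl⟩
  · exact Or.inl ⟨rfl, psi_b1 w v⟩
  · refine Or.inr (Or.inl ⟨rfl, ?_⟩)
    have h := psi_a1 (k := k) w v
    cases hv : v (lastPos n)
    · rw [hv, if_neg (by simp)] at h
      exact ⟨_, _, h, Or.inr ⟨rfl, rfl⟩⟩
    · rw [hv, if_pos rfl] at h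
      exact ⟨_, _, h, Or.inl ⟨rfl, rfl⟩⟩
  · exact Or.inr (Or.inr ⟨y, _, hy, rfl, psi_succGen w v hy⟩)

theorem par_b1_eq {g a b : F k v} {e : Bool} (h : psi w v g = pair a b * swpow e) :
    par v (.b (firstPos k)) g = if e then -1 else 1 := by
  induction g using F_induction generalizing a b e with
  | one =>
    have : pair 1 1 * swpow false = pair a b * swpow e := by
      rw [← h, map_one, pair_one, swpow]; rfl
    obtain ⟨-, -, rfl⟩ := pair_swpow_inj this
    simp
  | mul g x ih =>
    obtain ⟨a', b', e', h'⟩ := exists_eq_pair (psi w v g)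
    have ih' := ih h'
    rw [map_mul, ih']
    rw [map_mul, h'] at h
    rcases psi_fg_cases w v x with ⟨rfl, hx⟩ | ⟨rfl, a0, b0, hx, -⟩ | ⟨y, c, hy, rfl, hx⟩
    · rw [hx, mul_assoc, swpow_mul_sw] at h
      obtain ⟨-, -, rfl⟩ := pair_swpow_inj h
      rw [par_fg_self]
      cases e' <;> simp
    · rw [hx, mul_assoc, swpow_mul_pair, ← mul_assoc] at h
      rw [par_fg_ne v (by simp), mul_one]
      cases e' <;> simp only [if_true, if_false, Bool.false_eq_true, pair_mul] at h ⊢ <;>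
        obtain ⟨-, -, rfl⟩ := pair_swpow_inj h <;> simp
    · rw [hx, mul_assoc, swpow_mul_atc, ← mul_assoc] at h
      rw [par_fg_ne v (succGen_ne_b1 _), mul_one]
      unfold atc at h
      cases e' <;> cases c <;> simp only [Bool.xor_true, Bool.xor_false, Bool.not_true,
        Bool.not_false, if_true, if_false, Bool.false_eq_true, pair_mul] at h ⊢ <;>
        obtain ⟨-, -, rfl⟩ := pair_swpow_inj h <;> simp

/-- Each successor of an inner x contributes one x to one coordinate, and a_1 contributes one a_n
and one b_k. Since a_1 is the successor of both a_n and b_k, the formula has no exceptions. -/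
theorem par_succGen {g a b : F k v} {e : Bool} (h : psi w v g = pair a b * swpow e)
    (x : Gen k n) : par v (succGen x) g = par v x a * par v x b := by
  classical
  induction g using F_induction generalizing a b e with
  | one =>
    have : pair 1 1 * swpow false = pair a b * swpow e := by
      rw [← h, map_one, pair_one, swpow]; rfl
    obtain ⟨rfl, rfl, -⟩ := pair_swpow_inj this
    simp
  | mul g y ih =>
    obtain ⟨a', b', e', h'⟩ := exists_eq_pair (psi w v g)
    have ih' := ih h'
    rw [map_mul, ih']
    rw [map_mul, h'] at h
    rcases psi_fg_cases w v y with ⟨rfl, hy⟩ | ⟨rfl, a0, b0, hy, h0⟩ | ⟨y, c, hy, rfl, hx⟩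
    · rw [hy, mul_assoc, swpow_mul_sw] at h
      obtain ⟨rfl, rfl, -⟩ := pair_swpow_inj h
      rw [par_fg_ne v (succGen_ne_b1 x).symm, mul_one]
    · rw [hy, mul_assoc, swpow_mul_pair, ← mul_assoc] at h
      have key : par v (succGen x) (fg (.a (firstPos n))) = par v x a0 * par v x b0 := by
        have key1 : par v (succGen x) (fg (.a (firstPos n))) =
            par v x (bk v) * par v x (an v) := by
          change _ = par v x (fg (.b (lastPos k))) * par v x (fg (.a (lastPos n)))
          rcases inner_or x with hx | rfl | rfl
          · rw [par_fg_ne v (succGen_ne_a1 hx).symm, par_fg_ne v hx.ne_last_a.symm,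
              par_fg_ne v hx.ne_last_b.symm, mul_one]
          · rw [succGen_an, par_fg_self, par_fg_self, par_fg_ne v (by simp), one_mul]
          · rw [succGen_bk, par_fg_self, par_fg_self, par_fg_ne v (by simp), mul_one]
        rcases h0 with ⟨rfl, rfl⟩ | ⟨rfl, rfl⟩
        · exact key1
        · rw [key1, mul_comm]
      rw [key]
      cases e' <;> simp only [if_true, if_false, Bool.false_eq_true, pair_mul] at h <;>
        obtain ⟨rfl, rfl, -⟩ := pair_swpow_inj h <;> simp only [map_mul]
      · exact mul_mul_mul_comm _ _ _ _
      · rw [mul_comm (par v x a0), mul_mul_mul_comm]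
    · rw [hx, mul_assoc, swpow_mul_atc, ← mul_assoc] at h
      have key : par v (succGen x) (fg (succGen y)) = par v x (fg y) := by
        rw [par_fg, par_fg]
        refine if_congr ⟨fun hs => ?_, fun hs => by rw [hs]⟩ rfl rfl
        rcases inner_or x with hx | rfl | rfl
        · exact succGen_inj hy hx hs
        · rw [succGen_an] at hs; exact absurd hs (succGen_ne_a1 hy)
        · rw [succGen_bk] at hs; exact absurd hs (succGen_ne_a1 hy)
      rw [key]
      unfold atc at h
      cases e' <;> cases c <;> simp only [Bool.xor_true, Bool.xor_false, Bool.not_true,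
        Bool.not_false, if_true, if_false, Bool.false_eq_true, pair_mul] at h <;>
        obtain ⟨rfl, rfl, -⟩ := pair_swpow_inj h <;> simp only [map_mul, mul_one] <;>
        first
          | exact mul_assoc _ _ _
          | exact mul_right_comm _ _ _

/-- The position of a generator in the list `b_1, …, b_k, a_1, …, a_n`. -/
def rank : Gen k n → ℕ
  | .a i => k + i
  | .b j => j

/-- Parities of generators are thus well defined on K(w,v), which is how elements are told apart
there. The induction runs along b_1, …, b_k, a_1, …, a_n: the parity of a successor is a product of
parities in coordinates that are again trivial in K(w,v). -/
theorem par_eq_one_of_toK {g : F k v} (hg : toK w v g = 1) (x : Gen k n) : par v x g = 1 := by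
  induction hN : rank x using Nat.strong_induction_on generalizing x g with
  | _ N ih =>
    obtain ⟨a, b, e, h⟩ := exists_eq_pair (psi w v g)
    obtain ⟨ha, hb, rfl⟩ := toK_pair_of_eq_one w v h hg
    have step : ∀ y : Gen k n, rank y < N → par v (succGen y) g = 1 := by
      intro y hy
      rw [par_succGen w v h, ih _ hy ha y rfl, ih _ hy hb y rfl, one_mul]
    rcases gen_cases x with rfl | rfl | ⟨y, hy, rfl⟩
    · rw [par_b1_eq w v h]; simp
    -- Both a_n and b_k have successor a_1, but only b_k comes before a_1 in the order of the
    -- induction.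
    · rw [← succGen_bk]
      apply step
      have := NeZero.pos k
      simp only [rank, firstPos, lastPos] at hN ⊢
      omega
    · apply step
      rcases y with i | j
      · have hi : (i : ℕ) + 1 < n := hy
        simp only [rank, succGen, val_add_one_of_inner hi] at hN ⊢
        omega
      · have hj : (j : ℕ) + 1 < k := hy
        simp only [rank, succGen, hj, dif_pos] at hN ⊢
        omega

theorem toK_ne_of_par {g g' : F k v} (x : Gen k n) (h : par v x g ≠ par v x g') :
    toK w v g ≠ toK w v g' := by
  intro e
  apply h
  have : toK w v (g * g'⁻¹) = 1 := by rw [map_mul, map_inv, e, mul_inv_cancel]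
  have h1 := par_eq_one_of_toK w v this x
  rw [map_mul, map_inv, mul_inv_eq_one] at h1
  exact h1

end

section

variable {k n : ℕ} [NeZero k] [NeZero n] (w : Fin k → Bool) (v : Fin n → Bool)

/-! ### The presented group -/

/-- The iterates of `φ`. -/
def phiIt (t : F k v) : ℕ → (F k v →* F k v)
  | 0 => MonoidHom.id _
  | l + 1 => (phi w v t).comp (phiIt t l)

theorem phiIt_zero (t g : F k v) : phiIt w v t 0 g = g := rfl

theorem phiIt_succ (t : F k v) (l : ℕ) (g : F k v) :
    phiIt w v t (l + 1) g = phi w v t (phiIt w v t l g) := rfl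

theorem phiIt_eq (t : F k v) (l : ℕ) (g : F k v) : phiIt w v t l g = (phi w v t)^[l] g := by
  induction l with
  | zero => rfl
  | succ l ih => rw [phiIt_succ, ih, Function.iterate_succ_apply']

theorem toFbar_phiIt (s t : F k v) (m l : ℕ) (g : F k v) :
    toFbar w v s t m (phiIt w v t l g) = (phiBar w v s t m)^[l] (toFbar w v s t m g) := by
  induction l with
  | zero => rfl
  | succ l ih => rw [phiIt_succ, Function.iterate_succ_apply', ← ih]; rfl

/-- The element `(a_n^s b_k)^{2^m}`. -/
def rho (s : F k v) (m : ℕ) : F k v := (cj (an v) s * bk v) ^ 2 ^ m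

/-- The subgroup `⟨a_1^t, b_1⟩` of `F`. -/
def Delta (t : F k v) : Subgroup (F k v) := Subgroup.closure {cj (a1 v) t, b1 v}

/-- The subgroup `⟨b_k, a_n^s⟩` of `F`. -/
def Lambda (s : F k v) : Subgroup (F k v) := Subgroup.closure {bk v, cj (an v) s}

theorem cj_a1_mul_self (t : F k v) : cj (a1 v) t * cj (a1 v) t = 1 :=
  cj_mul_self (fg_mul_self v _) t

theorem mem_Delta_A (t : F k v) : cj (a1 v) t ∈ Delta v t :=
  Subgroup.subset_closure (Or.inl rfl)

theorem mem_Delta_b1 (t : F k v) : b1 v ∈ Delta v t :=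
  Subgroup.subset_closure (Or.inr rfl)

theorem bpow_mem_Delta (t : F k v) (c : Bool) : bpow v c ∈ Delta v t := by
  cases c
  · exact one_mem _
  · exact mem_Delta_b1 v t

variable {v} in
theorem Delta_induction {t : F k v} {p : F k v → Prop} (one : p 1)
    (A : ∀ g ∈ Delta v t, p g → p (g * cj (a1 v) t))
    (b : ∀ g ∈ Delta v t, p g → p (g * b1 v)) {g : F k v} (hg : g ∈ Delta v t) : p g := by
  unfold Delta at hg
  induction hg using Subgroup.closure_induction_right with
  | one => exact one
  | mul_right g hg y hy ih =>
    rcases hy with rfl | rfl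
    · exact A g hg ih
    · exact b g hg ih
  | mul_inv_cancel g hg y hy ih =>
    rcases hy with rfl | rfl
    · rw [inv_eq_of_mul_eq_one_right (cj_a1_mul_self v t)]
      exact A g hg ih
    · rw [b1_inv]
      exact b g hg ih

theorem psi_A_right (t : F k v) : (psi w v (cj (a1 v) t)).right = 1 := by
  have h : (psi w v (a1 v)).right = 1 := by
    rw [psi_a1]
    split_ifs <;> rfl
  rw [map_cj]
  simp [cj, h]

/-- The permutation of the first letter prescribed for two letters. -/
def parity (c c' : Bool) : Equiv.Perm Bool := if c = c' then Equiv.boolNot else 1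

/-- The product of factors `a_1^t` (for `false`) and `b_1` (for `true`). -/
def deltaWord (t : F k v) (u : List Bool) : F k v :=
  (u.map fun c => if c then b1 v else cj (a1 v) t).prod

theorem dihWord_eq (s t : F k v) (m : ℕ) (u : List Bool) :
    dihWord w v s t m u = toFbar w v s t m (deltaWord v t u) := by
  unfold dihWord deltaWord
  rw [map_list_prod, List.map_map]
  rfl

theorem deltaWord_mem (t : F k v) (u : List Bool) : deltaWord v t u ∈ Delta v t := by
  refine Subgroup.list_prod_mem _ ?_
  intro x hx
  obtain ⟨c, -, rfl⟩ := List.mem_map.1 hx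
  cases c
  · exact mem_Delta_A v t
  · exact mem_Delta_b1 v t

theorem psi_deltaWord_right (t : F k v) (u : List Bool) :
    (psi w v (deltaWord v t u)).right = if Odd (u.count true) then Equiv.boolNot else 1 := by
  induction u with
  | nil => simp [deltaWord]
  | cons c u ih =>
    have : deltaWord v t (c :: u) = (if c then b1 v else cj (a1 v) t) * deltaWord v t u := by
      simp [deltaWord]
    rw [this, map_mul, SemidirectProduct.mul_right, ih]
    cases c
    · simp [psi_A_right]
    · simp only [if_true, psi_b1, sw_right, List.count_cons_self, Nat.odd_add_one]
      by_cases h : Odd (List.count true u) <;> simp [h, boolNot_mul_self]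

theorem exists_deltaWord {t g : F k v} (hg : g ∈ Delta v t) : ∃ u, g = deltaWord v t u := by
  refine Delta_induction (p := fun g => ∃ u, g = deltaWord v t u) ⟨[], rfl⟩ ?_ ?_ hg
  · rintro _ - ⟨u, rfl⟩
    exact ⟨u ++ [false], by simp [deltaWord]⟩
  · rintro _ - ⟨u, rfl⟩
    exact ⟨u ++ [true], by simp [deltaWord]⟩

/-- Counting factors b_1 modulo 2 amounts to recording the action on the first letter, because a_1^t
fixes that letter. The latter is multiplicative and visible in Ψ. -/
theorem mem_twist_iff (s t : F k v) (m : ℕ) (c c' : Bool) (x : Fbar w v s t m) :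
    x ∈ twist w v s t m c c' ↔
      ∃ u ∈ Delta v t, (psi w v u).right = parity c c' ∧ x = toFbar w v s t m u := by
  have key : ∀ u : List Bool, (psi w v (deltaWord v t u)).right = parity c c' ↔
      (if c = c' then Odd (u.count true) else Even (u.count true)) := by
    intro u
    rw [psi_deltaWord_right, parity]
    by_cases h : Odd (u.count true)
    · have h' := Nat.not_even_iff_odd.2 h
      split_ifs <;> simp [h', h, boolNot_ne_one]
    · have h' := Nat.not_odd_iff_even.1 h
      split_ifs <;> simp [h', h, boolNot_ne_one.symm]
  have h1 : x ∈ twist w v s t m c c' ↔ ∃ u : List Bool,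
      (if c = c' then Odd (u.count true) else Even (u.count true)) ∧ x = dihWord w v s t m u := by
    unfold twist
    split_ifs <;> rfl
  rw [h1]
  constructor
  · rintro ⟨u, hu, rfl⟩
    exact ⟨_, deltaWord_mem v t u, (key u).2 hu, dihWord_eq w v s t m u⟩
  · rintro ⟨g, hg, hp, rfl⟩
    obtain ⟨u, rfl⟩ := exists_deltaWord v hg
    exact ⟨u, (key u).1 hp, (dihWord_eq w v s t m u).symm⟩

theorem fa_succ {i : ℕ} (hi : i + 1 < n) :
    fa v ⟨i + 1, hi⟩ = (fg (succGen (.a ⟨i, Nat.lt_of_succ_lt hi⟩)) : F k v) := by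
  unfold fa fg
  congr 1
  simp only [succGen]
  congr 1
  ext
  exact (val_add_one_of_inner (i := ⟨i, Nat.lt_of_succ_lt hi⟩) hi).symm

theorem fb_succ {j : ℕ} (hj : j + 1 < k) :
    fb v ⟨j + 1, hj⟩ = (fg (succGen (.b ⟨j, Nat.lt_of_succ_lt hj⟩)) : F k v) := by
  unfold fb fg
  simp [succGen, hj]

theorem exists_of_mem_setR {s t : F k v} {m : ℕ} {x : Fbar w v s t m}
    (hx : x ∈ setR w v s t m) :
    ∃ y z : Gen k n, Inner y ∧ Inner z ∧ ∃ u ∈ Delta v t,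
      (psi w v u).right = parity (letter w v y) (letter w v z) ∧
      x = toFbar w v s t m (cm (fg (succGen y)) (cj (fg (succGen z)) u)) := by
  rcases hx with (⟨i, j, hi, hj, u, hu, rfl⟩ | ⟨i, j, hi, hj, u, hu, rfl⟩) |
    ⟨i, j, hi, hj, u, hu, rfl⟩ <;>
    rw [mem_twist_iff] at hu <;> obtain ⟨u, hu, hp, rfl⟩ := hu
  · refine ⟨.b ⟨i, Nat.lt_of_succ_lt hi⟩, .b ⟨j, Nat.lt_of_succ_lt hj⟩, hi, hj, u, hu, hp, ?_⟩
    rw [map_cm, map_cj, fb_succ, fb_succ]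
  · refine ⟨.a ⟨i, Nat.lt_of_succ_lt hi⟩, .b ⟨j, Nat.lt_of_succ_lt hj⟩, hi, hj, u, hu, hp, ?_⟩
    rw [map_cm, map_cj, fb_succ, fa_succ]
  · refine ⟨.a ⟨i, Nat.lt_of_succ_lt hi⟩, .a ⟨j, Nat.lt_of_succ_lt hj⟩, hi, hj, u, hu, hp, ?_⟩
    rw [map_cm, map_cj, fa_succ, fa_succ]

/-- The set R contains [a_i, b_j^u] but is not declared to contain [b_j, a_i^u]. The latter is a
conjugate of the inverse of [a_i, b_j^{u⁻¹}], which explains the second alternative. -/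
theorem mem_setR {s t : F k v} {m : ℕ} {y z : Gen k n} (hy : Inner y) (hz : Inner z)
    {u : F k v} (hu : u ∈ Delta v t)
    (hp : (psi w v u).right = parity (letter w v y) (letter w v z)) :
    toFbar w v s t m (cm (fg (succGen y)) (cj (fg (succGen z)) u)) ∈ setR w v s t m ∨
    toFbar w v s t m (cm (fg (succGen z)) (cj (fg (succGen y)) u⁻¹)) ∈ setR w v s t m := by
  have htw : toFbar w v s t m u ∈ twist w v s t m (letter w v y) (letter w v z) :=
    (mem_twist_iff ..).2 ⟨u, hu, hp, rfl⟩
  have htw' : toFbar w v s t m u⁻¹ ∈ twist w v s t m (letter w v z) (letter w v y) := by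
    refine (mem_twist_iff ..).2 ⟨u⁻¹, inv_mem hu, ?_, rfl⟩
    rw [map_inv, SemidirectProduct.inv_right, hp]
    unfold parity
    rw [inv_eq_iff_mul_eq_one]
    by_cases h : letter w v y = letter w v z
    · rw [if_pos h, if_pos h.symm, boolNot_mul_self]
    · rw [if_neg h, if_neg (Ne.symm h), one_mul]
  simp only [map_cm, map_cj]
  rcases y with i | i <;> rcases z with j | j
  · have hi : (i : ℕ) + 1 < n := hy
    have hj : (j : ℕ) + 1 < n := hz
    refine Or.inl (Or.inr ⟨i, j, hi, hj, _, htw, ?_⟩)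
    rw [fa_succ, fa_succ]
  · have hi : (i : ℕ) + 1 < n := hy
    have hj : (j : ℕ) + 1 < k := hz
    refine Or.inl (Or.inl (Or.inr ⟨i, j, hi, hj, _, htw, ?_⟩))
    rw [fa_succ, fb_succ]
  · have hi : (i : ℕ) + 1 < k := hy
    have hj : (j : ℕ) + 1 < n := hz
    refine Or.inr (Or.inl (Or.inr ⟨j, i, hj, hi, _, htw', ?_⟩))
    rw [fa_succ, fb_succ]
  · have hi : (i : ℕ) + 1 < k := hy
    have hj : (j : ℕ) + 1 < k := hz
    refine Or.inl (Or.inl (Or.inl ⟨i, j, hi, hj, _, htw, ?_⟩))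
    rw [fb_succ, fb_succ]

/-- The group given by the presentation of `K(w, v)`. -/
abbrev PG (s t : F k v) (m : ℕ) : Type := PresentedGroup (presRels w v s t m)

/-- The natural homomorphism from `F` to the presented group. -/
def toPG (s t : F k v) (m : ℕ) : F k v →* PG w v s t m :=
  PresentedGroup.toGroup (f := PresentedGroup.of) (by
    intro r hr
    have h1 : FreeGroup.lift (PresentedGroup.of : Gen k n → PG w v s t m) =
        PresentedGroup.mk _ := by
      ext x; simp [PresentedGroup.of]
    rw [h1]
    refine PresentedGroup.one_of_mem (Or.inl ?_)
    change toFbar w v s t m (PresentedGroup.mk _ r) = 1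
    rw [PresentedGroup.one_of_mem hr, map_one])

theorem toPG_fg (s t : F k v) (m : ℕ) (x : Gen k n) :
    toPG w v s t m (fg x) = PresentedGroup.of x := PresentedGroup.toGroup.of _

theorem toPG_mk (s t : F k v) (m : ℕ) (r : FreeGroup (Gen k n)) :
    toPG w v s t m (PresentedGroup.mk _ r) = PresentedGroup.mk _ r := by
  have : (toPG w v s t m).comp (PresentedGroup.mk _) = PresentedGroup.mk _ := by
    ext x
    exact toPG_fg w v s t m x
  exact DFunLike.congr_fun this r

/-- A homomorphism on `F` that kills the relators of the presentation. -/
structure Kills {H : Type*} [Group H] (s t : F k v) (m : ℕ) (f : F k v →* H) : Prop where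
  rho : ∀ l, f (phiIt w v t l (rho v s m)) = 1
  comm : ∀ l (y z : Gen k n), Inner y → Inner z → ∀ u ∈ Delta v t,
    (psi w v u).right = parity (letter w v y) (letter w v z) →
    Commute (f (phiIt w v t l (fg (succGen y)))) (f (phiIt w v t l (cj (fg (succGen z)) u)))

theorem mk_surjective (g : F k v) : ∃ r, g = PresentedGroup.mk _ r := by
  obtain ⟨r, hr⟩ := PresentedGroup.mk_surjective (relsF k v) g
  exact ⟨r, hr.symm⟩

theorem toPG_eq_one_of_setR {s t : F k v} {m : ℕ} {g : F k v}
    (hg : toFbar w v s t m g ∈ setR w v s t m) (l : ℕ) :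
    toPG w v s t m (phiIt w v t l g) = 1 := by
  obtain ⟨r, hr⟩ := mk_surjective v (phiIt w v t l g)
  rw [hr, toPG_mk]
  refine PresentedGroup.one_of_mem (Or.inr ⟨l, ?_⟩)
  rw [← hr, toFbar_phiIt]
  exact ⟨_, hg, rfl⟩

theorem toPG_kills (s t : F k v) (m : ℕ) : Kills w v s t m (toPG w v s t m) where
  rho l := by
    obtain ⟨r, hr⟩ := mk_surjective v (phiIt w v t l (KneadingGroup.rho v s m))
    rw [hr, toPG_mk]
    refine PresentedGroup.one_of_mem (Or.inl ?_)
    change toFbar w v s t m (PresentedGroup.mk _ r) = 1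
    rw [← hr]
    refine (QuotientGroup.eq_one_iff _).2 (Subgroup.subset_normalClosure ⟨l, ?_⟩)
    rw [KneadingGroup.rho, map_pow, phiIt_eq]
  comm l y z hy hz u hu hp := by
    rcases mem_setR (s := s) (m := m) w v hy hz hu hp with h | h
    · rw [← cm_eq_one_iff, ← map_cm, ← map_cm]
      exact toPG_eq_one_of_setR w v h l
    · have h1 := toPG_eq_one_of_setR w v h l
      rw [map_cm, map_cm, cm_eq_one_iff] at h1
      rw [← commute_cj_iff _ _ (toPG w v s t m (phiIt w v t l u)), ← map_cj, ← map_cj, ← map_cj,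
        ← map_cj, ← cj_mul, inv_mul_cancel, cj_one] at h1
      exact h1.symm

/-- This is the universal property of Γ: a homomorphism on F factors through Γ as soon as it kills
the relators. -/
theorem Kills.eq_one {H : Type*} [Group H] {s t : F k v} {m : ℕ} {f : F k v →* H}
    (hf : Kills w v s t m f) {g : F k v} (hg : toPG w v s t m g = 1) : f g = 1 := by
  have hbar : ∀ x, toFbar w v s t m x = 1 → f x = 1 := by
    intro x hx
    have hx' : x ∈ barKer w v s t m := (QuotientGroup.eq_one_iff _).1 hx
    have : barKer w v s t m ≤ f.ker := by
      refine Subgroup.normalClosure_le_normal ?_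
      rintro x ⟨l, rfl⟩
      have := hf.rho l
      rw [KneadingGroup.rho, map_pow, phiIt_eq] at this
      exact this
    exact this hx'
  have hrel : ∀ r ∈ presRels w v s t m, FreeGroup.lift (fun x => f (fg x)) r = 1 := by
    have hlift : ∀ r, FreeGroup.lift (fun x => f (fg x)) r = f (PresentedGroup.mk _ r) := by
      intro r
      have : FreeGroup.lift (fun x => f (fg x)) = f.comp (PresentedGroup.mk _) := by
        ext x
        simp [fg, PresentedGroup.of]
      rw [this]; rfl
    rintro r (hr | ⟨l, x, hx, hr⟩)
    · rw [hlift]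
      exact hbar _ hr
    · rw [hlift]
      obtain ⟨y, z, hy, hz, u, hu, hp, rfl⟩ := exists_of_mem_setR w v hx
      rw [← toFbar_phiIt] at hr
      -- A word representing an element of φ^ℓ(R) in F̄ agrees with the iterated commutator only up
      -- to the kernel of F → F̄, which f kills.
      have h1 : f (PresentedGroup.mk _ r) = f (phiIt w v t l (cm (fg (succGen y))
          (cj (fg (succGen z)) u))) := by
        rw [← mul_inv_eq_one, ← map_inv, ← map_mul]
        apply hbar
        rw [map_mul, map_inv, ← hr, mul_inv_cancel]
      rw [h1, map_cm, map_cm, cm_eq_one_iff]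
      exact hf.comm l y z hy hz u hu hp
  have hcomp : (PresentedGroup.toGroup hrel).comp (toPG w v s t m) = f := by
    apply F_hom_ext
    intro x
    rw [MonoidHom.comp_apply, toPG_fg, PresentedGroup.toGroup.of]
  rw [← hcomp, MonoidHom.comp_apply, hg, map_one]

/-- Applying φ shifts ℓ by one in both families of relators, so φ descends to Γ. -/
theorem toPG_phi {s t : F k v} {m : ℕ} {g : F k v} (hg : toPG w v s t m g = 1) :
    toPG w v s t m (phi w v t g) = 1 := by
  have : Kills w v s t m ((toPG w v s t m).comp (phi w v t)) :=
    ⟨fun l => (toPG_kills w v s t m).rho (l + 1),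
      fun l y z hy hz u hu hp => (toPG_kills w v s t m).comm (l + 1) y z hy hz u hu hp⟩
  exact this.eq_one w v hg

end

/-! ### Groups generated by two involutions -/

section Dihedral

variable {H : Type*} [Group H] {α β : H}

theorem mem_closure_pair_induction (hα : α * α = 1) (hβ : β * β = 1) {p : H → Prop} (one : p 1)
    (hpα : ∀ g ∈ Subgroup.closure {α, β}, p g → p (g * α))
    (hpβ : ∀ g ∈ Subgroup.closure {α, β}, p g → p (g * β)) {g : H}
    (hg : g ∈ Subgroup.closure {α, β}) : p g := by
  induction hg using Subgroup.closure_induction_right with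
  | one => exact one
  | mul_right g hg y hy ih =>
    rcases hy with rfl | rfl
    · exact hpα g hg ih
    · exact hpβ g hg ih
  | mul_inv_cancel g hg y hy ih =>
    rcases hy with rfl | rfl
    · rw [inv_eq_of_mul_eq_one_right hα]
      exact hpα g hg ih
    · rw [inv_eq_of_mul_eq_one_right hβ]
      exact hpβ g hg ih

/-- Being its own inverse, (αβ)² equals (βα)², and conjugation by α or β interchanges these two. -/
theorem commute_sq_of_involutions (hα : α * α = 1) (hβ : β * β = 1) (hζ : ((α * β) ^ 2) ^ 2 = 1)
    {x : H} (hx : x ∈ Subgroup.closure {α, β}) : Commute x ((α * β) ^ 2) := by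
  have hα' := inv_eq_of_mul_eq_one_right hα
  have hβ' := inv_eq_of_mul_eq_one_right hβ
  have hinv : (α * β) ^ 2 = (β * α) ^ 2 := by
    rw [pow_two ((α * β) ^ 2)] at hζ
    rw [← inv_eq_of_mul_eq_one_right hζ, ← inv_pow, mul_inv_rev, hα', hβ']
  have ca : Commute α ((α * β) ^ 2) := by
    change α * (α * β) ^ 2 = (α * β) ^ 2 * α
    nth_rewrite 2 [hinv]
    rw [pow_two, pow_two]
    calc α * (α * β * (α * β)) = (α * α) * (β * α * β) := by group
      _ = (β * α * β) * (α * α) := by rw [hα]; group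
      _ = _ := by group
  have cb : Commute β ((α * β) ^ 2) := by
    change β * (α * β) ^ 2 = (α * β) ^ 2 * β
    nth_rewrite 1 [hinv]
    rw [pow_two, pow_two]
    calc β * (β * α * (β * α)) = (β * β) * (α * β * α) := by group
      _ = (α * β * α) * (β * β) := by rw [hβ]; group
      _ = _ := by group
  refine mem_closure_pair_induction hα hβ (p := fun x => Commute x ((α * β) ^ 2))
    (Commute.one_left _) ?_ ?_ hx
  · exact fun g _ hg => hg.mul_left ca
  · exact fun g _ hg => hg.mul_left cb

/-- The generators commute up to the central involution or identity ζ = (αβ)², and commuting up to ζ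
is stable under products in either argument. -/
theorem mul_eq_or_of_involutions (hα : α * α = 1) (hβ : β * β = 1) (hζ : ((α * β) ^ 2) ^ 2 = 1)
    {x y : H} (hx : x ∈ Subgroup.closure {α, β}) (hy : y ∈ Subgroup.closure {α, β}) :
    x * y = y * x ∨ x * y = y * x * (α * β) ^ 2 := by
  have hc : ∀ {x}, x ∈ Subgroup.closure {α, β} → Commute x ((α * β) ^ 2) :=
    fun h => commute_sq_of_involutions hα hβ hζ h
  have hα' := inv_eq_of_mul_eq_one_right hα
  have hβ' := inv_eq_of_mul_eq_one_right hβ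
  set ζ := (α * β) ^ 2 with hζdef
  have hζ' : ζ * ζ = 1 := by rw [← pow_two]; exact hζ
  have mα : α ∈ Subgroup.closure {α, β} := Subgroup.subset_closure (Or.inl rfl)
  have mβ : β ∈ Subgroup.closure {α, β} := Subgroup.subset_closure (Or.inr rfl)
  have hab : α * β = β * α * ζ := by
    rw [hζdef, pow_two]
    calc α * β = β * (α * α) * β * α * β := by rw [hα, mul_one, hβ, one_mul]
      _ = _ := by group
  have hba : β * α = α * β * ζ := by rw [hab, mul_assoc, hζ', mul_one]
  have right_mul : ∀ {x z c : H}, c ∈ Subgroup.closure {α, β} →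
      (x * z = z * x ∨ x * z = z * x * ζ) → (x * c = c * x ∨ x * c = c * x * ζ) →
      (x * (z * c) = z * c * x ∨ x * (z * c) = z * c * x * ζ) := by
    intro x z c hcm h1 h2
    have hcz : c * ζ = ζ * c := hc hcm
    rcases h1 with h1 | h1 <;> rcases h2 with h2 | h2
    · left; rw [← mul_assoc, h1, mul_assoc, h2, mul_assoc]
    · right; rw [← mul_assoc, h1, mul_assoc, h2]; group
    · right; rw [← mul_assoc, h1, mul_assoc, ← hcz, ← mul_assoc, mul_assoc z, h2]; group
    · left
      rw [← mul_assoc, h1, mul_assoc, ← hcz, ← mul_assoc, mul_assoc z, h2]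
      calc z * (c * x * ζ) * ζ = z * c * x * (ζ * ζ) := by group
        _ = _ := by rw [hζ', mul_one]
  have swap : ∀ {x z : H}, x ∈ Subgroup.closure {α, β} → z ∈ Subgroup.closure {α, β} →
      (x * z = z * x ∨ x * z = z * x * ζ) → (z * x = x * z ∨ z * x = x * z * ζ) := by
    intro x z hx hz h
    rcases h with h | h
    · exact Or.inl h.symm
    · right; rw [h, mul_assoc _ ζ ζ, hζ', mul_one]
  have gens : ∀ {y : H}, y ∈ Subgroup.closure {α, β} → ∀ c, (c = α ∨ c = β) →
      (c * y = y * c ∨ c * y = y * c * ζ) := by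
    intro y hy c hcc
    refine mem_closure_pair_induction hα hβ (p := fun y => c * y = y * c ∨ c * y = y * c * ζ)
      (Or.inl (by simp)) ?_ ?_ hy
    · intro g _ ih
      refine right_mul mα ih ?_
      rcases hcc with rfl | rfl
      · exact Or.inl rfl
      · exact Or.inr hba
    · intro g _ ih
      refine right_mul mβ ih ?_
      rcases hcc with rfl | rfl
      · exact Or.inr hab
      · exact Or.inl rfl
  refine mem_closure_pair_induction hα hβ (p := fun y => x * y = y * x ∨ x * y = y * x * ζ)
    (Or.inl (by simp)) ?_ ?_ hy
  · intro g _ ih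
    exact right_mul mα ih (swap mα hx (gens hx α (Or.inl rfl)))
  · intro g _ ih
    exact right_mul mβ ih (swap mβ hx (gens hx β (Or.inr rfl)))

theorem mul_self_eq_or_of_involutions (hα : α * α = 1) (hβ : β * β = 1)
    (hζ : ((α * β) ^ 2) ^ 2 = 1) {x : H} (hx : x ∈ Subgroup.closure {α, β}) :
    x * x = 1 ∨ x * x = (α * β) ^ 2 := by
  have hζ' : (α * β) ^ 2 * (α * β) ^ 2 = 1 := by rw [← pow_two]; exact hζ
  have key : ∀ c ∈ Subgroup.closure {α, β}, c * c = 1 → ∀ g ∈ Subgroup.closure {α, β},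
      (g * g = 1 ∨ g * g = (α * β) ^ 2) → (g * c * (g * c) = 1 ∨ g * c * (g * c) = (α * β) ^ 2) := by
    intro c hc hcc g hg ih
    have hm := mul_eq_or_of_involutions hα hβ hζ hc hg
    have hcz : (α * β) ^ 2 * c = c * (α * β) ^ 2 := (commute_sq_of_involutions hα hβ hζ hc).symm
    rcases hm with hm | hm
    · have : g * c * (g * c) = g * g := by
        calc g * c * (g * c) = g * (c * g) * c := by group
          _ = g * g * (c * c) := by rw [hm]; group
          _ = g * g := by rw [hcc, mul_one]
      rw [this]; exact ih
    · have : g * c * (g * c) = g * g * (α * β) ^ 2 := by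
        calc g * c * (g * c) = g * (c * g) * c := by group
          _ = g * g * c * ((α * β) ^ 2 * c) := by rw [hm]; group
          _ = g * g * (c * c) * (α * β) ^ 2 := by rw [hcz]; group
          _ = _ := by rw [hcc, mul_one]
      rw [this]
      rcases ih with ih | ih
      · right; rw [ih, one_mul]
      · left; rw [ih, hζ']
  refine mem_closure_pair_induction hα hβ (p := fun x => x * x = 1 ∨ x * x = (α * β) ^ 2)
    (Or.inl (by simp)) ?_ ?_ hx
  · exact fun g hg ih => key α (Subgroup.subset_closure (Or.inl rfl)) hα g hg ih
  · exact fun g hg ih => key β (Subgroup.subset_closure (Or.inr rfl)) hβ g hg ih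

/-- Conjugation changes y at most by the central factor (αβ)², which does not affect commutation
with x. -/
theorem commute_cj_of_involutions (hα : α * α = 1) (hβ : β * β = 1)
    (hζ : ((α * β) ^ 2) ^ 2 = 1) {x y u : H} (hx : x ∈ Subgroup.closure {α, β})
    (hy : y ∈ Subgroup.closure {α, β}) (hu : u ∈ Subgroup.closure {α, β}) (h : Commute x y) :
    Commute x (cj y u) := by
  rcases mul_eq_or_of_involutions hα hβ hζ hy hu with e | e
  · rw [(cj_eq_self_iff y u).2 e]; exact h
  · have : cj y u = y * (α * β) ^ 2 := by
      unfold cj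
      rw [mul_assoc, e]; group
    rw [this]
    exact h.mul_right (commute_sq_of_involutions hα hβ hζ hx)

end Dihedral

/-! ### The relators under θ and in K(w,v). -/

section

variable {k n : ℕ} [NeZero k] [NeZero n] (w : Fin k → Bool) (v : Fin n → Bool)

/-- What the proof uses of the choice of `s`, `t` and `m`. -/
structure Setup (s t : F k v) (m r : ℕ) : Prop where
  psiA : psi w v (cj (a1 v) t) = pair (bk v) (cj (an v) s)
  one_le : 1 ≤ r
  le : r ≤ k
  hs : s ∈ bSub (k := k) v (r - 1)
  ht : t ∈ bSub (k := k) v r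
  hm : m = 1 ∨ m = 2 ∧ (k = 2 ∧ n = 1 ∨ k = 1 ∧ 2 ≤ n)
  rhoK : toK w v (rho v s m) = 1

variable {w v} {s t : F k v} {m r : ℕ}

theorem an_mul_self : (an v * an v : F k v) = 1 := fg_mul_self v _

theorem bk_mul_self : (bk v * bk v : F k v) = 1 := fg_mul_self v _

theorem theta_mem (g : F k v) : theta v s g ∈ Subgroup.closure {cj (an v) s, bk v} := by
  induction g using F_induction with
  | one => rw [map_one]; exact one_mem _
  | mul g x ih =>
    rw [map_mul]
    refine mul_mem ih ?_
    rw [theta_fg]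
    unfold thetaGen
    split_ifs
    · exact Subgroup.subset_closure (Or.inr rfl)
    · exact Subgroup.subset_closure (Or.inl rfl)
    · exact one_mem _

/-- The image of f ∘ θ lies in a group generated by two involutions whose product has order dividing
2^m. Powers die because squares lie in {1, (αβ)²}. For m = 1 the image is abelian. For m = 2 it need
not be, and the shape of (k, n) enters: if k = 2 and n = 1 the only inner generator is b_1, so both
entries of a commutator come from the same generator; if k = 1 the relevant values all come from a
single generator. -/
theorem theta_kills (S : Setup w v s t m r) {H : Type*} [Group H] (f : F k v →* H)
    (hf : f (rho v s m) = 1) : Kills w v s t m (f.comp (theta v s)) := by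
  set α := f (cj (an v) s) with hαd
  set β := f (bk v) with hβd
  have hα : α * α = 1 := by rw [hαd, ← map_mul, cj_mul_self an_mul_self, map_one]
  have hβ : β * β = 1 := by rw [hβd, ← map_mul, bk_mul_self, map_one]
  have hρ : (α * β) ^ 2 ^ m = 1 := by
    rw [rho, map_pow, map_mul] at hf
    exact hf
  have hζ : ((α * β) ^ 2) ^ 2 = 1 := by
    rcases S.hm with rfl | ⟨rfl, -⟩
    · rw [pow_one] at hρ; rw [hρ, one_pow]
    · rw [← pow_mul]; exact hρ
  have hmem : ∀ g, f (theta v s g) ∈ Subgroup.closure {α, β} := by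
    intro g
    have := Subgroup.mem_map_of_mem f (theta_mem (s := s) g)
    rw [MonoidHom.map_closure, Set.image_pair] at this
    exact this
  constructor
  · intro l
    rw [rho, map_pow, map_pow]
    have h := mul_self_eq_or_of_involutions hα hβ hζ (hmem (phiIt w v t l (cj (an v) s * bk v)))
    rw [← pow_two] at h
    change f (theta v s _) ^ 2 ^ m = 1
    rcases S.hm with rfl | ⟨rfl, -⟩
    · rw [pow_one] at hρ ⊢
      rw [hρ] at h
      simpa using h
    · rw [show 2 ^ 2 = 2 * 2 from rfl, pow_mul]
      rcases h with h | h
      · rw [h, one_pow]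
      · rw [h, hζ]
  · intro l y z hy hz u hu hp
    simp only [map_cj]
    refine commute_cj_of_involutions hα hβ hζ (hmem _) (hmem _) (hmem _) ?_
    change Commute (f (theta v s _)) (f (theta v s _))
    rcases S.hm with rfl | ⟨-, ⟨rfl, rfl⟩ | ⟨rfl, hn⟩⟩
    · have h := mul_eq_or_of_involutions hα hβ hζ
        (hmem (phiIt w v t l (fg (succGen y)))) (hmem (phiIt w v t l (fg (succGen z))))
      rw [pow_one] at hρ
      rw [hρ, mul_one, or_self] at h
      exact h
    · have hb : ∀ x : Gen 2 1, Inner x → x = .b 0 := by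
        rintro (i | j) hx
        · have : (i : ℕ) + 1 < 1 := hx
          omega
        · have : (j : ℕ) + 1 < 2 := hx
          congr 1
          ext
          simp only [Fin.val_zero]
          omega
      rw [hb y hy, hb z hz]
    · have hsucc : ∀ x : Gen 1 n, Inner x → ∀ j, succGen x ≠ .b j := by
        rintro (i | j) hx
        · simp [succGen]
        · have : (j : ℕ) + 1 < 1 := hx
          omega
      have hth : ∀ x : Gen 1 n, Inner x → succGen x ≠ .a (lastPos n) →
          theta v s (fg (succGen x)) = 1 := by
        intro x hx hne
        rw [theta_fg, thetaGen, if_neg hne, if_neg (hsucc x hx _)]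
      have ha1 : theta v s (a1 v) = 1 := by
        have : (a1 v : F 1 v) = fg (.a (firstPos n)) := rfl
        rw [this, theta_fg, thetaGen, if_neg, if_neg (by simp)]
        simp only [firstPos, lastPos, Gen.a.injEq, Fin.mk.injEq]
        omega
      rcases l with _ | l
      · rw [phiIt_zero, phiIt_zero]
        by_cases h1 : succGen y = .a (lastPos n)
        · by_cases h2 : succGen z = .a (lastPos n)
          · rw [h1, h2]
          · rw [hth z hz h2, map_one]; exact Commute.one_right _
        · rw [hth y hy h1, map_one]; exact Commute.one_left _
      -- Since n ≥ 2, θ kills a_1. Hence θ ∘ φ kills every generator except possibly the predecessor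
      -- of a_n, and its image is commutative.
      · rw [phiIt_succ, phiIt_succ]
        have hgen : ∀ x, theta v s (phi w v t (fg x)) = 1 ∨
            Inner x ∧ succGen x = .a (lastPos n) := by
          intro x
          rcases inner_or x with hx | rfl | rfl
          · by_cases h1 : succGen x = .a (lastPos n)
            · exact Or.inr ⟨hx, h1⟩
            · left
              rw [phi_inner w v t hx, map_cj, hth x hx h1, one_cj]
          · left
            change theta v s (phi w v t (an v)) = 1
            rw [phi_an, map_cj, ha1, one_cj]
          · left
            change theta v s (phi w v t (bk v)) = 1
            rw [phi_bk, map_cj, ha1, one_cj]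
        have hall : ∀ g g' : F 1 v, Commute (((f.comp (theta v s)).comp (phi w v t)) g)
            (((f.comp (theta v s)).comp (phi w v t)) g') := by
          intro g g'
          refine commute_of_closure (S := Set.range fg) (T := Set.range fg) _ _ ?_
            (by rw [closure_fg]; trivial) (by rw [closure_fg]; trivial)
          rintro _ ⟨x, rfl⟩ _ ⟨x', rfl⟩
          change Commute (f (theta v s (phi w v t (fg x)))) (f (theta v s (phi w v t (fg x'))))
          rcases hgen x with h1 | ⟨h1, h1'⟩
          · rw [h1, map_one]; exact Commute.one_left _
          · rcases hgen x' with h2 | ⟨h2, h2'⟩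
            · rw [h2, map_one]; exact Commute.one_right _
            · rw [succGen_inj h1 h2 (h1'.trans h2'.symm)]
        exact hall _ _

theorem toPG_rho : toPG w v s t m (rho v s m) = 1 := (toPG_kills w v s t m).rho 0

theorem toPG_theta (S : Setup w v s t m r) {g : F k v} (hg : toPG w v s t m g = 1) :
    toPG w v s t m (theta v s g) = 1 :=
  (theta_kills S (toPG w v s t m) toPG_rho).eq_one w v hg

theorem cj_atc (c e : Bool) {G : Type} [Group G] (g a b : G) :
    cj (atc c g) (pair a b * swpow e) = atc (xor c e) (cj g (if c then b else a)) := by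
  rw [cj_mul]
  cases c <;> cases e <;> simp [atc, swpow, cj_one, cj_pair_pair, one_cj, cj_pair_sw]

/-- The parity of u is chosen so that conjugation by u moves the nontrivial coordinate of the second
element to the place where the first one is trivial. -/
theorem psi_comm {y z : Gen k n} (hy : Inner y) (hz : Inner z) {u : F k v}
    (hp : (psi w v u).right = parity (letter w v y) (letter w v z)) :
    Commute (psi w v (fg (succGen y))) (psi w v (cj (fg (succGen z)) u)) := by
  obtain ⟨a, b, e, h⟩ := exists_eq_pair (psi w v u)
  rw [map_cj, psi_succGen w v hy, psi_succGen w v hz, h, cj_atc]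
  have he : (xor (letter w v z) e) = !(letter w v y) := by
    rw [h, SemidirectProduct.mul_right, pair_right, one_mul, swpow_right, parity] at hp
    clear h
    generalize letter w v y = c at *
    generalize letter w v z = c' at *
    cases e <;> cases c <;> cases c' <;>
      simp_all [boolNot_ne_one, boolNot_ne_one.symm]
  rw [he]
  cases letter w v y <;>
    · change _ * _ = _ * _
      simp [atc, pair_mul]

/-- Induction on ℓ: by `psi_phi` the first coordinate of a relator of level ℓ + 1 is the relator of
level ℓ, and the second one dies by `theta_kills`. -/
theorem toK_kills (S : Setup w v s t m r) : Kills w v s t m (toK w v) := by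
  have hθ := theta_kills S (toK w v) S.rhoK
  constructor
  · intro l
    induction l with
    | zero => exact S.rhoK
    | succ l ih =>
      rw [phiIt_succ]
      exact toK_eq_one_of_pair w v (psi_phi S.psiA _) ih (hθ.rho l)
  · intro l y z hy hz u hu hp
    rw [← cm_eq_one_iff, ← map_cm, ← map_cm]
    induction l with
    | zero =>
      refine toK_eq_one_of_pair w v (a := 1) (b := 1) ?_ (map_one _) (map_one _)
      rw [phiIt_zero, pair_one, map_cm, cm_eq_one_iff]
      exact psi_comm hy hz hp
    | succ l ih =>
      rw [phiIt_succ]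
      refine toK_eq_one_of_pair w v (psi_phi S.psiA _) ih ?_
      have := hθ.comm l y z hy hz u hu hp
      rw [← cm_eq_one_iff, ← map_cm, ← map_cm] at this
      exact this

theorem toK_eq_one_of_toPG (S : Setup w v s t m r) {g : F k v} (hg : toPG w v s t m g = 1) :
    toK w v g = 1 := (toK_kills S).eq_one w v hg

/-! ### Centralizers of generators in `F` -/

open Classical in
/-- The values on the generators of a homomorphism that sends a given generator to `σ` and the
other `b_j` into the first factor of the base group. -/
def centGen (v : Fin n → Bool) (x : Gen k n) : Gen k n → Wr (F k v)
  | .a i => if .a i = x then sw else 1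
  | .b j => if .b j = x then sw else pair (fb v j) 1

theorem centGen_relsF (x : Gen k n) (r : FreeGroup (Gen k n)) (hr : r ∈ relsF k v) :
    FreeGroup.lift (centGen v x) r = 1 := by
  rcases hr with ⟨g, rfl⟩ | ⟨i, i', l, -, -, h, rfl⟩
  · rw [map_pow, FreeGroup.lift_apply_of, pow_two]
    rcases g with i | j <;> simp only [centGen] <;> split_ifs
    · exact sw_mul_sw
    · exact one_mul 1
    · exact sw_mul_sw
    · have : (fb v j * fb v j : F k v) = 1 := fg_mul_self v _
      rw [pair_mul, this, one_mul, pair_one]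
  · rw [map_cm, FreeGroup.lift_apply_of, FreeGroup.lift_apply_of]
    refine cm_eq_one ?_
    simp only [centGen]
    split_ifs <;> simp

/-- A homomorphism that sends a given generator to `σ` and the other `b_j` into the first factor
of the base group. -/
def cent (v : Fin n → Bool) (x : Gen k n) : F k v →* Wr (F k v) :=
  PresentedGroup.toGroup (centGen_relsF x)

theorem cent_fg (x y : Gen k n) : cent v x (fg y) = centGen v x y := PresentedGroup.toGroup.of _

theorem bSub_induction {r : ℕ} {p : F k v → Prop} (one : p 1)
    (mul : ∀ g ∈ bSub v r, ∀ j : Fin k, (j : ℕ) < r → p g → p (g * fb v j)) {g : F k v}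
    (hg : g ∈ bSub v r) : p g := by
  unfold bSub at hg
  induction hg using Subgroup.closure_induction_right with
  | one => exact one
  | mul_right g hg y hy ih =>
    obtain ⟨j, hj, rfl⟩ := hy
    exact mul g hg j hj ih
  | mul_inv_cancel g hg y hy ih =>
    obtain ⟨j, hj, rfl⟩ := hy
    have : (fb v j : F k v)⁻¹ = fb v j := fg_inv v _
    rw [this]
    exact mul g hg j hj ih

theorem bSub_mono {r r' : ℕ} (h : r ≤ r') : bSub (k := k) v r ≤ bSub v r' :=
  Subgroup.closure_mono fun _ ⟨j, hj, e⟩ => ⟨j, lt_of_lt_of_le hj h, e⟩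

theorem fb_mem_bSub {r : ℕ} {j : Fin k} (h : (j : ℕ) < r) : fb v j ∈ bSub (k := k) v r :=
  Subgroup.subset_closure ⟨j, h, rfl⟩

theorem b1_mem_bSub {r : ℕ} (h : 1 ≤ r) : b1 v ∈ bSub (k := k) v r :=
  fb_mem_bSub (by simp only [firstPos]; omega)

theorem bpow_mem_bSub {r : ℕ} (h : 1 ≤ r) (c : Bool) : bpow v c ∈ bSub (k := k) v r := by
  cases c
  · exact one_mem _
  · exact b1_mem_bSub h

/-- The homomorphism `cent` sends x to σ and c to ⟨c, 1⟩. Commuting with σ forces the two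
coordinates to agree. -/
theorem eq_one_of_commute_fg (x : Gen k n) {r : ℕ} (hx : ∀ j : Fin k, (j : ℕ) < r → .b j ≠ x)
    {c : F k v} (hc : c ∈ bSub v r) (h : Commute (fg x) c) : c = 1 := by
  have h1 : cent v x c = pair c 1 := by
    refine bSub_induction (p := fun c => cent v x c = pair c 1) (by simp [pair_one]) ?_ hc
    intro g _ j hj ih
    have : cent v x (fb v j) = pair (fb v j) 1 := by
      have h0 : (fb v j : F k v) = fg (.b j) := rfl
      rw [h0, cent_fg]
      simp only [centGen, if_neg (hx j hj)]
      rfl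
    rw [map_mul, ih, this, pair_mul, one_mul]
  have h2 : cent v x (fg x) = sw := by
    rw [cent_fg]
    rcases x with i | j <;> simp [centGen]
  have h3 := (h.map (cent v x)).symm
  rw [h1, h2, ← cj_eq_self_iff, cj_pair_sw] at h3
  exact (pair_inj h3).2

theorem eq_one_of_commute_bk {c : F k v} (hc : c ∈ bSub v (k - 1)) (h : cj (bk v) c = bk v) :
    c = 1 := by
  refine eq_one_of_commute_fg (.b (lastPos k)) ?_ hc ((cj_eq_self_iff _ _).1 h)
  rintro j hj e
  have := congrArg Fin.val (Gen.b.inj e)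
  simp only [lastPos] at this
  omega

theorem eq_one_of_commute_an {r : ℕ} {c : F k v} (hc : c ∈ bSub v r)
    (h : cj (an v) c = an v) : c = 1 :=
  eq_one_of_commute_fg (.a (lastPos n)) (by simp) hc ((cj_eq_self_iff _ _).1 h)

theorem cj_an_ne_bk (c c' : F k v) : cj (an v) c ≠ cj (bk v) c' := by
  intro h
  have := congrArg (par v (.a (lastPos n))) h
  rw [par_cj, par_cj] at this
  have h1 : par v (.a (lastPos n)) (an v : F k v) = -1 := par_fg_self v _
  have h2 : par v (.a (lastPos n)) (bk v : F k v) = 1 := par_fg_ne v (by simp)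
  rw [h1, h2] at this
  exact absurd this (by decide)

/-! ### Words in the `b_j` -/

/-- These are the commutators in R rewritten through φ: the powers of b_1 that relate a successor to
a value of φ are absorbed in u, and the condition on letters becomes that u moves the first letter.
-/
theorem commute_toPG_phi {y z : Gen k n} (hy : Inner y) (hz : Inner z) {u : F k v}
    (hu : u ∈ Delta v t) (hp : (psi w v u).right = Equiv.boolNot) :
    Commute (toPG w v s t m (phi w v t (fg y))) (toPG w v s t m (cj (phi w v t (fg z)) u)) := by
  have hu' : bpow v (letter w v z) * u * bpow v (letter w v y) ∈ Delta v t :=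
    mul_mem (mul_mem (bpow_mem_Delta v t _) hu) (bpow_mem_Delta v t _)
  have h := (toPG_kills w v s t m).comm 0 y z hy hz _ hu' (by
    rw [map_mul, map_mul, SemidirectProduct.mul_right, SemidirectProduct.mul_right, psi_bpow,
      psi_bpow, swpow_right, swpow_right, hp, parity]
    cases letter w v y <;> cases letter w v z <;> simp [boolNot_mul_self])
  rw [phiIt_zero, phiIt_zero, ← commute_cj_iff _ _ (toPG w v s t m (bpow v (letter w v y))),
    ← map_cj, ← map_cj, ← phi_inner w v t hy, cj_mul, cj_mul, ← phi_inner w v t hz,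
    ← cj_mul _ (bpow v (letter w v y)), bpow_mul_self, cj_one] at h
  exact h

theorem inner_b {j : Fin k} (h : (j : ℕ) < k - 1) : Inner (.b j : Gen k n) := by
  change (j : ℕ) + 1 < k
  omega

theorem commute_toPG_phi_bSub {x y : F k v} (hx : x ∈ bSub v (k - 1)) (hy : y ∈ bSub v (k - 1)) :
    Commute (toPG w v s t m (phi w v t x)) (toPG w v s t m (cj (phi w v t y) (b1 v))) := by
  have h := commute_of_closure ((toPG w v s t m).comp (phi w v t))
    ((toPG w v s t m).comp ((MulAut.conj (b1 v)⁻¹).toMonoidHom.comp (phi w v t)))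
    (S := {g | ∃ j : Fin k, (j : ℕ) < k - 1 ∧ g = fb v j})
    (T := {g | ∃ j : Fin k, (j : ℕ) < k - 1 ∧ g = fb v j}) ?_ hx hy
  · simpa [cj] using h
  · rintro _ ⟨i, hi, rfl⟩ _ ⟨j, hj, rfl⟩
    have : Commute (toPG w v s t m (phi w v t (fb v i)))
        (toPG w v s t m (cj (phi w v t (fb v j)) (b1 v))) := commute_toPG_phi (w := w) (s := s) (m := m) (inner_b (n := n) hi) (inner_b (n := n) hj)
      (mem_Delta_b1 v t) (by rw [psi_b1]; rfl)
    simpa [cj] using this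

/-- In Γ, a word in b_1, …, b_r is recovered from its coordinates under Ψ. A new factor is pushed to
the left of b_1^e, where it is a value of φ or a b_1-conjugate of one; in the former case it also
passes φ(h₁)^{b_1} by `commute_toPG_phi_bSub`. -/
theorem bSub_decomp (s t : F k v) (m : ℕ) (hr : r ≤ k) {g : F k v} (hg : g ∈ bSub v r) :
    ∃ h₀ ∈ bSub (k := k) v (r - 1), ∃ h₁ ∈ bSub (k := k) v (r - 1), ∃ e : Bool,
      psi w v g = pair h₀ h₁ * swpow e ∧
      toPG w v s t m g =
        toPG w v s t m (phi w v t h₀ * cj (phi w v t h₁) (b1 v) * bpow v e) := by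
  refine bSub_induction (p := fun g => ∃ h₀ ∈ bSub (k := k) v (r - 1),
    ∃ h₁ ∈ bSub (k := k) v (r - 1), ∃ e : Bool, psi w v g = pair h₀ h₁ * swpow e ∧
      toPG w v s t m g =
        toPG w v s t m (phi w v t h₀ * cj (phi w v t h₁) (b1 v) * bpow v e)) ?_ ?_ hg
  · refine ⟨1, one_mem _, 1, one_mem _, false, ?_, ?_⟩
    · rw [map_one, pair_one, swpow]; rfl
    · simp [bpow, one_cj]
  · rintro g - ⟨j, hj⟩ hjr ⟨h₀, m₀, h₁, m₁, e, hψ, hq⟩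
    rcases j with _ | j
    · refine ⟨h₀, m₀, h₁, m₁, !e, ?_, ?_⟩
      · have := psi_b1 (k := k) w v
        unfold b1 firstPos at this
        rw [map_mul, hψ, this, mul_assoc, swpow_mul_sw]
      · rw [map_mul, hq, ← map_mul, mul_assoc]
        have : (⟨0, hj⟩ : Fin k) = firstPos k := rfl
        rw [this, bpow_mul_b1]
    · have hjr' : j + 1 < r := hjr
      have hin : Inner (.b ⟨j, by omega⟩ : Gen k n) := hj
      have hmem : (fg (.b ⟨j, by omega⟩) : F k v) ∈ bSub v (r - 1) :=
        fb_mem_bSub (by simp only; omega)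
      have hle : bSub (k := k) v (r - 1) ≤ bSub v (k - 1) := bSub_mono (by omega)
      set x : Gen k n := .b ⟨j, by omega⟩ with hxd
      set c := letter w v x with hc
      have hb : fb v ⟨j + 1, hj⟩ = cj (phi w v t (fg x)) (bpow v c) := by
        rw [fb_succ, succ_eq_phi w v t hin]
      have hψb : psi w v (fb v ⟨j + 1, hj⟩) = atc c (fg x) := by
        rw [fb_succ, psi_succGen w v hin]
      have hswap : bpow v e * fb v ⟨j + 1, hj⟩ =
          cj (phi w v t (fg x)) (bpow v (xor c e)) * bpow v e := by
        rw [hb, ← bpow_mul_bpow, cj_mul]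
        unfold cj
        rw [bpow_inv, bpow_inv]
        calc _ = bpow v e * (bpow v c * phi w v t (fg x) * bpow v c) *
              (bpow v e * bpow v e) := by rw [bpow_mul_self, mul_one]
          _ = _ := by group
      have hψ' : psi w v (g * fb v ⟨j + 1, hj⟩) =
          pair h₀ h₁ * atc (xor c e) (fg x) * swpow e := by
        rw [map_mul, hψ, hψb, mul_assoc, swpow_mul_atc, ← mul_assoc]
      have hq' : toPG w v s t m (g * fb v ⟨j + 1, hj⟩) =
          toPG w v s t m (phi w v t h₀ * cj (phi w v t h₁) (b1 v) *
            cj (phi w v t (fg x)) (bpow v (xor c e)) * bpow v e) := by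
        rw [map_mul, hq, ← map_mul, mul_assoc, hswap, ← mul_assoc]
      cases hce : xor c e
      · refine ⟨h₀ * fg x, mul_mem m₀ hmem, h₁, m₁, e, ?_, ?_⟩
        · rw [hψ', hce]
          simp [atc, pair_mul]
        · rw [hq', hce]
          have hcomm := commute_toPG_phi_bSub (w := w) (s := s) (t := t) (m := m) (hle hmem) (hle m₁)
          simp only [bpow, map_mul, cj_one, Bool.false_eq_true, if_false]
          rw [mul_assoc (toPG w v s t m (phi w v t h₀)) (toPG w v s t m (phi w v t (fg x))),
            hcomm.eq, mul_assoc, mul_assoc, mul_assoc, mul_assoc]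
      · refine ⟨h₀, m₀, h₁ * fg x, mul_mem m₁ hmem, e, ?_, ?_⟩
        · rw [hψ', hce]
          simp [atc, pair_mul]
        · rw [hq', hce]
          have : (bpow v true : F k v) = b1 v := rfl
          rw [this, map_mul (phi w v t), mul_cj, mul_assoc (phi w v t h₀)]

theorem theta_bSub {g : F k v} (hg : g ∈ bSub v (k - 1)) : theta v s g = 1 := by
  refine bSub_induction (p := fun g => theta v s g = 1) (map_one _) ?_ hg
  intro g _ j hj ih
  have : theta v s (fb v j) = 1 := theta_inner v s (inner_b hj)
  rw [map_mul, ih, this, one_mul]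

theorem phi_bSub (hr : r ≤ k) {g : F k v} (hg : g ∈ bSub v (r - 1)) :
    phi w v t g ∈ bSub (k := k) v r := by
  refine bSub_induction (p := fun g => phi w v t g ∈ bSub (k := k) v r) (by simp) ?_ hg
  intro g _ j hj ih
  rw [map_mul]
  refine mul_mem ih ?_
  have h1 : phi w v t (fb v j) = _ := phi_inner w v t (inner_b (n := n) (j := j) (by omega))
  have hjk : (j : ℕ) + 1 < k := by omega
  rw [h1, ← fb_succ (j := (j : ℕ)) v hjk]
  unfold cj
  have hb : bpow v (letter w v (.b j)) ∈ bSub (k := k) v r := bpow_mem_bSub (by omega) _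
  exact mul_mem (mul_mem (inv_mem hb) (fb_mem_bSub (by simp only; omega))) hb

theorem Setup.theta_s (S : Setup w v s t m r) : theta v s s = 1 := by
  have := S.le
  exact theta_bSub (bSub_mono (by omega) S.hs)

theorem Setup.theta_cj_an (S : Setup w v s t m r) : theta v s (cj (an v) s) = bk v := by
  rw [map_cj, S.theta_s, cj_one, theta_an]

/-- A word `τ` in the `b_j` that commutes with `Ψ(a_1)` in the wreath product. -/
theorem toPG_eq_one_of_centralizes (s t : F k v) (m : ℕ) (hr : r ≤ k) {τ : F k v}
    (hτ : τ ∈ bSub v r) (h : psi w v (cj (a1 v) τ) = psi w v (a1 v)) :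
    toPG w v s t m τ = 1 := by
  obtain ⟨h₀, m₀, h₁, m₁, e, hψ, hq⟩ := bSub_decomp (w := w) s t m hr hτ
  have hle : bSub (k := k) v (r - 1) ≤ bSub v (k - 1) := bSub_mono (by omega)
  -- With e = true, a conjugate of a_n would equal one of b_k, which a parity excludes. Otherwise h₀
  -- and h₁ centralize b_k and a_n in some order, and no nontrivial word in b_1, …, b_{r-1}
  -- centralizes either in F.
  have key : h₀ = 1 ∧ h₁ = 1 ∧ e = false := by
    rw [map_cj, hψ, psi_a1, cj_mul] at h
    split_ifs at h
    · rw [cj_pair_pair] at h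
      cases e
      · simp only [swpow, Bool.false_eq_true, if_false, cj_one] at h
        obtain ⟨e1, e2⟩ := pair_inj h
        exact ⟨eq_one_of_commute_bk (hle m₀) e1, eq_one_of_commute_an m₁ e2, rfl⟩
      · simp only [swpow, if_true, cj_pair_sw] at h
        have := (pair_inj h).1
        rw [← cj_one (bk v)] at this
        exact absurd this (cj_an_ne_bk _ _)
    · rw [cj_pair_pair] at h
      cases e
      · simp only [swpow, Bool.false_eq_true, if_false, cj_one] at h
        obtain ⟨e1, e2⟩ := pair_inj h
        exact ⟨eq_one_of_commute_an m₀ e1, eq_one_of_commute_bk (hle m₁) e2, rfl⟩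
      · simp only [swpow, if_true, cj_pair_sw] at h
        have := (pair_inj h).2
        rw [← cj_one (bk v)] at this
        exact absurd this (cj_an_ne_bk _ _)
  obtain ⟨rfl, rfl, rfl⟩ := key
  rw [hq]
  simp [bpow, one_cj]

/-- Both sides are conjugates of a_1 by words in b_1, …, b_r and have the same image ⟨a_n^s, b_k⟩
under Ψ. The quotient of the two conjugators therefore centralizes Ψ(a_1), and so is trivial in Γ.
-/
theorem Setup.toPG_phi_an (S : Setup w v s t m r) :
    toPG w v s t m (phi w v t (cj (an v) s)) = toPG w v s t m (cj (cj (a1 v) t) (b1 v)) := by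
  have h1 : psi w v (phi w v t (cj (an v) s)) = pair (cj (an v) s) (bk v) := by
    rw [psi_phi S.psiA, S.theta_cj_an]
  have h2 : psi w v (cj (cj (a1 v) t) (b1 v)) = pair (cj (an v) s) (bk v) := by
    rw [map_cj, S.psiA, psi_b1, cj_pair_sw]
  have h3 : phi w v t (cj (an v) s) = cj (a1 v) (bpow v (v (lastPos n)) * phi w v t s) := by
    rw [map_cj, phi_an, cj_mul]
  rw [← cj_mul] at h2 ⊢
  rw [h3] at h1 ⊢
  set x := bpow v (v (lastPos n)) * phi w v t s with hx
  set y := t * b1 v with hy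
  have hτ : x * y⁻¹ ∈ bSub (k := k) v r := by
    refine mul_mem (mul_mem (bpow_mem_bSub S.one_le _) (phi_bSub S.le S.hs)) (inv_mem ?_)
    exact mul_mem S.ht (b1_mem_bSub S.one_le)
  have hc : psi w v (cj (a1 v) (x * y⁻¹)) = psi w v (a1 v) := by
    rw [cj_mul, map_cj, h1, ← h2, ← map_cj, cj_inv_cj]
  have := toPG_eq_one_of_centralizes s t m S.le hτ hc
  rw [map_mul, map_inv, mul_inv_eq_one] at this
  rw [map_cj, map_cj, this]

end

section

variable {k n : ℕ} [NeZero k] [NeZero n] {w : Fin k → Bool} {v : Fin n → Bool}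
  {s t : F k v} {m r : ℕ}

/-! ### The wreath recursion on the presented group -/

/-- Relators of positive level are handled by `psi_phi` and commutators of level 0 by disjoint
supports. Only (a_n^s b_k)^{2^m} itself remains, and it is left as the hypothesis `hA`. -/
theorem mapWr_psi_kills (S : Setup w v s t m r)
    (hA : mapWr (toPG w v s t m) (psi w v (rho v s m)) = 1) :
    Kills w v s t m ((mapWr (toPG w v s t m)).comp (psi w v)) := by
  have hq := toPG_kills w v s t m
  have hθ := theta_kills S (toPG w v s t m) toPG_rho
  constructor
  · rintro (_ | l)
    · exact hA
    · have h2 : toPG w v s t m (theta v s (phiIt w v t l (rho v s m))) = 1 := hθ.rho l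
      rw [phiIt_succ, MonoidHom.comp_apply, psi_phi S.psiA, mapWr_pair, hq.rho l, h2, pair_one]
  · rintro (_ | l) y z hy hz u hu hp
    · rw [phiIt_zero, phiIt_zero, MonoidHom.comp_apply, MonoidHom.comp_apply]
      exact (psi_comm hy hz hp).map (mapWr (toPG w v s t m))
    · rw [← cm_eq_one_iff, ← map_cm, ← map_cm, phiIt_succ, MonoidHom.comp_apply, psi_phi S.psiA,
        mapWr_pair]
      have h1 := hq.comm l y z hy hz u hu hp
      have h2 := hθ.comm l y z hy hz u hu hp
      rw [← cm_eq_one_iff, ← map_cm, ← map_cm] at h1 h2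
      have h2' : toPG w v s t m (theta v s (phiIt w v t l
        (cm (fg (succGen y)) (cj (fg (succGen z)) u)))) = 1 := h2
      rw [h1, h2', pair_one]

theorem mapWr_psi_eq (S : Setup w v s t m r)
    (hA : mapWr (toPG w v s t m) (psi w v (rho v s m)) = 1) {g g' : F k v}
    (h : toPG w v s t m g = toPG w v s t m g') :
    mapWr (toPG w v s t m) (psi w v g) = mapWr (toPG w v s t m) (psi w v g') := by
  rw [← mul_inv_eq_one, ← map_inv, ← map_mul] at h
  have := (mapWr_psi_kills S hA).eq_one w v h
  rw [map_mul, map_inv, mul_inv_eq_one] at this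
  exact this

/-! ### The stabilizer of the first level in the presented group -/

/-- The subgroup generated by the conjugates under `⟨b_k, a_n^s⟩` of the generators other than
`a_n` and `b_k`. -/
def InnerSub (s : F k v) : Subgroup (F k v) :=
  Subgroup.closure {g | ∃ x : Gen k n, Inner x ∧ ∃ u ∈ Lambda v s, g = cj (fg x) u}

theorem theta_innerSub {z : F k v} (hz : z ∈ InnerSub s) : theta v s z = 1 := by
  have : InnerSub s ≤ (theta v s).ker := by
    refine (Subgroup.closure_le _).2 ?_
    rintro _ ⟨x, hx, u, -, rfl⟩
    change theta v s _ = 1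
    rw [map_cj, theta_inner v s hx, one_cj]
  exact this hz

theorem cj_mem_innerSub {z u : F k v} (hz : z ∈ InnerSub s) (hu : u ∈ Lambda v s) :
    cj z u ∈ InnerSub s := by
  unfold InnerSub at hz
  induction hz using Subgroup.closure_induction with
  | mem x hx =>
    obtain ⟨x, hx, u', hu', rfl⟩ := hx
    rw [← cj_mul]
    exact Subgroup.subset_closure ⟨x, hx, _, mul_mem hu' hu, rfl⟩
  | one => rw [one_cj]; exact one_mem _
  | mul a b _ _ ha hb => rw [mul_cj]; exact mul_mem ha hb
  | inv a _ ha =>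
    have : cj a⁻¹ u = (cj a u)⁻¹ := by simp [cj, mul_assoc]
    rw [this]; exact inv_mem ha

theorem fg_mem_innerSub {x : Gen k n} (hx : Inner x) : fg x ∈ InnerSub s :=
  Subgroup.subset_closure ⟨x, hx, 1, one_mem _, (cj_one _).symm⟩

/-- In Γ, φ sends b_k and a_n^s to a_1^t and a_1^{t b_1}, which lie in ⟨a_1^t, b_1⟩ and fix the
first letter. -/
theorem toPG_phi_lambda (S : Setup w v s t m r) {u : F k v} (hu : u ∈ Lambda v s) :
    ∃ δ ∈ Delta v t, (psi w v δ).right = 1 ∧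
      toPG w v s t m (phi w v t u) = toPG w v s t m δ := by
  unfold Lambda at hu
  induction hu using Subgroup.closure_induction with
  | mem x hx =>
    rcases hx with rfl | rfl
    · exact ⟨_, mem_Delta_A v t, psi_A_right w v t, by rw [phi_bk]⟩
    · refine ⟨cj (cj (a1 v) t) (b1 v), ?_, ?_, S.toPG_phi_an⟩
      · exact mul_mem (mul_mem (inv_mem (mem_Delta_b1 v t)) (mem_Delta_A v t)) (mem_Delta_b1 v t)
      · rw [map_cj, S.psiA, psi_b1, cj_pair_sw]; rfl
  | one => exact ⟨1, one_mem _, by simp, by simp⟩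
  | mul a b _ _ ha hb =>
    obtain ⟨δ, hδ, h1, h2⟩ := ha
    obtain ⟨δ', hδ', h1', h2'⟩ := hb
    refine ⟨δ * δ', mul_mem hδ hδ', ?_, ?_⟩
    · rw [map_mul, SemidirectProduct.mul_right, h1, h1', one_mul]
    · rw [map_mul, map_mul, h2, h2', map_mul]
  | inv a _ ha =>
    obtain ⟨δ, hδ, h1, h2⟩ := ha
    refine ⟨δ⁻¹, inv_mem hδ, ?_, ?_⟩
    · rw [map_inv, SemidirectProduct.inv_right, h1, inv_one]
    · rw [map_inv, map_inv, h2, map_inv]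

/-- On generators, the conjugators φ(u), φ(u') can be replaced by elements δ, δ' of `Delta` that fix
the first letter. Then δ' b_1 δ⁻¹ still moves it, so `commute_toPG_phi` applies. -/
theorem commute_toPG_innerSub (S : Setup w v s t m r) {x y : F k v} (hx : x ∈ InnerSub s)
    (hy : y ∈ InnerSub s) :
    Commute (toPG w v s t m (phi w v t x)) (toPG w v s t m (cj (phi w v t y) (b1 v))) := by
  have h := commute_of_closure ((toPG w v s t m).comp (phi w v t))
    ((toPG w v s t m).comp ((MulAut.conj (b1 v)⁻¹).toMonoidHom.comp (phi w v t)))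
    (S := {g | ∃ x : Gen k n, Inner x ∧ ∃ u ∈ Lambda v s, g = cj (fg x) u})
    (T := {g | ∃ x : Gen k n, Inner x ∧ ∃ u ∈ Lambda v s, g = cj (fg x) u}) ?_ hx hy
  · simpa [cj] using h
  · rintro _ ⟨x, hx, u, hu, rfl⟩ _ ⟨y, hy, u', hu', rfl⟩
    obtain ⟨δ, hδ, h1, h2⟩ := toPG_phi_lambda S hu
    obtain ⟨δ', hδ', h1', h2'⟩ := toPG_phi_lambda S hu'
    have hmem : δ' * b1 v * δ⁻¹ ∈ Delta v t :=
      mul_mem (mul_mem hδ' (mem_Delta_b1 v t)) (inv_mem hδ)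
    have key : Commute (toPG w v s t m (phi w v t (cj (fg x) u)))
        (toPG w v s t m (cj (phi w v t (cj (fg y) u')) (b1 v))) := by
      have h0 := commute_toPG_phi (w := w) (s := s) (m := m) hx hy hmem (by
        rw [map_mul, map_mul, map_inv, SemidirectProduct.mul_right, SemidirectProduct.mul_right,
          SemidirectProduct.inv_right, h1, h1', psi_b1, sw_right, inv_one, mul_one, one_mul])
      rw [← commute_cj_iff _ _ (toPG w v s t m δ), ← map_cj, ← map_cj, ← cj_mul,
        inv_mul_cancel_right, cj_mul, map_cj, map_cj, map_cj, ← h2, ← h2', ← map_cj, ← map_cj,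
        ← map_cj, ← map_cj, ← map_cj] at h0
      exact h0
    simpa [cj] using key

/-- The factor a_1^t is φ(b_k), and b_1 a_1^t = (a_1^t)^{b_1} b_1 with (a_1^t)^{b_1} = φ(a_n^s) in
Γ. Thus each factor a_1^t of δ is absorbed into z, and only the parity of the factors b_1 survives.
-/
theorem toPG_cj_phi (S : Setup w v s t m r) {z δ : F k v} (hz : z ∈ InnerSub s)
    (hδ : δ ∈ Delta v t) : ∃ z' ∈ InnerSub s,
      toPG w v s t m (cj (phi w v t z) δ) = toPG w v s t m (phi w v t z') ∨
      toPG w v s t m (cj (phi w v t z) δ) = toPG w v s t m (cj (phi w v t z') (b1 v)) := by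
  have mbk : bk v ∈ Lambda v s := Subgroup.subset_closure (Or.inl rfl)
  have man : cj (an v) s ∈ Lambda v s := Subgroup.subset_closure (Or.inr rfl)
  refine Delta_induction (p := fun δ => ∃ z' ∈ InnerSub s,
      toPG w v s t m (cj (phi w v t z) δ) = toPG w v s t m (phi w v t z') ∨
      toPG w v s t m (cj (phi w v t z) δ) = toPG w v s t m (cj (phi w v t z') (b1 v)))
      ⟨z, hz, Or.inl (by rw [cj_one])⟩ ?_ ?_ hδ
  · rintro δ - ⟨z', hz', h | h⟩
    · refine ⟨cj z' (bk v), cj_mem_innerSub hz' mbk, Or.inl ?_⟩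
      rw [cj_mul, map_cj, h, map_cj (phi w v t), phi_bk, map_cj _ (phi w v t z')]
    · refine ⟨cj z' (cj (an v) s), cj_mem_innerSub hz' man, Or.inr ?_⟩
      have hb : b1 v * cj (a1 v) t = cj (cj (a1 v) t) (b1 v) * b1 v := by
        conv_rhs => rw [cj, b1_inv, mul_assoc, b1_mul_self, mul_one]
      rw [cj_mul, map_cj, h, map_cj (phi w v t), ← map_cj, ← cj_mul, hb, cj_mul, map_cj, map_cj,
        ← S.toPG_phi_an, ← map_cj, ← map_cj]
  · rintro δ - ⟨z', hz', h | h⟩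
    · refine ⟨z', hz', Or.inr ?_⟩
      rw [cj_mul, map_cj, h, ← map_cj]
    · refine ⟨z', hz', Or.inl ?_⟩
      rw [cj_mul, map_cj, h, ← map_cj, ← cj_mul, b1_mul_self, cj_one]

/-- The elements with such a decomposition are closed under right multiplication by generators.
Elements of `Delta` join δ; the successor of an inner generator is moved past δ by `toPG_cj_phi` and
joins z₀ or z₁. -/
theorem exists_decomp (S : Setup w v s t m r) (g : F k v) :
    ∃ z₀ ∈ InnerSub s, ∃ z₁ ∈ InnerSub s, ∃ δ ∈ Delta v t,
      toPG w v s t m g = toPG w v s t m (phi w v t z₀ * cj (phi w v t z₁) (b1 v) * δ) := by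
  set p : F k v → Prop := fun g => ∃ z₀ ∈ InnerSub s, ∃ z₁ ∈ InnerSub s, ∃ δ ∈ Delta v t,
    toPG w v s t m g = toPG w v s t m (phi w v t z₀ * cj (phi w v t z₁) (b1 v) * δ) with hp
  have pδ : ∀ g, ∀ δ' ∈ Delta v t, p g → p (g * δ') := by
    rintro g δ' hδ' ⟨z₀, h₀, z₁, h₁, δ, hδ, h⟩
    exact ⟨z₀, h₀, z₁, h₁, _, mul_mem hδ hδ', by rw [map_mul, h, ← map_mul, mul_assoc]⟩
  have pin : ∀ g (x : Gen k n), Inner x → p g → p (g * fg (succGen x)) := by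
    rintro g x hx ⟨z₀, h₀, z₁, h₁, δ, hδ, h⟩
    obtain ⟨z', hz', h'⟩ := toPG_cj_phi S (fg_mem_innerSub hx)
      (mul_mem (bpow_mem_Delta v t (letter w v x)) (inv_mem hδ))
    have hswap : δ * fg (succGen x) =
        cj (phi w v t (fg x)) (bpow v (letter w v x) * δ⁻¹) * δ := by
      rw [cj_mul, ← succ_eq_phi w v t hx]
      simp [cj, mul_assoc]
    rcases h' with h' | h'
    · refine ⟨z₀ * z', mul_mem h₀ hz', z₁, h₁, δ, hδ, ?_⟩
      have hc := commute_toPG_innerSub S hz' h₁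
      rw [map_mul, h, ← map_mul, mul_assoc, hswap, ← mul_assoc, map_mul, map_mul, h', map_mul,
        mul_assoc (toPG w v s t m (phi w v t z₀)), ← hc.eq]
      simp only [map_mul, mul_assoc]
    · refine ⟨z₀, h₀, z₁ * z', mul_mem h₁ hz', δ, hδ, ?_⟩
      rw [map_mul, h, ← map_mul, mul_assoc, hswap, ← mul_assoc, map_mul, map_mul, h',
        map_mul (phi w v t), mul_cj]
      simp only [map_mul, mul_assoc]
  have pb : ∀ g (j : Fin k), p g → p (g * fb v j) := by
    intro g j hg
    rcases gen_cases (.b j : Gen k n) with h | h | ⟨y, hy, h⟩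
    · rw [Gen.b.inj h]
      exact pδ _ _ (mem_Delta_b1 v t) hg
    · simp at h
    · have : fb v j = fg (succGen y) := by rw [← h]; rfl
      rw [this]
      exact pin g y hy hg
  have pbs : ∀ c ∈ bSub (k := k) v r, ∀ g, p g → p (g * c) := by
    intro c hc
    refine bSub_induction (p := fun c => ∀ g, p g → p (g * c)) ?_ ?_ hc
    · intro g hg; rwa [mul_one]
    · intro c _ j _ ih g hg
      rw [← mul_assoc]
      exact pb _ j (ih g hg)
  refine F_induction (p := p) ⟨1, one_mem _, 1, one_mem _, 1, one_mem _, by simp [one_cj]⟩ ?_ g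
  intro g x hg
  rcases gen_cases x with rfl | rfl | ⟨y, hy, rfl⟩
  · exact pb g _ hg
  -- The generator a_1 itself need not lie in `Delta`, but it is conjugate to a_1^t by a word in the
  -- b_j, and the b_j have already been treated.
  · have : fg (.a (firstPos n)) = t * cj (a1 v) t * t⁻¹ := by
      simp [cj, mul_assoc, a1, fa, fg]
    rw [this, ← mul_assoc, ← mul_assoc]
    exact pbs _ (inv_mem S.ht) _ (pδ _ _ (mem_Delta_A v t) (pbs _ S.ht _ hg))
  · exact pin g y hy hg

/-- As θ(s) = 1, θ interchanges b_k and a_n^s, the coordinates of Ψ(a_1^t); hence it interchanges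
the coordinates of every element of `Delta`. -/
theorem Delta_decomp (S : Setup w v s t m r) {δ : F k v} (hδ : δ ∈ Delta v t) :
    ∃ (d₀ d₁ : F k v) (e : Bool), psi w v δ = pair d₀ d₁ * swpow e ∧
      theta v s d₀ = d₁ ∧ theta v s d₁ = d₀ ∧
      toPG w v s t m δ = toPG w v s t m (phi w v t d₀ * bpow v e) := by
  refine Delta_induction (p := fun δ => ∃ (d₀ d₁ : F k v) (e : Bool),
      psi w v δ = pair d₀ d₁ * swpow e ∧
      theta v s d₀ = d₁ ∧ theta v s d₁ = d₀ ∧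
      toPG w v s t m δ = toPG w v s t m (phi w v t d₀ * bpow v e)) ?_ ?_ ?_ hδ
  · refine ⟨1, 1, false, ?_, map_one _, map_one _, ?_⟩
    · rw [map_one, pair_one, swpow]; rfl
    · simp [bpow]
  · rintro δ - ⟨d₀, d₁, e, h, h0, h1, hq⟩
    cases e
    · refine ⟨d₀ * bk v, d₁ * cj (an v) s, false, ?_, ?_, ?_, ?_⟩
      · rw [map_mul, h, S.psiA, mul_assoc, swpow_mul_pair, ← mul_assoc]
        simp [pair_mul]
      · rw [map_mul, h0, theta_bk]
      · rw [map_mul, h1, S.theta_cj_an]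
      · rw [map_mul, hq, ← map_mul, map_mul (phi w v t), phi_bk]
        simp [bpow]
    · refine ⟨d₀ * cj (an v) s, d₁ * bk v, true, ?_, ?_, ?_, ?_⟩
      · rw [map_mul, h, S.psiA, mul_assoc, swpow_mul_pair, ← mul_assoc]
        simp [pair_mul]
      · rw [map_mul, h0, S.theta_cj_an]
      · rw [map_mul, h1, theta_bk]
      · have hb : (bpow v true : F k v) = b1 v := rfl
        rw [hb] at hq ⊢
        have hA : toPG w v s t m (phi w v t (d₀ * cj (an v) s) * b1 v) =
            toPG w v s t m (phi w v t d₀ * cj (cj (a1 v) t) (b1 v) * b1 v) := by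
          rw [map_mul (phi w v t)]
          simp only [map_mul (toPG w v s t m), S.toPG_phi_an]
        rw [map_mul, hq, ← map_mul, hA]
        congr 1
        rw [cj.eq_1 (cj (a1 v) t) (b1 v), b1_inv]
        simp only [mul_assoc, b1_mul_self, mul_one]
  · rintro δ - ⟨d₀, d₁, e, h, h0, h1, hq⟩
    refine ⟨d₀, d₁, !e, ?_, h0, h1, ?_⟩
    · rw [map_mul, h, psi_b1, mul_assoc, swpow_mul_sw]
    · rw [map_mul, hq, ← map_mul, mul_assoc, bpow_mul_b1]

theorem toPG_eq_one_of_psi (S : Setup w v s t m r)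
    (hA : mapWr (toPG w v s t m) (psi w v (rho v s m)) = 1) {g : F k v}
    (hg : mapWr (toPG w v s t m) (psi w v g) = 1) : toPG w v s t m g = 1 := by
  obtain ⟨z₀, m₀, z₁, m₁, δ, hδ, h⟩ := exists_decomp S g
  obtain ⟨d₀, d₁, e, hψ, hd0, hd1, hq⟩ := Delta_decomp S hδ
  have hp : psi w v (phi w v t z₀ * cj (phi w v t z₁) (b1 v) * δ) =
      pair (z₀ * d₀) (z₁ * d₁) * swpow e := by
    rw [map_mul, map_mul, map_cj, psi_phi S.psiA, psi_phi S.psiA, theta_innerSub m₀,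
      theta_innerSub m₁, psi_b1, cj_pair_sw, hψ, ← mul_assoc, pair_mul, pair_mul, mul_one, one_mul]
  have h1 := mapWr_psi_eq S hA h
  rw [hg, hp, map_mul, mapWr_pair, mapWr_swpow] at h1
  have h2 : (pair 1 1 * swpow false : Wr (PG w v s t m)) = 1 := by rw [pair_one, swpow]; simp
  obtain ⟨e0, e1, rfl⟩ := pair_swpow_inj (h2.trans h1)
  -- Applying θ to z₀ d₀ = 1 erases z₀ and turns d₀ into d₁. In the same way z₁ d₁ = 1 gives d₀ = 1,
  -- and then both z's are trivial.
  have hd1' : toPG w v s t m d₁ = 1 := by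
    have := toPG_theta S e0.symm
    rwa [map_mul, theta_innerSub m₀, one_mul, hd0] at this
  have hd0' : toPG w v s t m d₀ = 1 := by
    have := toPG_theta S e1.symm
    rwa [map_mul, theta_innerSub m₁, one_mul, hd1] at this
  have hz0 : toPG w v s t m z₀ = 1 := by
    rw [map_mul, hd0', mul_one] at e0; exact e0.symm
  have hz1 : toPG w v s t m z₁ = 1 := by
    rw [map_mul, hd1', mul_one] at e1; exact e1.symm
  rw [h, map_mul, map_mul, map_cj, hq, map_mul, toPG_phi w v hz0, toPG_phi w v hz1,
    toPG_phi w v hd0', one_cj]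
  simp [bpow]

end

section

variable {k n : ℕ} [NeZero k] [NeZero n] {w : Fin k → Bool} {v : Fin n → Bool}
  {s t : F k v} {m : ℕ}

/-! ### Periods of the word `v` -/

theorem rootExp_mul (v : Fin n → Bool) : rootExp v * (n / rootExp v) = n ∧ 0 < rootExp v := by
  obtain ⟨u, hu⟩ := rootExp_spec v
  have hlen := congrArg List.length hu
  simp only [List.length_ofFn, List.length_flatten, List.map_replicate, List.sum_replicate,
    smul_eq_mul] at hlen
  have hn := NeZero.pos n
  refine ⟨Nat.mul_div_cancel' ⟨_, hlen⟩, ?_⟩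
  rcases Nat.eq_zero_or_pos (rootExp v) with h0 | h0
  · rw [h0] at hlen; omega
  · exact h0

theorem le_rootExp (v : Fin n → Bool) {d : ℕ} {u : List Bool}
    (h : List.ofFn v = (List.replicate d u).flatten) : d ≤ rootExp v := by
  refine le_csSup ⟨n, ?_⟩ ⟨u, h⟩
  rintro d ⟨u, hu⟩
  have h := congrArg List.length hu
  simp only [List.length_ofFn, List.length_flatten, List.map_replicate, List.sum_replicate,
    smul_eq_mul] at h
  have hn := NeZero.pos n
  rw [h]
  exact Nat.le_mul_of_pos_right _ (Nat.pos_of_ne_zero fun h0 => by rw [h0] at h; omega)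

/-- The periodic extension of `v` to the integers. -/
def periodicExt (v : Fin n → Bool) (z : ℤ) : Bool :=
  v ⟨(z % n).toNat, by
    have := NeZero.pos n
    have h1 := Int.emod_nonneg z (b := n) (by omega)
    have h2 := Int.emod_lt_of_pos z (b := n) (by omega)
    omega⟩

theorem periodicExt_val (v : Fin n → Bool) (i : Fin n) : periodicExt v (i : ℕ) = v i := by
  unfold periodicExt
  congr 1
  ext
  simp only
  rw [← Int.natCast_mod, Int.toNat_natCast, Nat.mod_eq_of_lt i.2]

theorem periodicExt_periodic_of {p : ℕ}
    (h : ∀ i i' : Fin n, (i' : ℕ) = (i + p) % n → v i' = v i) :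
    Function.Periodic (periodicExt v) p := by
  intro z
  unfold periodicExt
  apply h
  have hn := NeZero.pos n
  have h1 := Int.emod_nonneg z (b := n) (by omega)
  zify
  rw [Int.toNat_of_nonneg h1, Int.toNat_of_nonneg (Int.emod_nonneg _ (by omega)),
    Int.emod_add_emod]

/-- By Bézout, the gcd q of the cyclic periods e and n/d is again a period, so v is a power of a
word of length q. Maximality of d forces q = n/d. -/
theorem dvd_of_period {e : ℕ} (h : ∀ i i' : Fin n, (i' : ℕ) = (i + e) % n → v i' = v i) :
    n / rootExp v ∣ e := by
  obtain ⟨hd, hd0⟩ := rootExp_mul v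
  have hn := NeZero.pos n
  set p := n / rootExp v with hp
  have pe := periodicExt_periodic_of h
  have pp : Function.Periodic (periodicExt v) p :=
    periodicExt_periodic_of fun i i' hi => letter_periodic v (l := 1) (by rw [one_mul]; exact hi)
  have hq : Function.Periodic (periodicExt v) (Nat.gcd e p) := by
    have : ((Nat.gcd e p : ℕ) : ℤ) = Nat.gcdA e p * e + Nat.gcdB e p * p := by
      rw [Nat.gcd_eq_gcd_ab]; ring
    rw [this]
    exact (pe.int_mul _).add_period (pp.int_mul _)
  set q := Nat.gcd e p with hqd
  have hqp : q ∣ p := Nat.gcd_dvd_right e p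
  have hqn : n / q * q = n := Nat.div_mul_cancel (hqp.trans ⟨_, by rw [mul_comm]; exact hd.symm⟩)
  have hle : n / q ≤ rootExp v := by
    refine le_rootExp v (u := (List.range q).map fun i => periodicExt v (i : ℕ)) ?_
    apply List.ext_getElem?
    intro i
    by_cases hi : i < n
    · rw [flatten_replicate_get _ _ _ (by simpa [hqn] using hi)]
      have hq0 : 0 < q := Nat.pos_of_ne_zero fun h0 => by rw [h0] at hqn; omega
      simp only [List.length_map, List.length_range, List.getElem?_map, List.getElem?_ofFn, hi,
        dif_pos]
      rw [List.getElem?_range (Nat.mod_lt _ hq0), Option.map_some, ← periodicExt_val v ⟨i, hi⟩]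
      congr 1
      have := hq.int_mul (i / q : ℕ) ((i % q : ℕ) : ℤ)
      rw [← this]
      congr 1
      have := Nat.mod_add_div i q
      zify at this
      push_cast
      rw [mul_comm (_ / _ : ℤ)]
      exact this.symm
    · rw [List.getElem?_eq_none (by simpa using hi), List.getElem?_eq_none]
      simpa [hqn] using hi
  have hpq : p ≤ q := by
    have hq0 : 0 < q := Nat.pos_of_ne_zero fun h0 => by rw [h0] at hqn; omega
    have h1 : rootExp v * p ≤ rootExp v * q := by
      calc rootExp v * p = n / q * q := by rw [hd, hqn]
        _ ≤ _ := Nat.mul_le_mul_right _ hle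
    exact Nat.le_of_mul_le_mul_left h1 hd0
  have hp0 : 0 < p := Nat.pos_of_ne_zero fun h0 => by rw [h0] at hd; omega
  have : q = p := le_antisymm (Nat.le_of_dvd hp0 hqp) hpq
  rw [← this]
  exact Nat.gcd_dvd_left e p

/-- Taking z = i - x shows that j - i is a cyclic period of v. It is thus a multiple of n/d, and the
commutator is a relator of F. -/
theorem commute_fa {i j : Fin n} (h : ∀ z, v (i - z) = v (j - z)) :
    Commute (fg (.a i) : F k v) (fg (.a j)) := by
  by_cases hij : i = j
  · rw [hij]
  obtain ⟨hd, hd0⟩ := rootExp_mul v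
  have hdvd : n / rootExp v ∣ ((j - i : Fin n) : ℕ) := by
    apply dvd_of_period
    intro x x' hx
    have : x' = x + (j - i) := Fin.ext (by rw [Fin.val_add]; exact hx)
    have h1 := h (i - x)
    rw [sub_sub_cancel] at h1
    rw [this, h1]
    congr 1
    abel
  obtain ⟨l, hl⟩ := hdvd
  have hlt := (j - i).2
  have hl' : l * (n / rootExp v) = (j - i : Fin n) := by rw [hl, mul_comm]
  have hne : ((j - i : Fin n) : ℕ) ≠ 0 := by
    intro h0
    apply hij
    have : j - i = 0 := Fin.ext h0
    exact (sub_eq_zero.1 this).symm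
  refine fa_comm v (l := l) ?_ ?_ ?_
  · rw [hl', ← Fin.val_add]
    congr 1
    abel
  · rcases Nat.eq_zero_or_pos l with h0 | h0
    · rw [h0] at hl; omega
    · exact h0
  · by_contra hcon
    have : n ≤ l * (n / rootExp v) := by
      calc n = rootExp v * (n / rootExp v) := hd.symm
        _ ≤ _ := Nat.mul_le_mul_right _ (by omega)
    omega

/-! ### Contraction -/

/-- The element of `F` represented by a list of generators. -/
def word (v : Fin n → Bool) (l : List (Gen k n)) : F k v := (l.map fg).prod

theorem word_cons (x : Gen k n) (l : List (Gen k n)) : word v (x :: l) = fg x * word v l := by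
  simp [word]

theorem word_append (l l' : List (Gen k n)) : word v (l ++ l') = word v l * word v l' := by
  simp [word]

theorem exists_word (g : F k v) : ∃ l, g = word v l := by
  induction g using F_induction with
  | one => exact ⟨[], rfl⟩
  | mul g x ih =>
    obtain ⟨l, rfl⟩ := ih
    exact ⟨l ++ [x], by rw [word_append]; simp [word]⟩

/-- The coordinates of a word in the generators. -/
def secWord (w : Fin k → Bool) (v : Fin n → Bool) : Bool → List (Gen k n) → List (Gen k n)
  | _, [] => []
  | c, x :: l => (coord w v x c).toList ++ secWord w v (xor (active x) c) l

theorem psi_word_left (l : List (Gen k n)) (c : Bool) :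
    (psi w v (word v l)).left c = word v (secWord w v c l) := by
  induction l generalizing c with
  | nil => simp [word, secWord]
  | cons x l ih =>
    rw [word_cons, map_mul, secWord, word_append, ← ih, SemidirectProduct.mul_left, Pi.mul_apply,
      psi_fg]
    congr 1
    · cases h : coord w v x c <;> cases c <;> simp [psiGen, pair, h, ofOption, word, fg]
    · have hr : (psiGen w v x).right = if active x then Equiv.boolNot else 1 := by
        simp [psiGen, pair]
      rw [hr]
      cases active x <;> cases c <;> simp <;> rfl

theorem coord_of_active {x : Gen k n} (h : active x = true) (c : Bool) : coord w v x c = none := by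
  rcases x with i | ⟨_ | j, hj⟩
  · simp [active] at h
  · rfl
  · simp [active] at h

theorem length_secWord_le (l : List (Gen k n)) (c : Bool) :
    (secWord w v c l).length ≤ l.length := by
  induction l generalizing c with
  | nil => simp [secWord]
  | cons x l ih =>
    have := ih (xor (active x) c)
    rw [secWord, List.length_append, List.length_cons]
    cases coord w v x c <;> simp <;> omega

/-- A letter contributes at most one letter to a coordinate, and an active one contributes none.
Equal lengths therefore mean that nothing was lost and that the path c never changes. -/
theorem mem_secWord {l : List (Gen k n)} {c : Bool} (h : (secWord w v c l).length = l.length)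
    {x : Gen k n} (hx : x ∈ l) : ∃ y, coord w v x c = some y ∧ y ∈ secWord w v c l := by
  induction l with
  | nil => simp at hx
  | cons z l ih =>
    have hle := length_secWord_le (w := w) (v := v) l (xor (active z) c)
    rw [secWord, List.length_append, List.length_cons] at h
    cases hz : coord w v z c with
    | none => rw [hz] at h; simp at h; omega
    | some y =>
      have hact : active z = false := by
        by_contra hcon
        rw [coord_of_active (by simpa using hcon)] at hz
        simp at hz
      rw [hz, hact, Bool.false_xor] at h
      have h' : (secWord w v c l).length = l.length := by simp at h; omega
      rw [secWord, hz, hact, Bool.false_xor]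
      rcases List.mem_cons.1 hx with rfl | hx
      · exact ⟨y, hz, by simp⟩
      · obtain ⟨y', h1, h2⟩ := ih h' hx
        exact ⟨y', h1, by simp [h2]⟩

theorem coord_a_eq_some {i i' : Fin n} {c : Bool} (h : coord w v (.a i) c = some (.a i')) :
    v (i - 1) = c ∧ i' = i - 1 := by
  rcases i with ⟨_ | i, hi⟩
  · have h0 : (⟨0, hi⟩ - 1 : Fin n) = lastPos n := by
      rw [sub_eq_iff_eq_add, lastPos_add_one]; rfl
    rw [h0]
    simp only [coord] at h
    split_ifs at h with hc
    · simp only [Option.some.injEq, Gen.a.injEq] at h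
      exact ⟨hc.symm, h.symm⟩
    · simp at h
  · have h0 : (⟨i + 1, hi⟩ - 1 : Fin n) = ⟨i, by omega⟩ := by
      rw [sub_eq_iff_eq_add]
      ext
      rw [val_add_one_of_inner (i := ⟨i, by omega⟩) hi]
    rw [h0]
    simp only [coord] at h
    split_ifs at h with hc
    simp only [Option.some.injEq, Gen.a.injEq] at h
    exact ⟨hc.symm, h.symm⟩

/-- A word that is trivial in `K(w, v)` but not in the presented group, of a given length. -/
structure Bad (w : Fin k → Bool) (s t : F k v) (m L : ℕ) (l : List (Gen k n)) : Prop where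
  length : l.length = L
  trivial : toK w v (word v l) = 1
  nontrivial : toPG w v s t m (word v l) ≠ 1

/-- Coordinates shorter than L are trivial in Γ by minimality. Were all coordinates trivial in Γ,
injectivity of Ψ on Γ would make the word trivial there. -/
theorem Bad.step (hB : ∀ g, mapWr (toPG w v s t m) (psi w v g) = 1 → toPG w v s t m g = 1)
    {L : ℕ} (hL : ∀ l : List (Gen k n), l.length < L → toK w v (word v l) = 1 →
      toPG w v s t m (word v l) = 1) {l : List (Gen k n)} (h : Bad w s t m L l) :
    ∃ c, Bad w s t m L (secWord w v c l) := by
  by_contra hcon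
  simp only [not_exists] at hcon
  obtain ⟨hK, hr⟩ := (mapWr_eq_one_iff _ _).1 ((toK_eq_one_iff w v _).1 h.trivial)
  apply h.nontrivial
  apply hB
  refine (mapWr_eq_one_iff _ _).2 ⟨fun c => ?_, hr⟩
  have h1 : toK w v (word v (secWord w v c l)) = 1 := by
    rw [← psi_word_left]
    exact hK c
  rw [psi_word_left]
  have hle := length_secWord_le (w := w) (v := v) l c
  rw [h.length] at hle
  rcases hle.lt_or_eq with hlt | heq
  · exact hL _ hlt h1
  · by_contra h2
    exact hcon c ⟨heq, h1, h2⟩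

/-- Along coordinates of full length an occurrence of b_j descends to b_1, which contributes no
letter at all. -/
theorem Bad.no_b (hB : ∀ g, mapWr (toPG w v s t m) (psi w v g) = 1 →
      toPG w v s t m g = 1)
    {L : ℕ} (hL : ∀ l : List (Gen k n), l.length < L → toK w v (word v l) = 1 →
      toPG w v s t m (word v l) = 1) (j : ℕ) (hj : j < k) {l : List (Gen k n)}
    (h : Bad w s t m L l) : .b ⟨j, hj⟩ ∉ l := by
  induction j generalizing l with
  | zero =>
    intro hx
    obtain ⟨c, hc⟩ := h.step hB hL
    obtain ⟨y, hy, -⟩ := mem_secWord (hc.length.trans h.length.symm) hx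
    simp [coord] at hy
  | succ j ih =>
    intro hx
    obtain ⟨c, hc⟩ := h.step hB hL
    obtain ⟨y, hy, hy'⟩ := mem_secWord (hc.length.trans h.length.symm) hx
    simp only [coord] at hy
    split_ifs at hy
    rw [← Option.some.inj hy] at hy'
    exact ih _ hc hy'

theorem Bad.exists_step (hB : ∀ g, mapWr (toPG w v s t m) (psi w v g) = 1 →
      toPG w v s t m g = 1)
    {L : ℕ} (hL : ∀ l : List (Gen k n), l.length < L → toK w v (word v l) = 1 →
      toPG w v s t m (word v l) = 1) {l : List (Gen k n)}
    (h : Bad w s t m L l) : ∃ c, Bad w s t m L (secWord w v c l) ∧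
      ∀ i, .a i ∈ l → v (i - 1) = c ∧ .a (i - 1) ∈ secWord w v c l := by
  obtain ⟨c, hc⟩ := h.step hB hL
  refine ⟨c, hc, ?_⟩
  intro i hi
  obtain ⟨y, hy, hy'⟩ := mem_secWord (hc.length.trans h.length.symm) hi
  rcases y with i' | j'
  · obtain ⟨h1, rfl⟩ := coord_a_eq_some hy
    exact ⟨h1, hy'⟩
  · exact absurd hy' (hc.no_b hB hL _ j'.2)

/-- In a coordinate of full length every a_i must read the same letter and is replaced by a_{i-1}.
Iterating, all the a_i of the word read the same sequence. -/
theorem Bad.letters (hB : ∀ g, mapWr (toPG w v s t m) (psi w v g) = 1 →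
      toPG w v s t m g = 1)
    {L : ℕ} (hL : ∀ l : List (Gen k n), l.length < L → toK w v (word v l) = 1 →
      toPG w v s t m (word v l) = 1) (N : ℕ) {l : List (Gen k n)}
    (h : Bad w s t m L l) {i j : Fin n} (hi : .a i ∈ l) (hj : .a j ∈ l) (z : Fin n)
    (hz : (z : ℕ) = N) : v (i - 1 - z) = v (j - 1 - z) := by
  induction N generalizing l i j z with
  | zero =>
    obtain ⟨c, -, key⟩ := h.exists_step hB hL
    have hz0 : z = 0 := Fin.ext (by simpa using hz)
    rw [hz0, sub_zero, sub_zero, (key i hi).1, (key j hj).1]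
  | succ N ih =>
    obtain ⟨c, hc, key⟩ := h.exists_step hB hL
    have hz0 : z ≠ 0 := by rintro rfl; simp at hz
    have hz1 : ((z - 1 : Fin n) : ℕ) = N := by
      have : z = (z - 1) + 1 := (sub_add_cancel z 1).symm
      have h2 : ((z - 1 : Fin n) : ℕ) + 1 < n ∨ ((z - 1 : Fin n) : ℕ) + 1 = n := by
        have := (z - 1).2
        omega
      rcases h2 with h2 | h2
      · have h3 := val_add_one_of_inner h2
        rw [← this, hz] at h3
        omega
      · exfalso
        apply hz0
        have h4 : z - 1 = lastPos n := Fin.ext (by simp only [lastPos]; omega)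
        rw [this, h4, lastPos_add_one]
        rfl
    have h5 := ih hc (key i hi).2 (key j hj).2 (z - 1) hz1
    rwa [show i - 1 - 1 - (z - 1) = i - 1 - z by abel,
      show j - 1 - 1 - (z - 1) = j - 1 - z by abel] at h5

theorem toPG_eq_one_of_toK
    (hB : ∀ g, mapWr (toPG w v s t m) (psi w v g) = 1 → toPG w v s t m g = 1) {g : F k v}
    (hg : toK w v g = 1) : toPG w v s t m g = 1 := by
  obtain ⟨l, rfl⟩ := exists_word g
  induction hN : l.length using Nat.strong_induction_on generalizing l with
  | _ L IH =>
    by_contra hcon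
    have hL : ∀ l : List (Gen k n), l.length < L → toK w v (word v l) = 1 →
      toPG w v s t m (word v l) = 1 := fun l h1 h2 => IH _ h1 l h2 rfl
    have hbad : Bad w s t m L l := ⟨hN, hg, hcon⟩
    have hcomm : ∀ x ∈ l, ∀ y ∈ l, Commute (fg x : F k v) (fg y) := by
      intro x hx y hy
      rcases x with i | j
      · rcases y with i' | j
        · apply commute_fa
          intro z
          have := hbad.letters hB hL _ hx hy (z - 1) rfl
          rwa [sub_sub, sub_sub, add_sub_cancel] at this
        · exact absurd hy (hbad.no_b hB hL _ j.2)
      · exact absurd hx (hbad.no_b hB hL _ j.2)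
    cases l with
    | nil => exact hcon (by simp [word])
    | cons x l =>
      -- A letter occurring only once would have parity -1. The second occurrence can be moved next
      -- to the first, since all letters of the word commute, and the pair cancels.
      have hxl : x ∈ l := by
        by_contra hxl
        have h1 := par_eq_one_of_toK w v hg x
        have h2 : ∀ l : List (Gen k n), x ∉ l → par v x (word v l) = 1 := by
          intro l hl
          induction l with
          | nil => simp [word]
          | cons y l ih =>
            rw [List.mem_cons, not_or] at hl
            rw [word_cons, map_mul, ih hl.2, par_fg_ne v (Ne.symm hl.1), one_mul]
        rw [word_cons, map_mul, par_fg_self, h2 l hxl] at h1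
        exact absurd h1 (by decide)
      obtain ⟨l₁, l₂, rfl⟩ := List.append_of_mem hxl
      have hc : Commute (fg x : F k v) (word v l₁) := by
        have : ∀ l' : List (Gen k n), (∀ y ∈ l', Commute (fg x : F k v) (fg y)) →
            Commute (fg x : F k v) (word v l') := by
          intro l' h'
          induction l' with
          | nil => simp [word]
          | cons y l' ih =>
            rw [word_cons]
            exact (h' y (by simp)).mul_right (ih fun y hy => h' y (by simp [hy]))
        exact this l₁ fun y hy => hcomm x (by simp) y (by simp [hy])
      have heq : word v (x :: (l₁ ++ x :: l₂)) = word v (l₁ ++ l₂) := by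
        rw [word_cons, word_append, word_cons, word_append, ← mul_assoc, hc.eq, mul_assoc,
          ← mul_assoc (fg x), fg_mul_self, one_mul]
      rw [heq] at hg hcon
      refine hcon (hL _ ?_ hg)
      simp only [List.length_cons, List.length_append] at hN ⊢
      omega

end

section

variable {k n : ℕ} [NeZero k] [NeZero n] {w : Fin k → Bool} {v : Fin n → Bool}
  {s t : F k v} {m r : ℕ}

/-! ### Commuting generators -/

theorem toK_cj_sw {g a b : F k v} (h : psi w v g = pair a b)
    (hc : Commute (toK w v g) (toK w v (b1 v))) : toK w v a = toK w v b := by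
  rw [← cj_eq_self_iff, ← map_cj] at hc
  have h' : psi w v (cj g (b1 v)) = pair b a := by rw [map_cj, h, psi_b1, cj_pair_sw]
  exact ((toK_eq_iff w v h' h).1 hc).2

theorem toK_ne_one_fg (x : Gen k n) : toK w v (fg x) ≠ 1 := by
  rw [← map_one (toK w v)]
  refine toK_ne_of_par w v x ?_
  rw [par_fg_self, map_one]
  decide

theorem toK_cj_an_ne_bk (c c' : F k v) : toK w v (cj (an v) c) ≠ toK w v (cj (bk v) c') := by
  refine toK_ne_of_par w v (.a (lastPos n)) ?_
  rw [par_cj, par_cj]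
  have h1 : par v (.a (lastPos n)) (an v : F k v) = -1 := par_fg_self v _
  have h2 : par v (.a (lastPos n)) (bk v : F k v) = 1 := par_fg_ne v (by simp)
  rw [h1, h2]
  decide

/-- Commuting with σ forces equal coordinates in K(w,v). Those of a_1 are a_n and b_k, and those of
a successor are a generator and 1; parities distinguish them. -/
theorem eq_b1_of_commute {x : Gen k n} (h : Commute (toK w v (fg x)) (toK w v (b1 v))) :
    x = .b (firstPos k) := by
  rcases psi_fg_cases w v x with ⟨rfl, -⟩ | ⟨-, a, b, hx, hab⟩ | ⟨y, c, -, -, hx⟩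
  · rfl
  · exfalso
    have := toK_cj_sw hx h
    rcases hab with ⟨rfl, rfl⟩ | ⟨rfl, rfl⟩
    · rw [← cj_one (bk v), ← cj_one (an v)] at this
      exact toK_cj_an_ne_bk _ _ this.symm
    · rw [← cj_one (bk v), ← cj_one (an v)] at this
      exact toK_cj_an_ne_bk _ _ this
  · exfalso
    cases c
    · have := toK_cj_sw hx h
      rw [map_one] at this
      exact toK_ne_one_fg y this
    · have := toK_cj_sw hx h
      rw [map_one] at this
      exact toK_ne_one_fg y this.symm

/-- Commutation of two elements is inherited by the coordinates. -/
theorem toK_commute_left {g g' a b a' b' : F k v} (h : psi w v g = pair a b)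
    (h' : psi w v g' = pair a' b') (hc : Commute (toK w v g) (toK w v g')) :
    Commute (toK w v a) (toK w v a') := by
  have hc' : toK w v (g * g') = toK w v (g' * g) := by rw [map_mul, map_mul]; exact hc
  have := ((toK_eq_iff w v (a := a * a') (b := b * b') (a' := a' * a) (b' := b' * b)
    (by rw [map_mul, h, h', pair_mul]) (by rw [map_mul, h, h', pair_mul])).1 hc').1
  rw [map_mul, map_mul] at this
  exact this

theorem commute_toPG_phi_of (w : Fin k → Bool) (s t : F k v) (m : ℕ) {x y : F k v}
    (h : Commute (toPG w v s t m x) (toPG w v s t m y)) :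
    Commute (toPG w v s t m (phi w v t x)) (toPG w v s t m (phi w v t y)) := by
  rw [← cm_eq_one_iff, ← map_cm] at h
  rw [← cm_eq_one_iff, ← map_cm, ← map_cm]
  exact toPG_phi w v h

theorem psi_phi_bSub (t : F k v) {g : F k v} (hg : g ∈ bSub v (k - 1)) :
    psi w v (phi w v t g) = pair g 1 := by
  refine bSub_induction (p := fun g => psi w v (phi w v t g) = pair g 1)
    (by simp [pair_one]) ?_ hg
  intro g _ j hj ih
  have hin := inner_b (n := n) hj
  have : psi w v (phi w v t (fb v j)) = pair (fb v j) 1 := by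
    have h0 : (fb v j : F k v) = fg (.b j) := rfl
    rw [h0, phi_inner w v t hin, map_cj, psi_succGen w v hin, psi_bpow, cj_atc_swpow]
    simp [atc]
  rw [map_mul, map_mul, ih, this, pair_mul, mul_one]

theorem psi_cj_a1_bpow (c : Bool) : psi w v (cj (a1 v) (bpow v c)) =
    if xor (v (lastPos n)) c then pair (bk v) (an v) else pair (an v) (bk v) := by
  rw [map_cj, psi_a1, psi_bpow]
  cases v (lastPos n) <;> cases c <;> simp [swpow, cj_one, cj_pair_sw]

/-- Induction along the b's. After conjugation by a power of b_1, the second entry is φ of the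
preceding b, whose only nontrivial coordinate is the first. If the first entry is φ(z), or is a_1 up
to a power of b_1, the commutation in K(w,v) passes to the first coordinates, is lifted to Γ by
induction, and is brought back by φ. If it is φ(z)^{b_1}, it commutes by the relators. -/
theorem commute_toPG_of_toK (S : Setup w v s t m r) (j : ℕ) (hj : j < k) (x : Gen k n) (e : Bool)
    (h : Commute (toK w v (cj (fg x) (bpow v e))) (toK w v (fb v ⟨j, hj⟩))) :
    Commute (toPG w v s t m (cj (fg x) (bpow v e))) (toPG w v s t m (fb v ⟨j, hj⟩)) := by
  induction j generalizing x e with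
  | zero =>
    have hb : cj (b1 v) (bpow v e) = (b1 v : F k v) := by
      rw [cj_eq_self_iff]
      cases e
      · exact Commute.one_right _
      · exact Commute.refl _
    have hb0 : fb v ⟨0, hj⟩ = (b1 v : F k v) := rfl
    rw [hb0, ← hb, map_cj, map_cj, commute_cj_iff] at h
    have hx := eq_b1_of_commute h
    rw [hx]
    change Commute (toPG w v s t m (cj (b1 v) (bpow v e))) _
    rw [hb, hb0]
  | succ j ih =>
    have hj' : j < k := by omega
    have hbf : (bpow v false : F k v) = 1 := by simp [bpow]
    have hjk : ((⟨j, hj'⟩ : Fin k) : ℕ) < k - 1 := by simp only; omega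
    have hin : Inner (.b ⟨j, hj'⟩ : Gen k n) := hj
    have hmem : fb v ⟨j, hj'⟩ ∈ bSub (k := k) v (k - 1) := fb_mem_bSub hjk
    set y : Gen k n := .b ⟨j, hj'⟩ with hy
    set c := letter w v y with hc
    have hB : fb v ⟨j + 1, hj⟩ = cj (phi w v t (fb v ⟨j, hj'⟩)) (bpow v c) := by
      rw [fb_succ, succ_eq_phi w v t hin]
      rfl
    -- after conjugation by `b_1 ^ c`
    have hψ := psi_phi_bSub (w := w) t hmem
    have hred : ∀ {H : Type} [Group H] (f : F k v →* H),
        Commute (f (cj (fg x) (bpow v e))) (f (fb v ⟨j + 1, hj⟩)) ↔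
        Commute (f (cj (fg x) (bpow v (xor e c)))) (f (phi w v t (fb v ⟨j, hj'⟩))) := by
      intro H _ f
      rw [hB, ← commute_cj_iff _ _ (f (bpow v c)), ← map_cj, ← map_cj, ← cj_mul, ← cj_mul,
        bpow_mul_bpow, bpow_mul_self, cj_one]
    rw [hred] at h ⊢
    generalize xor e c = e' at h ⊢
    rcases gen_cases x with rfl | rfl | ⟨z, hz, rfl⟩
    · exfalso
      have hb : cj (b1 v) (bpow v c) = (b1 v : F k v) := by
        rw [cj_eq_self_iff]
        cases c
        · exact Commute.one_right _
        · exact Commute.refl _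
      have hb' : cj (fg (.b (firstPos k))) (bpow v e') = (b1 v : F k v) := by
        change cj (b1 v) _ = _
        rw [cj_eq_self_iff]
        cases e'
        · exact Commute.one_right _
        · exact Commute.refl _
      rw [hb', ← commute_cj_iff _ _ (toK w v (bpow v c)), ← map_cj, ← map_cj, hb, ← hB] at h
      have := eq_b1_of_commute (x := (.b ⟨j + 1, hj⟩ : Gen k n)) h.symm
      simp [firstPos] at this
    · change Commute (toK w v (cj (a1 v) (bpow v e'))) _ at h
      change Commute (toPG w v s t m (cj (a1 v) (bpow v e'))) _
      have hψa := psi_cj_a1_bpow (k := k) (w := w) (v := v) e'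
      cases hxe : xor (v (lastPos n)) e'
      · rw [hxe] at hψa
        have h1 := toK_commute_left hψa hψ h
        have h2 : Commute (toPG w v s t m (an v)) (toPG w v s t m (fb v ⟨j, hj'⟩)) := by
          have := ih hj' (.a (lastPos n)) false (by rw [hbf, cj_one]; exact h1)
          rw [hbf, cj_one] at this
          exact this
        have he : e' = v (lastPos n) := by
          revert hxe; cases e' <;> cases v (lastPos n) <;> simp
        rw [he, ← phi_an w v t]
        exact commute_toPG_phi_of w s t m h2
      · rw [hxe] at hψa
        have h1 := toK_commute_left hψa hψ h
        have h2 : Commute (toPG w v s t m (bk v)) (toPG w v s t m (fb v ⟨j, hj'⟩)) := by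
          have := ih hj' (.b (lastPos k)) false (by rw [hbf, cj_one]; exact h1)
          rw [hbf, cj_one] at this
          exact this
        have h3 := commute_toPG_phi_of w s t m h2
        rw [phi_bk] at h3
        -- Here a_1^{b_1^{e'}} = φ(b_k)^η. Comparing first coordinates, which are both b_k, shows
        -- that η has trivial first coordinate, so η = φ(h₁)^{b_1} in Γ, and this commutes with the
        -- second entry.
        set η := t⁻¹ * bpow v e' with hη
        have hηm : η ∈ bSub (k := k) v r := mul_mem (inv_mem S.ht) (bpow_mem_bSub S.one_le _)
        have hηe : cj (a1 v) (bpow v e') = cj (cj (a1 v) t) η := by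
          rw [hη, ← cj_mul, mul_inv_cancel_left]
        obtain ⟨h₀, m₀, h₁, m₁, ε, hηψ, hηq⟩ := bSub_decomp (w := w) s t m S.le hηm
        have hle : bSub (k := k) v (r - 1) ≤ bSub v (k - 1) :=
          bSub_mono (by have := S.le; omega)
        rw [hηe, map_cj, S.psiA, hηψ, cj_mul, cj_pair_pair] at hψa
        simp only [if_true] at hψa
        have hε : ε = false ∧ h₀ = 1 := by
          cases ε
          · simp only [swpow, Bool.false_eq_true, if_false, cj_one] at hψa
            exact ⟨rfl, eq_one_of_commute_bk (hle m₀) (pair_inj hψa).1⟩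
          · simp only [swpow, if_true, cj_pair_sw] at hψa
            have := (pair_inj hψa).1
            rw [← cj_mul, ← cj_one (bk v)] at this
            exact absurd this (cj_an_ne_bk _ _)
        obtain ⟨rfl, rfl⟩ := hε
        have hηq' : toPG w v s t m η = toPG w v s t m (cj (phi w v t h₁) (b1 v)) := by
          rw [hηq]; simp [bpow]
        have h4 := commute_toPG_phi_bSub (w := w) (s := s) (t := t) (m := m) hmem (hle m₁)
        rw [← hηq'] at h4
        rw [hηe, map_cj]
        unfold cj at h3 ⊢
        exact ((h4.symm.inv_left).mul_left h3).mul_left h4.symm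
    · have hz' : cj (fg (succGen z)) (bpow v e') =
          cj (phi w v t (fg z)) (bpow v (xor (letter w v z) e')) := by
        rw [succ_eq_phi w v t hz, ← cj_mul, bpow_mul_bpow]
      rw [hz'] at h ⊢
      cases hce : xor (letter w v z) e'
      · rw [hce] at h
        rw [hbf, cj_one] at h ⊢
        rw [psi_phi S.psiA] at hψ
        have h1 := toK_commute_left (psi_phi S.psiA (fg z)) (psi_phi S.psiA _) h
        have h2 := ih hj' z false (by rw [hbf, cj_one]; exact h1)
        rw [hbf, cj_one] at h2
        exact commute_toPG_phi_of w s t m h2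
      · exact (commute_toPG_phi (w := w) hin hz (mem_Delta_b1 v t) (by rw [psi_b1]; rfl)).symm

theorem mem_bSub_one {g : F k v} (hg : g ∈ bSub v 1) : ∃ e, g = bpow v e := by
  refine bSub_induction (p := fun g => ∃ e, g = bpow v e) ⟨false, by simp [bpow]⟩ ?_ hg
  rintro _ - j hj ⟨e, rfl⟩
  refine ⟨!e, ?_⟩
  have : j = firstPos k := Fin.ext (by simp only [firstPos]; omega)
  rw [this, bpow_mul_b1]

theorem rho_one : rho v s 1 = cm (cj (an v) s) (bk v : F k v) := by
  have h1 : (cj (an v) s)⁻¹ = cj (an v : F k v) s :=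
    inv_eq_of_mul_eq_one_right (cj_mul_self an_mul_self s)
  have h2 : (bk v)⁻¹ = (bk v : F k v) := inv_eq_of_mul_eq_one_right bk_mul_self
  rw [rho, cm, h1, h2, pow_one, pow_two]
  group

theorem bk_eq_succ (hk : 2 ≤ k) : Inner (.b ⟨k - 2, by omega⟩ : Gen k n) ∧
    (bk v : F k v) = fg (succGen (.b ⟨k - 2, by omega⟩)) := by
  have h : k - 2 + 1 < k := by omega
  refine ⟨h, ?_⟩
  rw [← fb_succ v h]
  exact congrArg (fb v) (Fin.ext (by simp only [lastPos]; omega))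

theorem an_eq_succ (hn : 2 ≤ n) : ∃ y : Gen k n, Inner y ∧ (an v : F k v) = fg (succGen y) := by
  rcases gen_cases (.a (lastPos n) : Gen k n) with h | h | ⟨y, hy, h⟩
  · simp at h
  · simp only [firstPos, lastPos, Gen.a.injEq, Fin.mk.injEq] at h
    omega
  · exact ⟨y, hy, congrArg fg h⟩

/-- For m = 1 the relator is the commutator of a_n^s and b_k. As b_k has b_{k-1} as its only
nontrivial coordinate, Ψ leaves one commutator with b_{k-1}; it vanishes in K(w,v), hence in Γ by
`commute_toPG_of_toK`. -/
theorem mapWr_psi_rho_one (S : Setup w v s t 1 r) (hk : 2 ≤ k)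
    (hs : ∃ g₀ g₁ : F k v, psi w v (cj (an v) s) = pair g₀ g₁ ∧
      ∀ g, g = g₀ ∨ g = g₁ → g = 1 ∨ ∃ x e, g = cj (fg x) (bpow v e)) :
    mapWr (toPG w v s t 1) (psi w v (rho v s 1)) = 1 := by
  obtain ⟨g₀, g₁, hg, hgs⟩ := hs
  obtain ⟨hin, hbk⟩ := bk_eq_succ (n := n) (v := v) hk
  have hψ := psi_succGen w v hin
  rw [← hbk] at hψ
  generalize letter w v _ = c at hψ
  have hK := S.rhoK
  rw [rho_one] at hK ⊢
  have hfin : ∀ g, (g = g₀ ∨ g = g₁) → toK w v (cm g (fb v ⟨k - 2, by omega⟩)) = 1 →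
      toPG w v s t 1 (cm g (fb v ⟨k - 2, by omega⟩)) = 1 := by
    intro g hg' h
    rw [map_cm, cm_eq_one_iff] at h ⊢
    rcases hgs g hg' with rfl | ⟨x, e, rfl⟩
    · rw [map_one]; exact Commute.one_left _
    · exact commute_toPG_of_toK S _ _ x e h
  cases c
  · have h1 : psi w v (cm (cj (an v) s) (bk v)) = pair (cm g₀ (fb v ⟨k - 2, by omega⟩)) 1 := by
      rw [map_cm, hg, hψ]
      simp only [atc, cm, pair_mul, pair_inv, Bool.false_eq_true, if_false]
      congr 1
      group
    have h2 := (toK_pair_of_eq_one w v (e := false) (h1.trans (mul_one _).symm) hK).1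
    rw [h1, mapWr_pair, hfin _ (Or.inl rfl) h2, map_one, pair_one]
  · have h1 : psi w v (cm (cj (an v) s) (bk v)) = pair 1 (cm g₁ (fb v ⟨k - 2, by omega⟩)) := by
      rw [map_cm, hg, hψ]
      simp only [atc, cm, pair_mul, pair_inv, if_true]
      congr 1
      group
    have h2 := (toK_pair_of_eq_one w v (e := false) (h1.trans (mul_one _).symm) hK).2.1
    rw [h1, mapWr_pair, hfin _ (Or.inr rfl) h2, map_one, pair_one]

/-! ### The relator `(a_n^s b_k)^{2^m}` in the case `m = 2` -/

/-- The square of b_2 b_1 is b_2 b_2^{b_1}, a product of two involutions that commute under f. -/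
theorem map_bk_b1_pow {H : Type*} [Group H] (f : F 2 v →* H)
    (h : Commute (f (bk v)) (f (cj (bk v) (b1 v)))) : f ((bk v * b1 v) ^ 4) = 1 := by
  have e : (bk v * b1 v) ^ 4 = (bk v * cj (bk v) (b1 v) * (bk v * cj (bk v) (b1 v)) : F 2 v) := by
    rw [cj, b1_inv]
    simp only [pow_succ, pow_zero, one_mul, mul_assoc]
  rw [e, map_mul, map_mul, h.symm.mul_mul_mul_comm, ← map_mul, ← map_mul, bk_mul_self,
    cj_mul_self bk_mul_self, map_one, one_mul]

theorem psi_cj_rho_two_one [NeZero 2] [NeZero 1] {w : Fin 2 → Bool} {v : Fin 1 → Bool}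
    {s r : F 2 v} (hs : s ∈ bSub (k := 2) v 1) (hr : r ∈ bSub (k := 2) v 1)
    (h1 : psi w v (cj (bk v) r) = pair (b1 v) 1)
    (h2 : psi w v (cj (a1 v) (r * s)) = pair (bk v) (an v)) (l : ℕ) :
    psi w v (cj ((cj (an v) s * bk v) ^ l) r) = pair ((bk v * b1 v) ^ l) (an v ^ l) := by
  have hrs : s * r = r * s := by
    obtain ⟨e, rfl⟩ := mem_bSub_one hs
    obtain ⟨e', rfl⟩ := mem_bSub_one hr
    rw [bpow_mul_bpow, bpow_mul_bpow, Bool.xor_comm]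
  have hpow : ∀ (G : Type) [Group G] (x y : G) (l : ℕ), cj (x ^ l) y = cj x y ^ l := by
    intro G _ x y l
    induction l with
    | zero => simp [one_cj]
    | succ l ih => rw [pow_succ, mul_cj, ih, pow_succ]
  have han : (an v : F 2 v) = a1 v := rfl
  rw [hpow, map_pow, mul_cj, ← cj_mul, hrs, map_mul, han, h2, h1, pair_mul, han, mul_one]
  induction l with
  | zero => simp [pair_one]
  | succ l ih => rw [pow_succ, ih, pair_mul, ← pow_succ, ← pow_succ]

theorem atc_mul_sw_sq {G : Type} [Group G] (c : Bool) (g : G) :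
    (atc c g * sw) ^ 2 = pair g g := by
  have h1 : (atc c g * sw) ^ 2 = atc c g * (swpow true * atc c g) * sw := by
    simp only [swpow, if_true, mul_assoc, pow_two]
  have h2 : (swpow true * sw : Wr G) = 1 := sw_mul_sw
  rw [h1, swpow_mul_atc, mul_assoc, mul_assoc, h2, mul_one]
  cases c <;> simp [atc, pair_mul]

theorem psi_an_b1_sq (hn : 2 ≤ n) : ∃ y : Gen k n,
    psi w v ((an v * b1 v) ^ 2) = pair (fg y) (fg y) := by
  obtain ⟨y, hy, h⟩ := an_eq_succ (k := k) (v := v) hn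
  refine ⟨y, ?_⟩
  rw [map_pow, map_mul, h, psi_succGen w v hy, psi_b1]
  exact atc_mul_sw_sq _ _

/-- With k = 1 the relator is (a_n b_1)⁴, and (a_n b_1)² has the same involution in both
coordinates. -/
theorem psi_rho_of_k_eq_one {w : Fin 1 → Bool} [NeZero 1] (hn : 2 ≤ n) :
    psi w v (rho v (1 : F 1 v) 2) = 1 := by
  obtain ⟨y, hy⟩ := psi_an_b1_sq (k := 1) (w := w) (v := v) hn
  have hb : (bk v : F 1 v) = b1 v := rfl
  rw [rho, cj_one, hb, show 2 ^ 2 = 2 * 2 from rfl, pow_mul, map_pow, hy, pow_two, pair_mul,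
    fg_mul_self, pair_one]

/-- The value of r is 2, 3, 2, 1 in the four cases. For m = 1 triviality of the relator in K(w,v) is
part of the choice; for m = 2 it is computed from its coordinates. -/
theorem IsChoice.setup (h : IsChoice w v s t m) :
    ∃ r, Setup w v s t m r ∧ mapWr (toPG w v s t m) (psi w v (rho v s m)) = 1 := by
  obtain ⟨hψ, ⟨hk, hn, rfl, hs, ht, hK⟩ | ⟨hk, rfl, rfl, hs, ht, hK⟩ |
    ⟨rfl, rfl, rfl, hs, ht, r, hr, hr1, hr2⟩ | ⟨rfl, hn, rfl, rfl, ht⟩⟩ := h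
  · rw [← rho_one] at hK
    have S : Setup w v s t 1 2 := ⟨hψ, by omega, hk, hs, ht, Or.inl rfl, hK⟩
    refine ⟨2, S, mapWr_psi_rho_one S hk ?_⟩
    obtain ⟨e, rfl⟩ := mem_bSub_one hs
    obtain ⟨y, hy, h⟩ := an_eq_succ (k := k) (v := v) hn
    rw [h, map_cj, psi_succGen w v hy, psi_bpow, cj_atc_swpow]
    have hfg : fg y = cj (fg y) (bpow v false : F k v) := by simp [bpow, cj_one]
    cases xor (letter w v y) e
    · refine ⟨fg y, 1, rfl, ?_⟩
      rintro g (rfl | rfl)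
      · exact Or.inr ⟨y, false, hfg⟩
      · exact Or.inl rfl
    · refine ⟨1, fg y, rfl, ?_⟩
      rintro g (rfl | rfl)
      · exact Or.inl rfl
      · exact Or.inr ⟨y, false, hfg⟩
  · rw [← rho_one] at hK
    have S : Setup w v s t 1 3 := ⟨hψ, by omega, hk, hs, ht, Or.inl rfl, hK⟩
    refine ⟨3, S, mapWr_psi_rho_one S (by omega) ?_⟩
    obtain ⟨h₀, m₀, h₁, m₁, e, hse, -⟩ := bSub_decomp (w := w) s t 1 (by omega) hs
    obtain ⟨e₀, rfl⟩ := mem_bSub_one m₀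
    obtain ⟨e₁, rfl⟩ := mem_bSub_one m₁
    have ha : (an v : F k v) = a1 v := rfl
    have key : ∃ x₀ x₁ : Gen k 1, psi w v (an v) = pair (fg x₀) (fg x₁) := by
      rw [ha, psi_a1]
      split_ifs
      · exact ⟨.b _, .a _, rfl⟩
      · exact ⟨.a _, .b _, rfl⟩
    obtain ⟨x₀, x₁, hx⟩ := key
    rw [map_cj, hx, hse, cj_mul, cj_pair_pair]
    cases e
    · refine ⟨_, _, by simp only [swpow, Bool.false_eq_true, if_false, cj_one]; rfl, ?_⟩
      rintro g (rfl | rfl) <;> exact Or.inr ⟨_, _, rfl⟩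
    · refine ⟨_, _, by simp only [swpow, if_true, cj_pair_sw]; rfl, ?_⟩
      rintro g (rfl | rfl) <;> exact Or.inr ⟨_, _, rfl⟩
  · have hpsi := psi_cj_rho_two_one hs hr hr1 hr2 4
    have han : (an v : F 2 v) ^ 4 = 1 := by
      have h2 : (an v : F 2 v) ^ 2 = 1 := by rw [pow_two, an_mul_self]
      rw [show 4 = 2 * 2 from rfl, pow_mul, h2, one_pow]
    have hin : Inner (.b 0 : Gen 2 1) := by change 0 + 1 < 2; omega
    have hbk : (bk v : F 2 v) = fg (succGen (.b 0)) := rfl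
    have hcK : Commute (toK w v (bk v)) (toK w v (cj (bk v) (b1 v))) := by
      rw [← cm_eq_one_iff, ← map_cm]
      refine toK_eq_one_of_pair w v (a := 1) (b := 1) ?_ (map_one _) (map_one _)
      rw [pair_one, map_cm, cm_eq_one_iff, hbk]
      exact psi_comm hin hin (by rw [psi_b1, parity, if_pos rfl]; rfl)
    have hcG : Commute (toPG w v s t 2 (bk v)) (toPG w v s t 2 (cj (bk v) (b1 v))) := by
      rw [hbk]
      exact (toPG_kills w v s t 2).comm 0 _ _ hin hin _ (mem_Delta_b1 v t)
        (by rw [psi_b1, parity, if_pos rfl]; rfl)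
    rw [han] at hpsi
    have hrK : toK w v (rho v s 2) = 1 := by
      have := toK_eq_one_of_pair w v hpsi (map_bk_b1_pow _ hcK) (map_one _)
      rw [map_cj, cj_eq_one_iff] at this
      exact this
    refine ⟨2, ⟨hψ, by omega, le_rfl, hs, ht, Or.inr ⟨rfl, Or.inl ⟨rfl, rfl⟩⟩, hrK⟩, ?_⟩
    have h1 : mapWr (toPG w v s t 2) (psi w v (cj (rho v s 2) r)) = 1 := by
      have hpsi' : psi w v (cj (rho v s 2) r) = _ := hpsi
      rw [hpsi', mapWr_pair, map_bk_b1_pow _ hcG, map_one, pair_one]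
    rw [map_cj, map_cj, cj_eq_one_iff] at h1
    exact h1
  · have hρ := psi_rho_of_k_eq_one (w := w) (v := v) hn
    refine ⟨1, ⟨hψ, le_rfl, le_rfl, one_mem _, ht, Or.inr ⟨rfl, Or.inr ⟨rfl, hn⟩⟩, ?_⟩, ?_⟩
    · exact toK_eq_one_of_pair w v (hρ.trans pair_one.symm) (map_one _) (map_one _)
    · rw [hρ, map_one]

end

/-! ### Finite dihedral groups -/

section Dihedral

variable {G : Type*} [Group G] {x y : G} {N : ℕ}

theorem zpow_cast_add {ρ : G} (h : orderOf ρ = N) (i j : ZMod N) :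
    ρ ^ ((i + j : ZMod N).cast : ℤ) = ρ ^ (i.cast : ℤ) * ρ ^ (j.cast : ℤ) := by
  rw [← zpow_add, zpow_eq_zpow_iff_modEq, h]
  refine (ZMod.intCast_eq_intCast_iff _ _ N).1 ?_
  push_cast
  simp

theorem zpow_cast_neg {ρ : G} (h : orderOf ρ = N) (i : ZMod N) :
    ρ ^ ((-i : ZMod N).cast : ℤ) = (ρ ^ (i.cast : ℤ))⁻¹ := by
  rw [← zpow_neg, zpow_eq_zpow_iff_modEq, h]
  refine (ZMod.intCast_eq_intCast_iff _ _ N).1 ?_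
  push_cast
  simp

theorem mul_zpow_mul_of_involutions (hx : x * x = 1) (hy : y * y = 1) (l : ℤ) :
    x * (x * y) ^ l * x = ((x * y) ^ l)⁻¹ := by
  have hx' := inv_eq_of_mul_eq_one_right hx
  have hy' := inv_eq_of_mul_eq_one_right hy
  have h : MulAut.conj x (x * y) = (x * y)⁻¹ := by
    rw [MulAut.conj_apply, mul_inv_rev, hx', hy', ← mul_assoc, hx, one_mul]
  have := map_zpow (MulAut.conj x) (x * y) l
  rw [h, inv_zpow, MulAut.conj_apply, hx'] at this
  exact this

/-- The homomorphism from a dihedral group given by two involutions. -/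
def dihedralHom (hx : x * x = 1) (hy : y * y = 1) (hN : orderOf (x * y) = N) :
    DihedralGroup N →* G where
  toFun
    | .r i => (x * y) ^ (i.cast : ℤ)
    | .sr i => x * (x * y) ^ (i.cast : ℤ)
  map_one' := by
    change (x * y) ^ ((0 : ZMod N).cast : ℤ) = 1
    simp
  map_mul' := by
    have hc := mul_zpow_mul_of_involutions hx hy
    have hc' : ∀ l : ℤ, (x * y) ^ l * x = x * ((x * y) ^ l)⁻¹ := by
      intro l
      rw [← hc l, mul_assoc x, ← mul_assoc, hx, one_mul]
    rintro (i | i) (j | j)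
    · exact zpow_cast_add hN i j
    · change x * (x * y) ^ ((j - i : ZMod N).cast : ℤ) = _ * (x * _)
      rw [← mul_assoc, hc', mul_assoc, sub_eq_neg_add, zpow_cast_add hN, zpow_cast_neg hN]
    · change x * (x * y) ^ ((i + j : ZMod N).cast : ℤ) = x * _ * _
      rw [zpow_cast_add hN, mul_assoc]
    · change (x * y) ^ ((j - i : ZMod N).cast : ℤ) = x * _ * (x * _)
      rw [← mul_assoc, hc, sub_eq_neg_add, zpow_cast_add hN, zpow_cast_neg hN]

theorem closure_pair_equiv_dihedral (hx : x * x = 1) (hy : y * y = 1)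
    (hN : orderOf (x * y) = N) (h2 : 2 < N) :
    Nonempty (Subgroup.closure {x, y} ≃* DihedralGroup N) := by
  set f := dihedralHom hx hy hN with hf
  have hr : ∀ i, f (.r i) = (x * y) ^ (i.cast : ℤ) := fun _ => rfl
  have hsr : ∀ i, f (.sr i) = x * (x * y) ^ (i.cast : ℤ) := fun _ => rfl
  have hinj : Function.Injective f := by
    rw [injective_iff_map_eq_one]
    rintro (i | i) h
    · rw [hr, ← zpow_zero (x * y), zpow_eq_zpow_iff_modEq, hN] at h
      have := (ZMod.intCast_eq_intCast_iff _ _ N).2 h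
      simp only [ZMod.intCast_cast, ZMod.cast_id', id_eq, Int.cast_zero] at this
      rw [this]
      rfl
    -- If x were a power of xy it would commute with xy. It also inverts xy, so (xy)² would be 1,
    -- against N > 2.
    · exfalso
      rw [hsr] at h
      have hxz : x = (x * y) ^ (-(i.cast : ℤ)) := by
        rw [zpow_neg, eq_inv_iff_mul_eq_one]; exact h
      have hcomm : Commute x (x * y) := by
        have : Commute ((x * y) ^ (-(i.cast : ℤ))) (x * y) := (Commute.refl _).zpow_left _
        rwa [← hxz] at this
      have h1 := mul_zpow_mul_of_involutions hx hy 1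
      rw [zpow_one, hcomm.eq, mul_assoc, hx, mul_one, eq_inv_iff_mul_eq_one, ← pow_two] at h1
      have := Nat.le_of_dvd two_pos (orderOf_dvd_of_pow_eq_one h1)
      omega
  have hrange : f.range = Subgroup.closure {x, y} := by
    have mx : x ∈ Subgroup.closure {x, y} := Subgroup.subset_closure (Or.inl rfl)
    have my : y ∈ Subgroup.closure {x, y} := Subgroup.subset_closure (Or.inr rfl)
    apply le_antisymm
    · rintro _ ⟨i | i, rfl⟩
      · rw [hr]; exact zpow_mem (mul_mem mx my) _
      · rw [hsr]; exact mul_mem mx (zpow_mem (mul_mem mx my) _)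
    · rw [Subgroup.closure_le]
      have h0 : x ∈ f.range := ⟨.sr 0, by rw [hsr]; simp⟩
      have h1 : x * y ∈ f.range := by
        refine ⟨.r 1, ?_⟩
        have h1 : (x * y) ^ ((1 : ZMod N).cast : ℤ) = (x * y) ^ (1 : ℤ) := by
          rw [zpow_eq_zpow_iff_modEq, hN]
          refine (ZMod.intCast_eq_intCast_iff _ _ N).1 ?_
          simp
        rw [hr, h1, zpow_one]
      rintro _ (rfl | rfl)
      · exact h0
      · have := mul_mem h0 h1
        rwa [← mul_assoc, hx, one_mul] at this
  exact ⟨((MonoidHom.ofInjective hinj).trans (MulEquiv.subgroupCongr hrange)).symm⟩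

end Dihedral

section

variable {k n : ℕ} [NeZero k] [NeZero n] {w : Fin k → Bool} {v : Fin n → Bool}
  {s t : F k v} {m r : ℕ}

/-! ### The presentation -/

theorem toK_surjective : Function.Surjective (toK w v) := by
  rintro ⟨g, hg⟩
  have h : K w v ≤ (toK w v).range.map (K w v).subtype := by
    refine (Subgroup.closure_le _).2 ?_
    rintro _ ⟨x, rfl⟩
    exact ⟨_, ⟨fg x, toK_fg w v x⟩, rfl⟩
  obtain ⟨_, ⟨y, rfl⟩, hy⟩ := h hg
  exact ⟨y, Subtype.ext hy⟩

theorem IsChoice.toPG_eq_one_iff (h : IsChoice w v s t m) (g : F k v) :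
    toPG w v s t m g = 1 ↔ toK w v g = 1 := by
  obtain ⟨r, S, hA⟩ := h.setup
  exact ⟨toK_eq_one_of_toPG S, toPG_eq_one_of_toK fun _ => toPG_eq_one_of_psi S hA⟩

theorem IsChoice.exists_equiv (h : IsChoice w v s t m) :
    ∃ e : PG w v s t m ≃* K w v, ∀ x : Gen k n, e (PresentedGroup.of x) = gen w v x := by
  have hlift : ∀ r, FreeGroup.lift (gen w v) r = toK w v (PresentedGroup.mk _ r) := by
    intro r
    have : FreeGroup.lift (gen w v) = (toK w v).comp (PresentedGroup.mk _) := by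
      ext1 x
      rw [FreeGroup.lift_apply_of]
      exact (toK_fg w v x).symm
    rw [this]; rfl
  have hrel : ∀ r ∈ presRels w v s t m, FreeGroup.lift (gen w v) r = 1 := by
    intro r hr
    rw [hlift, ← h.toPG_eq_one_iff, toPG_mk]
    exact PresentedGroup.one_of_mem hr
  set f : PG w v s t m →* K w v := PresentedGroup.toGroup hrel with hf
  have hcomp : ∀ g, f (toPG w v s t m g) = toK w v g := by
    intro g
    have : f.comp (toPG w v s t m) = toK w v := by
      apply F_hom_ext
      intro x
      rw [MonoidHom.comp_apply, toPG_fg, toK_fg]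
      exact PresentedGroup.toGroup.of _
    rw [← this]; rfl
  have hbij : Function.Bijective f := by
    constructor
    · rw [injective_iff_map_eq_one]
      intro x hx
      obtain ⟨r, rfl⟩ := PresentedGroup.mk_surjective _ x
      rw [← toPG_mk, hcomp] at hx
      rw [← toPG_mk]
      exact (h.toPG_eq_one_iff _).2 hx
    · intro y
      obtain ⟨g, rfl⟩ := toK_surjective y
      exact ⟨_, hcomp g⟩
  exact ⟨MulEquiv.ofBijective f hbij, fun _ => PresentedGroup.toGroup.of hrel⟩

/-! ### Matched choices -/

theorem par_b1_of_psi_right {g : F k v} (h : (psi w v g).right = 1) :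
    par v (.b (firstPos k)) g = 1 := by
  obtain ⟨a, b, e, hg⟩ := exists_eq_pair (psi w v g)
  rw [par_b1_eq w v hg]
  rw [hg, SemidirectProduct.mul_right, pair_right, one_mul, swpow_right] at h
  cases e
  · simp
  · exact absurd h boolNot_ne_one

theorem Setup.par_t (S : Setup w v s t m r) :
    par v (.b (firstPos k)) t = if v (lastPos n) then 1 else -1 := by
  obtain ⟨a, b, e, ht⟩ := exists_eq_pair (psi w v t)
  rw [par_b1_eq w v ht]
  have h := S.psiA
  rw [map_cj, ht, psi_a1, cj_mul] at h
  generalize v (lastPos n) = c at h ⊢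
  cases c <;> cases e <;>
    simp only [swpow, if_true, if_false, Bool.false_eq_true, cj_pair_pair, cj_one,
      cj_pair_sw] at h ⊢
  · have := (pair_inj h).1
    rw [← cj_one (bk v)] at this
    exact absurd this (cj_an_ne_bk _ _)
  · have := (pair_inj h).1
    rw [← cj_one (bk v)] at this
    exact absurd this (cj_an_ne_bk _ _)

/-- Since φ(s) fixes the first letter, it has an even number of factors b_1, and by `Setup.par_t`
the parity for t depends on x_n. So φ(s) is t b_1 if x_n = 0 and b_1 t b_1 if x_n = 1; either way
b_1^{x_n} φ(s) = t b_1, now in F itself. -/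
theorem Setup.phi_an_of_matched (S : Setup w v s t m r) (h : IsMatched w v s t) :
    phi w v t (cj (an v) s) = cj (cj (a1 v) t) (b1 v) := by
  have hφ : par v (.b (firstPos k)) (phi w v t s) = 1 := by
    apply par_b1_of_psi_right (w := w)
    rw [psi_phi S.psiA]; rfl
  have hb : par v (.b (firstPos k)) (b1 v : F k v) = -1 := par_fg_self v _
  have ht := S.par_t
  rw [map_cj, phi_an, ← cj_mul, ← cj_mul]
  rcases h with h | h
  · rw [h, map_mul, hb, ht] at hφ
    cases hv : v (lastPos n)
    · rw [h]; simp [bpow]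
    · rw [hv] at hφ; simp at hφ
  · rw [h, map_mul, map_mul, hb, ht] at hφ
    cases hv : v (lastPos n)
    · rw [hv] at hφ; simp at hφ
    · have hb' : (bpow v true : F k v) = b1 v := rfl
      rw [h, hb', mul_assoc, ← mul_assoc, b1_mul_self, one_mul]

/-! ### The order of a_1^t b_1, and finiteness of R. -/

theorem toK_pair_ne_one {g a b : F k v} (h : psi w v g = pair a b)
    (hab : toK w v a ≠ 1 ∨ toK w v b ≠ 1) : toK w v g ≠ 1 := by
  intro hg
  obtain ⟨h1, h2, -⟩ := toK_pair_of_eq_one w v (e := false) (h.trans (mul_one _).symm) hg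
  rcases hab with h | h
  · exact h h1
  · exact h h2

/-- This makes 2^m the exact order of a_n^s b_k in K(w,v). For m = 1 a parity suffices; for m = 2
the square, up to conjugation, has a coordinate that is nontrivial by a parity one or two levels
down. -/
theorem IsChoice.toK_pow_ne_one (h : IsChoice w v s t m) :
    1 ≤ m ∧ toK w v ((cj (an v) s * bk v) ^ 2 ^ (m - 1)) ≠ 1 := by
  have h1 : toK w v (cj (an v) s * bk v) ≠ 1 := by
    intro h
    have : (bk v)⁻¹ = (bk v : F k v) := inv_eq_of_mul_eq_one_right bk_mul_self
    rw [map_mul, mul_eq_one_iff_eq_inv, ← map_inv, this, ← cj_one (bk v)] at h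
    exact toK_cj_an_ne_bk _ _ h
  obtain ⟨hψ, ⟨hk, hn, rfl, hs, ht, hK⟩ | ⟨hk, rfl, rfl, hs, ht, hK⟩ |
    ⟨rfl, rfl, rfl, hs, ht, r, hr, hr1, hr2⟩ | ⟨rfl, hn, rfl, rfl, ht⟩⟩ := h
  · refine ⟨le_rfl, ?_⟩
    simpa using h1
  · refine ⟨le_rfl, ?_⟩
    simpa using h1
  · refine ⟨by omega, ?_⟩
    have hpsi := psi_cj_rho_two_one hs hr hr1 hr2 2
    have hin : Inner (.b 0 : Gen 2 1) := by change 0 + 1 < 2; omega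
    have hbk : (bk v : F 2 v) = fg (succGen (.b 0)) := rfl
    have h2 : toK w v ((bk v * b1 v : F 2 v) ^ 2) ≠ 1 := by
      have h3 : psi w v ((bk v * b1 v : F 2 v) ^ 2) = pair (b1 v) (b1 v) := by
        rw [map_pow, map_mul, hbk, psi_succGen w v hin, psi_b1]
        exact atc_mul_sw_sq _ _
      exact toK_pair_ne_one h3 (Or.inl (toK_ne_one_fg _))
    intro h4
    apply toK_pair_ne_one hpsi (Or.inl h2)
    rw [map_cj, cj_eq_one_iff]
    simpa using h4
  · refine ⟨by omega, ?_⟩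
    obtain ⟨y, hy⟩ := psi_an_b1_sq (k := 1) (w := w) (v := v) hn
    have h2 := toK_pair_ne_one hy (Or.inl (toK_ne_one_fg _))
    have hb : (bk v : F 1 v) = b1 v := rfl
    rw [cj_one, hb]
    simpa using h2

theorem toFbar_eq_one_toK (S : Setup w v s t m r) {g : F k v} (h : toFbar w v s t m g = 1) :
    toK w v g = 1 := by
  have hg : g ∈ barKer w v s t m := (QuotientGroup.eq_one_iff _).1 h
  have : barKer w v s t m ≤ (toK w v).ker := by
    refine Subgroup.normalClosure_le_normal ?_
    rintro x ⟨l, rfl⟩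
    have := (toK_kills S).rho l
    rw [rho, map_pow, phiIt_eq] at this
    exact this
  exact this hg

theorem sq_A_mul_b1 : (cj (a1 v) t * b1 v) ^ 2 = cj (a1 v) t * cj (cj (a1 v) t) (b1 v : F k v) := by
  rw [cj.eq_1 _ (b1 v), b1_inv, pow_two]
  simp only [mul_assoc]

theorem IsChoice.orderOf_A_mul_b1 (h : IsChoice w v s t m) (hm : IsMatched w v s t) :
    orderOf (toFbar w v s t m (cj (a1 v) t) * toFbar w v s t m (b1 v)) = 2 ^ (m + 1) := by
  obtain ⟨r, S, -⟩ := h.setup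
  obtain ⟨hm1, hne⟩ := h.toK_pow_ne_one
  have hinv : bk v * cj (an v) s = (cj (an v) s * bk v : F k v)⁻¹ := by
    rw [mul_inv_rev, inv_eq_of_mul_eq_one_right bk_mul_self,
      inv_eq_of_mul_eq_one_right (cj_mul_self an_mul_self s)]
  rw [← map_mul]
  apply orderOf_eq_prime_pow
  · intro hcon
    rw [← map_pow] at hcon
    have h1 := toFbar_eq_one_toK S hcon
    obtain ⟨l, rfl⟩ := Nat.exists_eq_add_of_le hm1
    have h2 : psi w v ((cj (a1 v) t * b1 v) ^ 2 ^ (1 + l)) =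
        pair ((bk v * cj (an v) s) ^ 2 ^ l) ((cj (an v) s * bk v) ^ 2 ^ l) := by
      have hpow : ∀ (x y : F k v) (l : ℕ), pair x y ^ l = pair (x ^ l) (y ^ l) := by
        intro x y l
        induction l with
        | zero => simp [pair_one]
        | succ l ih => rw [pow_succ, ih, pair_mul, ← pow_succ, ← pow_succ]
      rw [pow_add, pow_one, pow_mul, sq_A_mul_b1, map_pow, map_mul, map_cj _ _ (b1 v), psi_b1,
        S.psiA, cj_pair_sw, pair_mul, hpow]
    refine toK_pair_ne_one h2 (Or.inr ?_) h1
    simpa using hne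
  -- The square is a_1^t (a_1^t)^{b_1} = φ(b_k) φ(a_n^s), so this power is the inverse of the ℓ = 1
  -- relator of F̄.
  · have h1 : (cj (a1 v) t * b1 v) ^ 2 ^ (m + 1) = (phi w v t (rho v s m))⁻¹ := by
      rw [pow_succ', pow_mul, sq_A_mul_b1, ← S.phi_an_of_matched hm, ← phi_bk w v t, ← map_mul,
        hinv, rho, map_inv, map_pow, inv_pow]
    rw [← map_pow, h1, map_inv, inv_eq_one]
    refine (QuotientGroup.eq_one_iff _).2 (Subgroup.subset_normalClosure ⟨1, ?_⟩)
    rw [rho, map_pow]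
    rfl

theorem IsChoice.dih_equiv (h : IsChoice w v s t m) (hm : IsMatched w v s t) :
    Nonempty (dih w v s t m ≃* DihedralGroup (2 ^ (m + 1))) := by
  obtain ⟨hm1, -⟩ := h.toK_pow_ne_one
  refine closure_pair_equiv_dihedral ?_ ?_ (h.orderOf_A_mul_b1 hm) ?_
  · rw [← map_mul, cj_a1_mul_self, map_one]
  · rw [← map_mul, b1_mul_self, map_one]
  · calc 2 < 2 ^ 2 := by norm_num
      _ ≤ 2 ^ (m + 1) := Nat.pow_le_pow_right two_pos (by omega)

theorem finite_gen : Finite (Gen k n) :=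
  Finite.of_injective (β := Fin n ⊕ Fin k)
    (fun x => match x with
      | .a i => .inl i
      | .b j => .inr j)
    (by rintro (i | i) (j | j) h <;> simp_all)

theorem setR_finite (h : Finite (dih w v s t m)) : (setR w v s t m).Finite := by
  have := finite_gen (k := k) (n := n)
  refine (Set.finite_range (fun p : Gen k n × Gen k n × dih w v s t m =>
    cm (toFbar w v s t m (fg (succGen p.1)))
      (cj (toFbar w v s t m (fg (succGen p.2.1))) p.2.2.1))).subset ?_
  intro x hx
  obtain ⟨y, z, -, -, u, hu, -, rfl⟩ := exists_of_mem_setR w v hx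
  have hu' : toFbar w v s t m u ∈ dih w v s t m := by
    have := Subgroup.mem_map_of_mem (toFbar w v s t m) hu
    rw [Delta, MonoidHom.map_closure, Set.image_pair] at this
    exact this
  exact ⟨(y, z, ⟨_, hu'⟩), by rw [map_cm, map_cj]⟩

/-! ### Existence of matched choices -/

/-- The element t enters φ only through φ(b_k), and s does not involve b_k. Thus φ(s) is known
before t, and the matching condition can be solved for t; Ψ(φ(s)) = ⟨s, 1⟩ then gives the required
Ψ(a_1^t). -/
theorem exists_matched (hr1 : 1 ≤ r) (hr : r ≤ k) (hs : s ∈ bSub v (r - 1)) :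
    ∃ t ∈ bSub (k := k) v r, psi w v (cj (a1 v) t) = pair (bk v) (cj (an v) s) ∧
      IsMatched w v s t := by
  have hs' : s ∈ bSub (k := k) v (k - 1) := bSub_mono (by omega) hs
  have hindep : ∀ t, phi w v t s = phi w v 1 s := by
    intro t
    refine bSub_induction (p := fun s => phi w v t s = phi w v 1 s) (by simp) ?_ hs'
    intro g _ j hj ih
    have h1 : phi w v t (fb v j) = _ := phi_inner w v t (inner_b hj)
    have h2 : phi w v 1 (fb v j) = _ := phi_inner w v 1 (inner_b hj)
    rw [map_mul, map_mul, ih, h1, h2]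
  have hψ := psi_phi_bSub (w := w) 1 hs'
  have hmem : phi w v 1 s ∈ bSub (k := k) v r := phi_bSub hr hs
  have hb := b1_mem_bSub (k := k) (v := v) hr1
  cases hv : v (lastPos n)
  · refine ⟨phi w v 1 s * b1 v, mul_mem hmem hb, ?_, Or.inl ?_⟩
    · rw [map_cj, psi_a1, hv, map_mul, hψ, psi_b1]
      simp [cj_mul, cj_pair_pair, cj_pair_sw, cj_one]
    · rw [hindep, mul_assoc, b1_mul_self, mul_one]
  · refine ⟨b1 v * phi w v 1 s * b1 v, mul_mem (mul_mem hb hmem) hb, ?_, Or.inr ?_⟩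
    · rw [map_cj, psi_a1, hv, map_mul, map_mul, hψ, psi_b1]
      simp [cj_mul, cj_pair_pair, cj_pair_sw, cj_one]
    · rw [hindep]
      change _ = b1 v * (b1 v * _ * b1 v) * b1 v
      rw [mul_assoc (b1 v) (phi w v 1 s), ← mul_assoc (b1 v) (b1 v), b1_mul_self, one_mul,
        mul_assoc, b1_mul_self, mul_one]

theorem commute_atc_not {G : Type} [Group G] (c : Bool) (g h : G) :
    Commute (atc (!c) g) (atc c h) := by
  cases c <;>
    · change _ * _ = _ * _
      simp [atc, pair_mul]

theorem toK_cm_of_psi {g h : F k v} (hc : Commute (psi w v g) (psi w v h)) :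
    toK w v (cm g h) = 1 := by
  refine toK_eq_one_of_pair w v (a := 1) (b := 1) ?_ (map_one _) (map_one _)
  rw [pair_one, map_cm, cm_eq_one_iff]
  exact hc

theorem exists_isChoice (hkn : (k, n) ≠ (1, 1)) :
    ∃ (s t : F k v) (m : ℕ), IsChoice w v s t m ∧ IsMatched w v s t := by
  have hk0 := NeZero.pos k
  have hn0 := NeZero.pos n
  have hcases : (2 ≤ k ∧ 2 ≤ n) ∨ (3 ≤ k ∧ n = 1) ∨ (k = 2 ∧ n = 1) ∨ (k = 1 ∧ 2 ≤ n) := by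
    have : ¬ (k = 1 ∧ n = 1) := fun h => hkn (by rw [h.1, h.2])
    omega
  rcases hcases with ⟨hk, hn⟩ | ⟨hk, rfl⟩ | ⟨rfl, rfl⟩ | ⟨rfl, hn⟩
  · obtain ⟨y, hy, han⟩ := an_eq_succ (k := k) (v := v) hn
    obtain ⟨hin, hbk⟩ := bk_eq_succ (n := n) (v := v) hk
    set z : Gen k n := .b ⟨k - 2, by omega⟩ with hz
    -- This power of b_1 moves the nontrivial coordinate of a_n to the one where b_k is trivial.
    set s : F k v := bpow v (xor (letter w v y) (!(letter w v z))) with hs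
    have hsm : s ∈ bSub (k := k) v 1 := bpow_mem_bSub le_rfl _
    obtain ⟨t, ht, h1, h2⟩ := exists_matched (w := w) (r := 2) (by omega) hk hsm
    refine ⟨s, t, 1, ⟨h1, Or.inl ⟨hk, hn, rfl, hsm, ht, ?_⟩⟩, h2⟩
    apply toK_cm_of_psi
    change Commute (psi w v (cj (an v) s)) (psi w v (bk v))
    rw [han, hbk, map_cj, psi_succGen w v hy, psi_succGen w v hin, hs, psi_bpow, cj_atc_swpow]
    have : (xor (letter w v y) (xor (letter w v y) (!(letter w v z)))) = !(letter w v z) := by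
      cases letter w v y <;> cases letter w v z <;> rfl
    rw [this]
    exact commute_atc_not _ _ _
  · obtain ⟨hin, hbk⟩ := bk_eq_succ (n := 1) (v := v) (k := k) (by omega)
    set z : Gen k 1 := .b ⟨k - 2, by omega⟩ with hz
    have h3 : k - 3 + 1 < k := by omega
    have hin' : Inner (.b ⟨k - 3, by omega⟩ : Gen k 1) := h3
    set z' : Gen k 1 := .b ⟨k - 3, by omega⟩ with hz'
    have hzz : (fg z : F k v) = fg (succGen z') := by
      rw [← fb_succ v h3]
      exact congrArg (fb v) (Fin.ext (by simp only; omega))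
    have hψ := psi_succGen w v hin
    rw [← hbk] at hψ
    have hψ' := psi_succGen w v hin'
    rw [← hzz] at hψ'
    set c := letter w v z with hc
    set c' := letter w v z' with hc'
    have hin0 : Inner (.b ⟨0, by omega⟩ : Gen k 1) := by change 0 + 1 < k; omega
    set z0 : Gen k 1 := .b ⟨0, by omega⟩ with hz0
    have hb2 : fb v ⟨0 + 1, by omega⟩ = (fg (succGen z0) : F k v) := fb_succ v _
    -- In coordinate c, where b_k has b_{k-1}, the element b_k will have to be conjugated by a power
    -- of b_1 so that its support becomes disjoint from that of b_{k-1}. A suitable conjugate of b_2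
    -- has b_1 at that coordinate.
    obtain ⟨g, hg, hgψ⟩ : ∃ g ∈ bSub (k := k) v 2,
        psi w v g = atc c (bpow v (xor c (!c'))) := by
      cases xor c (!c')
      · refine ⟨1, one_mem _, ?_⟩
        cases c <;> simp [bpow, atc, pair_one]
      · refine ⟨cj (fb v ⟨0 + 1, by omega⟩) (bpow v (xor (letter w v z0) c)), ?_, ?_⟩
        · have hb : bpow v (xor (letter w v z0) c) ∈ bSub (k := k) v 2 :=
            bpow_mem_bSub (by omega) _
          exact mul_mem (mul_mem (inv_mem hb) (fb_mem_bSub (by simp))) hb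
        · rw [hb2, map_cj, psi_succGen w v hin0, psi_bpow, cj_atc_swpow]
          have : (xor (letter w v z0) (xor (letter w v z0) c)) = c := by
            cases letter w v z0 <;> cases c <;> rfl
          rw [this]
          rfl
    -- The power of b_1 brings the coordinate b_k of a_1 to position c; then g conjugates it there.
    set s : F k v := bpow v (xor (v (lastPos 1)) (!c)) * g with hs
    have hsm : s ∈ bSub (k := k) v 2 := mul_mem (bpow_mem_bSub (by omega) _) hg
    obtain ⟨t, ht, h1, h2⟩ := exists_matched (w := w) (r := 3) (by omega) hk hsm
    refine ⟨s, t, 1, ⟨h1, Or.inr (Or.inl ⟨hk, rfl, rfl, hsm, ht, ?_⟩)⟩, h2⟩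
    have hcomm : toK w v (cm (cj (bk v) (bpow v (xor c (!c')))) (fg z)) = 1 := by
      apply toK_cm_of_psi
      rw [map_cj, hψ, hψ', psi_bpow, cj_atc_swpow]
      have : (xor c (xor c (!c'))) = !c' := by cases c <;> cases c' <;> rfl
      rw [this]
      exact commute_atc_not _ _ _
    have hxc : (xor (v (lastPos 1)) (xor (v (lastPos 1)) (!c))) = !c := by
      cases v (lastPos 1) <;> cases c <;> rfl
    have hψs : psi w v (cj (an v) s) = cj (if !c then pair (bk v) (an v) else pair (an v) (bk v))
        (atc c (bpow v (xor c (!c')))) := by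
      have ha : (an v : F k v) = a1 v := rfl
      rw [ha, hs, cj_mul, map_cj, psi_cj_a1_bpow, hxc, hgψ, ha]
    change toK w v (cm (cj (an v) s) (bk v)) = 1
    have cm1 : ∀ g : F k v, cm g 1 = 1 := fun g => by simp [cm]
    have cmp : ∀ a b c d : F k v, cm (pair a b) (pair c d) = pair (cm a c) (cm b d) := by
      intro a b c d
      simp [cm, pair_mul, pair_inv]
    generalize c = c₀ at *
    cases c₀
    · refine toK_eq_one_of_pair w v (b := 1) ?_ hcomm (map_one _)
      rw [map_cm, hψs, hψ]
      simp only [atc, Bool.not_false, Bool.false_eq_true, if_true, if_false, cj_pair_pair, cmp,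
        cm1, cj_one]
    · refine toK_eq_one_of_pair w v (a := 1) ?_ (map_one _) hcomm
      rw [map_cm, hψs, hψ]
      simp only [atc, Bool.not_true, Bool.false_eq_true, if_true, if_false, cj_pair_pair, cmp,
        cm1, cj_one]
  · set r₀ : F 2 v := bpow v (w 0) with hr₀
    -- Here r₀ moves the coordinate b_1 of b_2 to position 0, and s is determined by r₀ s = b_1^{1 -
    -- x_n}, which puts b_2 first among the coordinates of a_1.
    set s : F 2 v := r₀ * bpow v (!(v (lastPos 1))) with hs
    have hr₀m : r₀ ∈ bSub (k := 2) v 1 := bpow_mem_bSub le_rfl _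
    have hsm : s ∈ bSub (k := 2) v 1 := mul_mem hr₀m (bpow_mem_bSub le_rfl _)
    obtain ⟨t, ht, h1, h2⟩ := exists_matched (w := w) (r := 2) (by omega) le_rfl hsm
    refine ⟨s, t, 2, ⟨h1, Or.inr (Or.inr (Or.inl ⟨rfl, rfl, rfl, hsm, ht, r₀, hr₀m, ?_, ?_⟩))⟩, h2⟩
    · have hin : Inner (.b 0 : Gen 2 1) := by change 0 + 1 < 2; omega
      have hbk : (bk v : F 2 v) = fg (succGen (.b 0)) := rfl
      change psi w v (cj (bk v) r₀) = _
      rw [hbk, map_cj, psi_succGen w v hin, hr₀, psi_bpow, cj_atc_swpow]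
      simp only [letter, Bool.xor_self]
      rfl
    · have h3 : r₀ * s = bpow v (!(v (lastPos 1))) := by
        rw [hs, ← mul_assoc, hr₀, bpow_mul_self, one_mul]
      change psi w v (cj (a1 v) (r₀ * s)) = pair (bk v) (an v)
      rw [h3, psi_cj_a1_bpow]
      simp
  · obtain ⟨t, ht, h1, h2⟩ := exists_matched (w := w) (v := v) (s := 1) (r := 1) le_rfl le_rfl
      (one_mem _)
    exact ⟨1, t, 2, ⟨h1, Or.inr (Or.inr (Or.inr ⟨rfl, hn, rfl, rfl, ht⟩))⟩, h2⟩

end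

end KneadingGroup

end

theorem mainTheorem8 {k n : ℕ} [NeZero k] [NeZero n] (w : Fin k → Bool) (v : Fin n → Bool)
    (hlast : w (KneadingGroup.lastPos k) ≠ v (KneadingGroup.lastPos n))
    (hkn : (k, n) ≠ (1, 1)) :
    (∃ (s t : KneadingGroup.F k v) (m : ℕ),
      KneadingGroup.IsChoice w v s t m ∧ KneadingGroup.IsMatched w v s t) ∧
    ∀ (s t : KneadingGroup.F k v) (m : ℕ), KneadingGroup.IsChoice w v s t m →
      (∃ e : PresentedGroup (KneadingGroup.presRels w v s t m) ≃* KneadingGroup.K w v,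
        ∀ g : KneadingGroup.Gen k n, e (PresentedGroup.of g) = KneadingGroup.gen w v g) ∧
      (KneadingGroup.IsMatched w v s t →
        Nonempty (KneadingGroup.dih w v s t m ≃* DihedralGroup (2 ^ (m + 1))) ∧
        (KneadingGroup.setR w v s t m).Finite) := by
  refine ⟨KneadingGroup.exists_isChoice hkn, fun s t m h => ⟨h.exists_equiv, fun hm => ?_⟩⟩
  obtain ⟨e⟩ := h.dih_equiv hm
  exact ⟨⟨e⟩, KneadingGroup.setR_finite (Finite.of_equiv _ e.symm.toEquiv)⟩
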